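/- Let $k$ be a field of characteristic zero and $R=k[x_0,x_1,x_2,x_3]$. Let $F=\ell_1\cdots\ell_m$ ($m\ge 1$) be a product of pairwise linearly independent linear forms, so that $F$ defines an arrangement of $m$ distinct planes in $\mathbb P^3$. For a form $G$ let $J_G=\langle \partial G/\partial x_0,\dots,\partial G/\partial x_3\rangle$ be its Jacobian ideal; let $\overline C_G$ be the subscheme of $\mathbb P^3$ defined by the intersection $\overline{J_G}$ of the height two primary ideals in a minimal primary decomposition of $J_G$, and let $C_G^{red}$ be the subscheme defined by $\sqrt{J_G}$. Write $I_C\subseteq R$ for the saturated homogeneous ideal of a subscheme $C\subseteq\mathbb P^3$, and $M(C)=\bigoplus_{t\in\mathbb Z}H^1(\mathbb P^3,\mathcal I_C(t))$ for its Hartshorne–Rao module; $N(-1)$ denotes the graded module with $N(-1)_t=N_{t-1}$. Call $C$ arithmetically Cohen–Macaulay (ACM) if $R/I_C$ is a Cohen–Macaulay ring. Two subschemes $C,C'$ are linked if there is a regular sequence of two forms $f,g\in I_C\cap I_{C'}$ with $(f,g):I_C=I_{C'}$ and $(f,g):I_{C'}=I_C$; they are in the same even liaison class if they are joined by a chain of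 an even number of links. Let $L$ be a linear form that does not vanish on any component of $C_F^{red}$; if $m=1$ (in which case $C_F^{red}$ is empty) assume moreover that $L$ and $F$ are linearly independent. Then: (i) $M(\overline C_{LF})\cong M(\overline C_F)(-1)$ and $M(C_{LF}^{red})\cong M(C_F^{red})(-1)$ as graded $R$-modules. (ii) $I_{\overline C_{LF}}=L\cdot I_{\overline C_F}+(F)$ and $I_{C_{LF}^{red}}=L\cdot I_{C_F^{red}}+(F)$. (iii) $\overline C_{LF}$ is ACM if and only if $\overline C_F$ is ACM, and $C_{LF}^{red}$ is ACM if and only if $C_F^{red}$ is ACM. Moreover $\overline C_{LF}$ is in the same even liaison class as $\overline C_F$, and $C_{LF}^{red}$ is in the same even liaison class as $C_F^{red}$. (The empty subscheme, with saturated ideal $R$, is allowed; it counts as ACM.) -/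

import Mathlib

noncomputable section

namespace ArrCurve

open MvPolynomial

/-- The homogeneous coordinate ring `k[x₀, x₁, x₂, x₃]` of projective 3-space. -/
abbrev CoordRing (k : Type*) [Field k] : Type _ := MvPolynomial (Fin 4) k

/-- The function field `k(x₀, x₁, x₂, x₃)` of the affine cone. -/
abbrev Frac (k : Type*) [Field k] : Type _ := FractionRing (CoordRing k)

section Ideals

variable {k : Type*} [Field k]

/-- The Jacobian ideal of `F`, generated by the partial derivatives of `F`. -/
def jacobianIdeal (F : CoordRing k) : Ideal (CoordRing k) :=
  Ideal.span (Set.range fun i : Fin 4 => pderiv i F)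

/-- The irrelevant maximal ideal `(x₀, x₁, x₂, x₃)`. -/
def irrelevantIdeal (k : Type*) [Field k] : Ideal (CoordRing k) :=
  Ideal.span (Set.range (X : Fin 4 → CoordRing k))

/-- The saturation `⋃ₙ (I : 𝔪ⁿ)` of an ideal with respect to the irrelevant ideal `𝔪`. For
homogeneous `I` this is the saturated homogeneous ideal of the closed subscheme of projective
3-space defined by `I`. -/
def saturation (I : Ideal (CoordRing k)) : Ideal (CoordRing k) where
  carrier := {f | ∃ n : ℕ, ∀ g ∈ irrelevantIdeal k ^ n, g * f ∈ I}
  zero_mem' := ⟨0, fun g _ => by simp⟩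
  add_mem' := by
    rintro f₁ f₂ ⟨n₁, h₁⟩ ⟨n₂, h₂⟩
    refine ⟨n₁ + n₂, fun g hg => ?_⟩
    rw [mul_add]
    exact I.add_mem (h₁ g (Ideal.pow_le_pow_right (Nat.le_add_right _ _) hg))
      (h₂ g (Ideal.pow_le_pow_right (Nat.le_add_left _ _) hg))
  smul_mem' := by
    rintro c f ⟨n, h⟩
    refine ⟨n, fun g hg => ?_⟩
    rw [smul_eq_mul, mul_left_comm]
    exact I.mul_mem_left c (h g hg)

/-- The top-dimensional part of an ideal `J` of height at least two: the intersection of the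
primary ideals of height two in a minimal primary decomposition of `J`. If `J` has height at least
two then these components are isolated, hence the same in every such decomposition; the empty
intersection is the unit ideal. -/
def topDimPart (J : Ideal (CoordRing k)) : Ideal (CoordRing k) :=
  sInf {q | ∃ t : Finset (Ideal (CoordRing k)),
    Submodule.IsMinimalPrimaryDecomposition J t ∧ q ∈ t ∧ q.radical.height = 2}

/-- The saturated homogeneous ideal of the curve `C̄_F`, the scheme defined by the top-dimensional
part of the Jacobian ideal of `F`. -/
def topCurveIdeal (F : CoordRing k) : Ideal (CoordRing k) :=
  saturation (topDimPart (jacobianIdeal F))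

/-- The saturated homogeneous ideal of the curve `C_F^red`, the scheme defined by the radical of
the Jacobian ideal of `F`. -/
def redCurveIdeal (F : CoordRing k) : Ideal (CoordRing k) :=
  saturation (jacobianIdeal F).radical

end Ideals

section HartshorneRao

variable {k : Type*} [Field k]

/-- The localization `I_u` of the ideal `I` at the powers of `u`, inside the function field. For
`u` a product of variables and `I` homogeneous, its part of degree `t` is the module of sections of
the twisted ideal sheaf `𝓘(t)` over the open set `D₊(u)`. -/
def idealAway (I : Ideal (CoordRing k)) (u : CoordRing k) : Submodule (CoordRing k) (Frac k) where
  carrier := {f | ∃ n : ℕ, ∃ g ∈ I, u ^ n • f = algebraMap (CoordRing k) (Frac k) g}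
  zero_mem' := ⟨0, 0, I.zero_mem, by simp⟩
  add_mem' := by
    rintro f₁ f₂ ⟨n₁, g₁, hg₁, h₁⟩ ⟨n₂, g₂, hg₂, h₂⟩
    refine ⟨n₁ + n₂, u ^ n₂ * g₁ + u ^ n₁ * g₂,
      I.add_mem (I.mul_mem_left _ hg₁) (I.mul_mem_left _ hg₂), ?_⟩
    rw [map_add, map_mul, map_mul, ← h₁, ← h₂, smul_add, ← Algebra.smul_def, ← Algebra.smul_def,
      smul_smul, smul_smul, pow_add, mul_comm (u ^ n₁)]
  smul_mem' := by
    rintro c f ⟨n, g, hg, h⟩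
    refine ⟨n, c * g, I.mul_mem_left _ hg, ?_⟩
    rw [smul_comm, h, map_mul, Algebra.smul_def]

theorem idealAway_le_mul (I : Ideal (CoordRing k)) (u v : CoordRing k) :
    idealAway I u ≤ idealAway I (u * v) := by
  rintro f ⟨n, g, hg, h⟩
  refine ⟨n, v ^ n * g, I.mul_mem_left _ hg, ?_⟩
  rw [map_mul, ← h, ← Algebra.smul_def, smul_smul, mul_pow, mul_comm]

/-- Čech 1-cocycles of `⨁ₜ 𝓘(t)` for the standard affine cover `D₊(x₀), …, D₊(x₃)`. -/
def cocycles (I : Ideal (CoordRing k)) : Submodule (CoordRing k) (Fin 4 → Fin 4 → Frac k) where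
  carrier := {c | (∀ i j, c i j ∈ idealAway I (X i * X j)) ∧
    ∀ i j l, c j l - c i l + c i j = 0}
  zero_mem' := ⟨fun _ _ => Submodule.zero_mem _, fun _ _ _ => by simp⟩
  add_mem' := by
    rintro c d ⟨hc, hc'⟩ ⟨hd, hd'⟩
    refine ⟨fun i j => Submodule.add_mem _ (hc i j) (hd i j), fun i j l => ?_⟩
    have h := congrArg₂ (· + ·) (hc' i j l) (hd' i j l)
    simp only [add_zero] at h
    rw [← h]
    simp only [Pi.add_apply]
    ring
  smul_mem' := by
    rintro a c ⟨hc, hc'⟩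
    refine ⟨fun i j => Submodule.smul_mem _ a (hc i j), fun i j l => ?_⟩
    simp only [Pi.smul_apply]
    rw [← smul_sub, ← smul_add, hc', smul_zero]

/-- Čech 1-coboundaries of `⨁ₜ 𝓘(t)` for the standard affine cover. -/
def coboundaries (I : Ideal (CoordRing k)) : Submodule (CoordRing k) (Fin 4 → Fin 4 → Frac k) where
  carrier := {c | ∃ b : Fin 4 → Frac k, (∀ i, b i ∈ idealAway I (X i)) ∧
    ∀ i j, c i j = b j - b i}
  zero_mem' := ⟨0, fun _ => Submodule.zero_mem _, fun _ _ => by simp⟩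
  add_mem' := by
    rintro c d ⟨b, hb, hc⟩ ⟨b', hb', hd⟩
    refine ⟨b + b', fun i => Submodule.add_mem _ (hb i) (hb' i), fun i j => ?_⟩
    simp only [Pi.add_apply, hc, hd]
    ring
  smul_mem' := by
    rintro a c ⟨b, hb, hc⟩
    refine ⟨a • b, fun i => Submodule.smul_mem _ a (hb i), fun i j => ?_⟩
    simp only [Pi.smul_apply, hc, smul_sub]

theorem coboundaries_le_cocycles (I : Ideal (CoordRing k)) : coboundaries I ≤ cocycles I := by
  rintro c ⟨b, hb, hc⟩
  refine ⟨fun i j => ?_, fun i j l => ?_⟩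
  · rw [hc]
    refine Submodule.sub_mem _ ?_ (idealAway_le_mul I _ _ (hb i))
    rw [mul_comm]
    exact idealAway_le_mul I _ _ (hb j)
  · rw [hc, hc, hc]
    ring

/-- The Hartshorne–Rao module `M(C) = ⨁ₜ H¹(ℙ³, 𝓘_C(t))` of the subscheme `C` with homogeneous
ideal `I`: the first Čech cohomology of `⨁ₜ 𝓘_C(t)` for the standard affine cover. -/
abbrev HRModule (I : Ideal (CoordRing k)) : Type _ :=
  cocycles I ⧸ (coboundaries I).submoduleOf (cocycles I)

/-- Elements of the function field that are homogeneous of degree `t`, i.e. quotients `p / q` of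
homogeneous polynomials with `deg p - deg q = t`. -/
def fracDegree (k : Type*) [Field k] (t : ℤ) : Submodule k (Frac k) where
  carrier := {f | ∃ (p q : CoordRing k) (a b : ℕ), p.IsHomogeneous a ∧ q.IsHomogeneous b ∧ q ≠ 0 ∧
    f = algebraMap (CoordRing k) (Frac k) p / algebraMap (CoordRing k) (Frac k) q ∧ (a : ℤ) - b = t}
  zero_mem' := by
    refine ⟨0, X 0 ^ (-t).toNat, t.toNat, (-t).toNat, isHomogeneous_zero _ _ _, ?_,
      pow_ne_zero _ (X_ne_zero _), by simp, by omega⟩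
    simpa using (isHomogeneous_X k (0 : Fin 4)).pow (-t).toNat
  add_mem' := by
    rintro f₁ f₂ ⟨p₁, q₁, a₁, b₁, hp₁, hq₁, h₁, rfl, e₁⟩ ⟨p₂, q₂, a₂, b₂, hp₂, hq₂, h₂, rfl, e₂⟩
    refine ⟨p₁ * q₂ + q₁ * p₂, q₁ * q₂, a₁ + b₂, b₁ + b₂, (hp₁.mul hq₂).add ?_, hq₁.mul hq₂,
      mul_ne_zero h₁ h₂, ?_, by push_cast; omega⟩
    · have h : a₁ + b₂ = b₁ + a₂ := by omega
      rw [h]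
      exact hq₁.mul hp₂
    · have i₁ : algebraMap (CoordRing k) (Frac k) q₁ ≠ 0 := by simpa using h₁
      have i₂ : algebraMap (CoordRing k) (Frac k) q₂ ≠ 0 := by simpa using h₂
      rw [div_add_div _ _ i₁ i₂, map_add, map_mul, map_mul, map_mul]
  smul_mem' := by
    rintro c f ⟨p, q, a, b, hp, hq, h, rfl, e⟩
    refine ⟨C c * p, q, a, b, ?_, hq, h, ?_, e⟩
    · simpa using (isHomogeneous_C (Fin 4) c).mul hp
    · rw [map_mul, mul_div_assoc, ← Algebra.smul_def, ← algebraMap_eq, algebraMap_smul]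

/-- The Čech 1-cocycles all of whose entries are homogeneous of degree `t`. -/
def cocyclesDegree (I : Ideal (CoordRing k)) (t : ℤ) : Submodule k (cocycles I) where
  carrier := {c | ∀ i j, c.1 i j ∈ fracDegree k t}
  zero_mem' := fun _ _ => Submodule.zero_mem _
  add_mem' := fun hc hd i j => Submodule.add_mem _ (hc i j) (hd i j)
  smul_mem' := fun a _ hc i j => Submodule.smul_mem _ a (hc i j)

/-- The degree `t` part `H¹(ℙ³, 𝓘_C(t))` of the Hartshorne–Rao module. -/
def HRDegree (I : Ideal (CoordRing k)) (t : ℤ) : Submodule k (HRModule I) :=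
  (cocyclesDegree I t).map
    (((coboundaries I).submoduleOf (cocycles I)).mkQ.restrictScalars k)

/-- `M(C) ≅ M(C')(d)` as graded modules, for the subschemes `C`, `C'` with homogeneous ideals
`I`, `I'`. Here `N(d)` is the shifted module with `N(d)ₜ = N_{t + d}`. -/
def HRShiftIso (I I' : Ideal (CoordRing k)) (d : ℤ) : Prop :=
  ∃ e : HRModule I ≃ₗ[CoordRing k] HRModule I', ∀ (t : ℤ) (m : HRModule I),
    m ∈ HRDegree I t ↔ e m ∈ HRDegree I' (t + d)

end HartshorneRao

section CohenMacaulay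

/-- A (Noetherian) local ring is Cohen–Macaulay if its maximal ideal contains a regular sequence
whose length is the Krull dimension of the ring. -/
def IsCMLocalRing (A : Type*) [CommRing A] [IsLocalRing A] : Prop :=
  ∃ rs : List A, (∀ r ∈ rs, r ∈ IsLocalRing.maximalIdeal A) ∧
    RingTheory.Sequence.IsRegular A rs ∧ (rs.length : WithBot ℕ∞) = ringKrullDim A

/-- A (Noetherian) ring is Cohen–Macaulay if its localizations at all maximal ideals are. -/
def IsCMRing (A : Type*) [CommRing A] : Prop :=
  ∀ (P : Ideal A) [P.IsMaximal], IsCMLocalRing (Localization.AtPrime P)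

/-- The subscheme with saturated homogeneous ideal `I` is arithmetically Cohen–Macaulay. -/
def IsACM {k : Type*} [Field k] (I : Ideal (CoordRing k)) : Prop := IsCMRing (CoordRing k ⧸ I)

end CohenMacaulay

section Liaison

variable {k : Type*} [Field k]

attribute [local instance] MvPolynomial.gradedAlgebra

/-- The subschemes with homogeneous ideals `I` and `I'` are (directly) linked by a complete
intersection of codimension two, with ideal `(f, g)`: this means `(f, g) ⊆ I ∩ I'`,
`(f, g) : I = I'` and `(f, g) : I' = I`. -/
def IsLinked (I I' : Ideal (CoordRing k)) : Prop :=
  I.IsHomogeneous (homogeneousSubmodule (Fin 4) k) ∧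
  I'.IsHomogeneous (homogeneousSubmodule (Fin 4) k) ∧
  ∃ (f g : CoordRing k) (a b : ℕ), f.IsHomogeneous a ∧ g.IsHomogeneous b ∧
    RingTheory.Sequence.IsRegular (CoordRing k) [f, g] ∧
    Ideal.span {f, g} ≤ I ⊓ I' ∧
    (Ideal.span {f, g}).colon (I : Set (CoordRing k)) = I' ∧
    (Ideal.span {f, g}).colon (I' : Set (CoordRing k)) = I

/-- Membership in the same even liaison class: the two subschemes are connected by a chain of an
even number of direct links. -/
def IsEvenlyLinked (I I' : Ideal (CoordRing k)) : Prop :=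
  Relation.ReflTransGen (Relation.Comp IsLinked IsLinked) I I'

end Liaison

end ArrCurve

end

namespace ArrCurve
open MvPolynomial
-- Linear forms and the height-two primes generated by two of them
section LinearForms
variable {k : Type*} [Field k]

/-! Write `P i j` for the ideal `(ℓ i, ℓ j)`, `i ≠ j`. Euler's formula in characteristic zero gives
`F ∈ J_F`, so a prime over `J_F` contains one linear factor, then, by a partial derivative, a second
one. Thus the `P i j` are exactly the height-two primes over `J_F`, and they are its minimal primes.
The ideal of `C̄_F` therefore consists of the `f` lying in `J_F` after localization at every `P i j`
(`mem_topCurveIdeal_iff`), and that of `C_F^red` is the intersection of the `P i j`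
(`mem_redCurveIdeal_iff`). All later arguments use only these two descriptions.

The hypothesis on `L` says that `L` lies in no `P i j`. Let `I` be either ideal for `F`, and `I'`
the one for `L F`. At an old line `L` is invertible, and `J_{LF}` and `J_F` agree there. A new line
`L = ℓ i = 0` lies on just two planes, so `J_{LF}` is locally `(L, ℓ i)`. The new lines together
have ideal `(L, F)`, so `I' = I ∩ (L, F)`. Since `F ∈ I` and `L` is a nonzerodivisor modulo `I`,
this is `L I + (F)`, a basic double link of `I`, which is (ii). The rest is general theory of basic
double links, made explicit.

Hartshorne–Rao modules: the pairs `(a, r)` with `L a + F r = 0` are the multiples of `(F, -L)`,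
which presents the sheaf of `I'` as a quotient of that of `I`, shifted by `-1`, plus a twist of `𝓞`,
with kernel a twist of `𝓞`. As `H¹` and `H²` of all `𝓞(t)` vanish, multiplication by `L` is an
isomorphism (`hrShiftIso_mul_add`); the proof works with Čech cochains.

Cohen–Macaulayness: both quotient rings have dimension two at every maximal ideal, so the condition
is depth two, phrased as `HasUniqueExtension`. It passes along `0 → R/I → R/I' → R/(L, F) → 0`,
where the first map is multiplication by `L` and the last term has depth two.

Liaison: let `G` be a derivative of `F` in a direction on which no `ℓ i` vanishes. Then `(F, G)`
links `I` to `K = (F, G) : I`, and `(F, L G)` links `K` to `L I + (F)`. The needed duality `(F, G) :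
K = I` is checked line by line with an explicit element of `K` (`exists_residual_red`,
`exists_residual_top`). -/

theorem linearForm_eq_sum {p : CoordRing k} (hp : p.IsHomogeneous 1) :
    p = ∑ i, C (coeff (Finsupp.single i 1) p) * X i := by
  have h : p ∈ homogeneousSubmodule (Fin 4) k 1 := hp
  rw [homogeneousSubmodule_one_eq_span_X, Submodule.mem_span_range_iff_exists_fun] at h
  obtain ⟨c, rfl⟩ := h
  refine Finset.sum_congr rfl fun i _ => ?_
  rw [smul_eq_C_mul]
  congr 2
  simp [coeff_sum, coeff_X, Finsupp.single_left_inj]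

theorem constantCoeff_linearForm {p : CoordRing k} (hp : p.IsHomogeneous 1) :
    coeff 0 p = 0 := hp.coeff_eq_zero (by simp)

/-- Compare parts of degree one: only the constant terms of the two coefficients contribute. -/
theorem linearForm_mem_span_pair {a b l : CoordRing k} (ha : a.IsHomogeneous 1)
    (hb : b.IsHomogeneous 1) (hl : l.IsHomogeneous 1) (h : l ∈ Ideal.span {a, b}) :
    ∃ α β : k, l = C α * a + C β * b := by
  obtain ⟨f, g, rfl⟩ := Ideal.mem_span_pair.1 h
  refine ⟨coeff 0 f, coeff 0 g, ?_⟩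
  have key : ∀ (f a : CoordRing k), a.IsHomogeneous 1 →
      homogeneousComponent 1 (f * a) = C (coeff 0 f) * a := by
    intro f a ha
    rw [linearForm_eq_sum (homogeneousComponent_isHomogeneous 1 (f * a))]
    conv_rhs => rw [linearForm_eq_sum ha, Finset.mul_sum]
    refine Finset.sum_congr rfl fun i _ => ?_
    rw [← mul_assoc, ← C_mul]
    congr 2
    rw [coeff_homogeneousComponent, if_pos (by simp), coeff_mul,
      Finsupp.antidiagonal_single]
    simp [Finset.Nat.antidiagonal_succ, constantCoeff_linearForm ha]
  have := homogeneousComponent_of_mem (m := 1) (n := 1) hl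
  rw [if_pos rfl, map_add, key f a ha, key g b hb] at this
  exact this.symm

theorem linearForm_mem_span_singleton {a l : CoordRing k} (ha : a.IsHomogeneous 1)
    (hl : l.IsHomogeneous 1) (h : l ∈ Ideal.span {a}) : ∃ α : k, l = C α * a := by
  have h' : l ∈ Ideal.span {a, a} := by simpa using h
  obtain ⟨α, β, rfl⟩ := linearForm_mem_span_pair ha ha hl h'
  exact ⟨α + β, by rw [C_add, add_mul]⟩

theorem linearForm_prime {a : CoordRing k} (ha : a.IsHomogeneous 1) (ha₀ : a ≠ 0) : Prime a := by
  refine Irreducible.prime (irreducible_of_totalDegree_eq_one (ha.totalDegree ha₀) fun x hx => ?_)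
  obtain ⟨d, hd⟩ := ne_zero_iff.1 ha₀
  obtain ⟨y, hy⟩ := hx d
  exact isUnit_iff_ne_zero.2 fun h => hd (by rw [hy, h, zero_mul])

theorem linearIndependent_iff_not_dvd {a b : CoordRing k} (ha : a.IsHomogeneous 1)
    (hb : b.IsHomogeneous 1) (ha₀ : a ≠ 0) :
    LinearIndependent k ![a, b] ↔ ¬ a ∣ b := by
  rw [LinearIndependent.pair_iff' ha₀, ← Ideal.mem_span_singleton]
  constructor
  · intro h hb'
    obtain ⟨α, h'⟩ := linearForm_mem_span_singleton ha hb hb'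
    exact h α (by rw [smul_eq_C_mul, h'])
  · intro h α h'
    exact h (Ideal.mem_span_singleton.2 ⟨C α, by rw [← h', smul_eq_C_mul, mul_comm]⟩)

/-- Modulo two independent linear forms, the coordinate ring is a polynomial ring in two
variables. -/
theorem exists_surjective_ker_eq_span_pair {a b : CoordRing k} (ha : a.IsHomogeneous 1)
    (hb : b.IsHomogeneous 1) (hab : LinearIndependent k ![a, b]) :
    ∃ ψ : CoordRing k →ₐ[k] Polynomial (Polynomial k),
      Function.Surjective ψ ∧ RingHom.ker ψ = Ideal.span {a, b} := by
  set v : CoordRing k → Fin 4 → k := fun p i => coeff (Finsupp.single i 1) p with hv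
  set T : (Fin 4 → k) →ₗ[k] CoordRing k := Fintype.linearCombination k (X : Fin 4 → CoordRing k)
    with hT
  have hTv : ∀ p : CoordRing k, p.IsHomogeneous 1 → T (v p) = p := by
    intro p hp
    conv_rhs => rw [linearForm_eq_sum hp]
    simp [hT, Fintype.linearCombination_apply, smul_eq_C_mul, hv]
  have hind : LinearIndependent k ![v a, v b] := by
    apply LinearIndependent.of_comp T
    convert hab using 1
    ext i
    fin_cases i <;> simp [hTv, ha, hb]
  obtain ⟨c, hc⟩ := exists_linearIndependent_cons_of_lt_finrank hind
    (by rw [Module.finrank_fin_fun]; norm_num)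
  obtain ⟨d, hd⟩ := exists_linearIndependent_cons_of_lt_finrank hc
    (by rw [Module.finrank_fin_fun]; norm_num)
  set M : Matrix (Fin 4) (Fin 4) k := ![d, c, v a, v b] with hM
  have hd' : LinearIndependent k M := hd
  have hU : IsUnit M := Matrix.linearIndependent_rows_iff_isUnit.1 hd'
  have hU' : IsUnit M.det := (Matrix.isUnit_iff_isUnit_det M).1 hU
  have h1 := Matrix.mul_nonsing_inv M hU'
  have h2 := Matrix.nonsing_inv_mul M hU'
  set N := M⁻¹
  -- In the coordinates `d, c, a, b`, whose coefficient rows form the invertible matrix `M` with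
  -- inverse `N`, this map keeps `d` and `c` as the two variables and sends `a`, `b` to zero.
  set ψ : CoordRing k →ₐ[k] Polynomial (Polynomial k) := aeval fun j =>
    algebraMap k _ (N j 0) * Polynomial.X + algebraMap k _ (N j 1) * Polynomial.C Polynomial.X
    with hψ
  have hψT : ∀ i, ψ (T (M i)) = algebraMap k _ ((1 : Matrix (Fin 4) (Fin 4) k) i 0) * Polynomial.X
      + algebraMap k _ ((1 : Matrix (Fin 4) (Fin 4) k) i 1) * Polynomial.C Polynomial.X := by
    intro i
    rw [← h1, Matrix.mul_apply, Matrix.mul_apply]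
    simp only [hT, Fintype.linearCombination_apply, map_sum, hψ, aeval_X, map_mul, AlgHom.commutes,
      Algebra.smul_def, Finset.sum_mul, mul_add, Finset.sum_add_distrib, mul_assoc]
  have hψd : ψ (T d) = Polynomial.X := by simpa [hM] using hψT 0
  have hψc : ψ (T c) = Polynomial.C Polynomial.X := by simpa [hM] using hψT 1
  have hψa : ψ a = 0 := by simpa [hM, hTv a ha] using hψT 2
  have hψb : ψ b = 0 := by simpa [hM, hTv b hb] using hψT 3
  have hX : ∀ j, (X j : CoordRing k) = ∑ i, C (N j i) * T (M i) := by
    intro j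
    have : T (∑ i, N j i • M i) = X j := by
      have e : (∑ i, N j i • M i) = Pi.single j 1 := by
        ext l
        have := congrFun (congrFun h2 j) l
        rw [Matrix.mul_apply] at this
        simp only [Finset.sum_apply, Pi.smul_apply, smul_eq_mul, this, Matrix.one_apply,
          Pi.single_apply, eq_comm]
      rw [e, hT, Fintype.linearCombination_apply_single, one_smul]
    rw [← this, map_sum]
    simp [smul_eq_C_mul]
  set σ : Polynomial (Polynomial k) →+* CoordRing k :=
    Polynomial.eval₂RingHom (Polynomial.aeval (T c)).toRingHom (T d) with hσ
  have hψσ : ∀ q, ψ (σ q) = q := by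
    intro q
    have : (ψ.toRingHom.comp σ) = RingHom.id _ := by
      ext x
      · simp [hσ]
      · simp [hσ, hψc]
      · simp [hσ, hψd]
    exact congrArg (fun f => f q) this
  refine ⟨ψ, fun q => ⟨σ q, hψσ q⟩, le_antisymm (fun f hf => ?_) ?_⟩
  · have key : (Ideal.Quotient.mk (Ideal.span {a, b})).comp (σ.comp ψ.toRingHom) =
        Ideal.Quotient.mk (Ideal.span {a, b}) := by
      refine MvPolynomial.ringHom_ext (fun r => ?_) (fun j => ?_)
      · simp [hσ, hψ, IsScalarTower.algebraMap_apply k (Polynomial k) (Polynomial (Polynomial k)),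
          MvPolynomial.algebraMap_eq]
      · have e : σ (ψ (X j)) = C (N j 0) * T d + C (N j 1) * T c := by
          simp [hσ, hψ, IsScalarTower.algebraMap_apply k (Polynomial k) (Polynomial (Polynomial k)),
            MvPolynomial.algebraMap_eq]
        change Ideal.Quotient.mk _ (σ (ψ (X j))) = _
        rw [e, Ideal.Quotient.eq, hX j, Fin.sum_univ_four]
        simp only [hM, Matrix.cons_val, hTv a ha, hTv b hb]
        rw [← neg_mem_iff]
        refine Ideal.mem_span_pair.2 ⟨C (N j 2), C (N j 3), by ring⟩
    have := congrArg (fun g => g f) key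
    have hf' : ψ f = 0 := hf
    change Ideal.Quotient.mk _ (σ (ψ f)) = _ at this
    rw [hf', map_zero, map_zero] at this
    exact Ideal.Quotient.eq_zero_iff_mem.1 this.symm
  · rw [Ideal.span_le]
    rintro x (rfl | rfl)
    · exact hψa
    · exact hψb

theorem isPrime_span_pair {a b : CoordRing k} (ha : a.IsHomogeneous 1)
    (hb : b.IsHomogeneous 1) (hab : LinearIndependent k ![a, b]) :
    (Ideal.span {a, b}).IsPrime := by
  obtain ⟨ψ, -, h⟩ := exists_surjective_ker_eq_span_pair ha hb hab
  rw [← h]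
  exact RingHom.ker_isPrime _

/-- Krull's height theorem bounds the height above; the chain `0 < (a) < (a, b)` of primes bounds it
below. -/
theorem height_span_pair {a b : CoordRing k} (ha : a.IsHomogeneous 1)
    (hb : b.IsHomogeneous 1) (hab : LinearIndependent k ![a, b]) :
    (Ideal.span {a, b}).height = 2 := by
  have hP := isPrime_span_pair ha hb hab
  have ha₀ : a ≠ 0 := hab.ne_zero 0
  apply le_antisymm
  · refine (Ideal.height_le_spanFinrank _ hP.ne_top).trans ?_
    have := Submodule.spanFinrank_span_le_ncard_of_finite (R := CoordRing k)
      (Set.toFinite {a, b})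
    exact_mod_cast this.trans (Set.ncard_insert_le a {b} |>.trans (by simp))
  · have h1 : (Ideal.span {a}).IsPrime :=
      (Ideal.span_singleton_prime ha₀).2 (linearForm_prime ha ha₀)
    have h01 : (⊥ : Ideal (CoordRing k)) < Ideal.span {a} := by
      rw [bot_lt_iff_ne_bot, Ne, Ideal.span_singleton_eq_bot]
      exact ha₀
    have h12 : Ideal.span {a} < Ideal.span {a, b} := by
      refine lt_of_le_of_ne (Ideal.span_mono (by simp)) fun h => ?_
      have hb' : b ∈ Ideal.span {a} := by
        rw [h]
        exact Ideal.subset_span (by simp)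
      exact (linearIndependent_iff_not_dvd ha hb ha₀).1 hab (Ideal.mem_span_singleton.1 hb')
    have e1 := Ideal.height_add_one_le_of_lt_of_isPrime h01
    have e2 := Ideal.height_add_one_le_of_lt_of_isPrime h12
    calc (2 : ℕ∞) = 0 + 1 + 1 := by norm_num
      _ ≤ (⊥ : Ideal (CoordRing k)).height + 1 + 1 := by gcongr; exact zero_le
      _ ≤ _ := le_trans (by gcongr) e2

end LinearForms
end ArrCurve

namespace ArrCurve
-- Depth two as a unique extension property
section UniqueExtension

variable {R : Type*} [CommRing R]

/-- Every linear map `𝔞 → M` extends uniquely to `R`. If `R` is Noetherian and `M` is finite this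
says that `𝔞` contains an `M`-regular sequence of length two, i.e. that
`Hom(R/𝔞, M) = Ext¹(R/𝔞, M) = 0`. -/
def HasUniqueExtension (𝔞 : Ideal R) (M : Type*) [AddCommGroup M] [Module R M] : Prop :=
  (∀ u : M, (∀ a ∈ 𝔞, a • u = 0) → u = 0) ∧ ∀ φ : 𝔞 →ₗ[R] M, ∃ u : M, ∀ a : 𝔞, φ a = (a : R) • u

variable {M M₁ M₂ M₃ : Type*} [AddCommGroup M] [Module R M] [AddCommGroup M₁] [Module R M₁]
  [AddCommGroup M₂] [Module R M₂] [AddCommGroup M₃] [Module R M₃]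

/-- The property says that `M → Hom(𝔞, M)` is bijective. As `Hom(𝔞, -)` is left exact, this is a
five-lemma chase with bijective third vertical map. -/
theorem hasUniqueExtension_iff_of_exact {𝔞 : Ideal R} {f : M₁ →ₗ[R] M₂} {g : M₂ →ₗ[R] M₃}
    (hf : Function.Injective f) (hg : Function.Surjective g) (hfg : Function.Exact f g)
    (h₃ : HasUniqueExtension 𝔞 M₃) :
    HasUniqueExtension 𝔞 M₁ ↔ HasUniqueExtension 𝔞 M₂ := by
  constructor
  · rintro ⟨h₁, h₁'⟩
    refine ⟨fun u hu => ?_, fun φ => ?_⟩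
    · have hgu : g u = 0 := h₃.1 _ fun a ha => by rw [← map_smul, hu a ha, map_zero]
      obtain ⟨v, rfl⟩ := (hfg u).1 hgu
      rw [h₁ v fun a ha => hf (by rw [map_smul, hu a ha, map_zero]), map_zero]
    · obtain ⟨w, hw⟩ := h₃.2 (g ∘ₗ φ)
      obtain ⟨u, rfl⟩ := hg w
      have hker : ∀ a : 𝔞, (φ - (LinearMap.toSpanSingleton R M₂ u).domRestrict 𝔞) a ∈
          LinearMap.range f := by
        intro a
        refine (hfg _).1 ?_
        have := hw a
        simp only [LinearMap.comp_apply] at this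
        simp [this]
      obtain ⟨v, hv⟩ := h₁' ((LinearEquiv.ofInjective f hf).symm.toLinearMap ∘ₗ
        LinearMap.codRestrict _ _ hker)
      refine ⟨u + f v, fun a => ?_⟩
      have h := congrArg (fun z => (LinearEquiv.ofInjective f hf z : M₂)) (hv a)
      simp only [LinearMap.comp_apply, LinearEquiv.coe_coe, LinearEquiv.apply_symm_apply,
        LinearMap.codRestrict_apply, map_smul] at h
      have h' : φ a - (a : R) • u = (a : R) • f v := h
      rw [smul_add, ← h']
      abel
  · rintro ⟨h₂, h₂'⟩
    refine ⟨fun u hu => hf ?_, fun φ => ?_⟩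
    · rw [map_zero]
      exact h₂ _ fun a ha => by rw [← map_smul, hu a ha, map_zero]
    · obtain ⟨w, hw⟩ := h₂' (f ∘ₗ φ)
      have hgw : g w = 0 := h₃.1 _ fun a ha => by
        rw [← map_smul, ← hw ⟨a, ha⟩]
        exact hfg.apply_apply_eq_zero _
      obtain ⟨v, rfl⟩ := (hfg w).1 hgw
      refine ⟨v, fun a => hf ?_⟩
      rw [map_smul]
      exact hw a

/-- Here `I + 𝔪 = R`, so some `b ∈ 𝔪` acts on `R/I` as the identity, and `φ a = φ (b a) = a φ b`. -/
theorem hasUniqueExtension_quotient_of_not_le {𝔪 I : Ideal R} (h𝔪 : 𝔪.IsMaximal) (h : ¬ I ≤ 𝔪) :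
    HasUniqueExtension 𝔪 (R ⧸ I) := by
  have htop : I ⊔ 𝔪 = ⊤ := by
    by_contra hne
    exact h (le_sup_left.trans (h𝔪.eq_of_le hne le_sup_right).ge)
  obtain ⟨i, hi, b, hb, hib⟩ := Submodule.mem_sup.1 ((Ideal.eq_top_iff_one _).1 htop)
  have key : ∀ u : R ⧸ I, u = b • u := by
    intro u
    obtain ⟨x, rfl⟩ := Ideal.Quotient.mk_surjective u
    have e : Ideal.Quotient.mk I i = 0 := Ideal.Quotient.eq_zero_iff_mem.2 hi
    have := congrArg (Ideal.Quotient.mk I) hib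
    rw [map_add, e, zero_add, map_one] at this
    rw [Algebra.smul_def, Ideal.Quotient.algebraMap_eq, this, one_mul]
  refine ⟨fun u hu => by rw [key u, hu b hb], fun φ => ⟨φ ⟨b, hb⟩, fun a => ?_⟩⟩
  rw [key (φ a), ← map_smul, ← map_smul]
  congr 1
  ext
  simp [mul_comm]

theorem isWeaklyRegular_pair_iff {x y : R} :
    RingTheory.Sequence.IsWeaklyRegular M [x, y] ↔
      (∀ u : M, x • u = 0 → u = 0) ∧ ∀ v w : M, y • v = x • w → ∃ u, v = x • u := by
  rw [RingTheory.Sequence.isWeaklyRegular_cons_iff, isSMulRegular_iff_right_eq_zero_of_smul,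
    RingTheory.Sequence.isWeaklyRegular_singleton_iff]
  refine and_congr_right fun _ => ?_
  rw [isSMulRegular_quotient_iff_mem_of_smul_mem]
  simp only [Submodule.mem_smul_pointwise_iff_exists, Submodule.mem_top, true_and]
  constructor
  · intro h v w hvw
    obtain ⟨u, hu⟩ := h v ⟨w, hvw.symm⟩
    exact ⟨u, hu.symm⟩
  · rintro h v ⟨w, hw⟩
    obtain ⟨u, hu⟩ := h v w hw.symm
    exact ⟨u, hu.symm⟩

/-- From `y φ(x) = x φ(y)` regularity gives `φ(x) = x w`; then `x (φ(a) - a w) = 0` for every `a`,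
and `x` cancels. -/
theorem HasUniqueExtension.of_isWeaklyRegular {𝔞 : Ideal R} {x y : R} (hx : x ∈ 𝔞) (hy : y ∈ 𝔞)
    (h : RingTheory.Sequence.IsWeaklyRegular M [x, y]) : HasUniqueExtension 𝔞 M := by
  obtain ⟨h₁, h₂⟩ := isWeaklyRegular_pair_iff.1 h
  refine ⟨fun u hu => h₁ u (hu x hx), fun φ => ?_⟩
  have hcomm : ∀ a b : 𝔞, (a : R) • φ b = (b : R) • φ a := by
    intro a b
    rw [← map_smul, ← map_smul]
    congr 1
    ext
    simp [mul_comm]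
  obtain ⟨w, hw⟩ := h₂ (φ ⟨x, hx⟩) (φ ⟨y, hy⟩) (hcomm ⟨y, hy⟩ ⟨x, hx⟩)
  refine ⟨w, fun a => sub_eq_zero.1 (h₁ _ ?_)⟩
  rw [smul_sub, sub_eq_zero]
  exact (hcomm ⟨x, hx⟩ a).trans (by rw [hw, smul_comm])

/-- Prime avoidance: if `𝔞` consisted of zero divisors it would lie in one associated prime, the
annihilator of a nonzero element. -/
theorem exists_mem_isSMulRegular [IsNoetherianRing R] [Module.Finite R M] {𝔞 : Ideal R}
    (h : ∀ u : M, (∀ a ∈ 𝔞, a • u = 0) → u = 0) :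
    ∃ x ∈ 𝔞, ∀ u : M, x • u = 0 → u = 0 := by
  by_contra! hcon
  have hsub : (𝔞 : Set R) ⊆ ⋃ p ∈ associatedPrimes R M, (p : Set R) := by
    rw [biUnion_associatedPrimes_eq_zero_divisors]
    intro x hx
    obtain ⟨u, hu, hu'⟩ := hcon x hx
    exact ⟨u, hu', hu⟩
  obtain ⟨p, hp, hp'⟩ := (Ideal.subset_union_prime_finite (associatedPrimes.finite R M)
    (f := fun p => p) ⊥ ⊥ fun p hp _ _ => IsAssociatedPrime.isPrime hp).1 hsub
  obtain ⟨hprime, u, hu⟩ := isAssociatedPrime_iff.1 (AssociatedPrimes.mem_iff.1 hp)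
  have hu₀ : u = 0 := h u fun a ha => by
    have := hp' ha
    rw [hu, Submodule.mem_colon_singleton] at this
    simpa using this
  refine hprime.ne_top ?_
  rw [hu, hu₀]
  exact Submodule.colon_singleton_zero

theorem HasUniqueExtension.exists_isWeaklyRegular [IsNoetherianRing R] [Module.Finite R M]
    {𝔞 : Ideal R} (h : HasUniqueExtension 𝔞 M) :
    ∃ x ∈ 𝔞, ∃ y ∈ 𝔞, RingTheory.Sequence.IsWeaklyRegular M [x, y] := by
  obtain ⟨x, hx, hxr⟩ := exists_mem_isSMulRegular h.1
  have hq : ∀ u : QuotSMulTop x M, (∀ a ∈ 𝔞, a • u = 0) → u = 0 := by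
    intro u hu
    obtain ⟨u, rfl⟩ := Submodule.Quotient.mk_surjective _ u
    have hu' : ∀ a : 𝔞, ∃ v : M, x • v = (a : R) • u := by
      intro a
      have := hu a a.2
      rw [← Submodule.Quotient.mk_smul, Submodule.Quotient.mk_eq_zero,
        Submodule.mem_smul_pointwise_iff_exists] at this
      obtain ⟨v, -, hv⟩ := this
      exact ⟨v, hv⟩
    choose φ hφ using hu'
    have hinj : ∀ v w : M, x • v = x • w → v = w := fun v w hvw =>
      sub_eq_zero.1 (hxr _ (by rw [smul_sub, hvw, sub_self]))
    -- If `𝔞 u ⊆ x M`, then `a ↦ x⁻¹ a u` is a linear map on `𝔞`. Extending it to multiplication by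
    -- `v` yields `u = x v`.
    obtain ⟨v, hv⟩ := h.2
      { toFun := φ
        map_add' := fun a b => hinj _ _ (by
          rw [smul_add, hφ, hφ, hφ, Submodule.coe_add, add_smul])
        map_smul' := fun r a => hinj _ _ (by
          rw [RingHom.id_apply, hφ, smul_comm, hφ, Submodule.coe_smul, smul_assoc]) }
    have hxv : u = x • v := sub_eq_zero.1 (h.1 _ fun a ha => by
      rw [smul_sub, ← hφ ⟨a, ha⟩, sub_eq_zero, smul_comm a x v]
      exact congrArg (x • ·) (hv ⟨a, ha⟩))
    rw [Submodule.Quotient.mk_eq_zero, Submodule.mem_smul_pointwise_iff_exists]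
    exact ⟨v, Submodule.mem_top, hxv.symm⟩
  obtain ⟨y, hy, hyr⟩ := exists_mem_isSMulRegular hq
  refine ⟨x, hx, y, hy, ?_⟩
  rw [RingTheory.Sequence.isWeaklyRegular_cons_iff, isSMulRegular_iff_right_eq_zero_of_smul,
    RingTheory.Sequence.isWeaklyRegular_singleton_iff, isSMulRegular_iff_right_eq_zero_of_smul]
  exact ⟨hxr, hyr⟩

/-- Descent of the unique extension property from the localization at a maximal ideal. -/
theorem HasUniqueExtension.of_localization {𝔪 : Ideal R} (h𝔪 : 𝔪.IsMaximal) (hfg : 𝔪.FG)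
    (f : M₁ →ₗ[R] M₂) (hker : ∀ u, f u = 0 → ∃ s ∉ 𝔪, s • u = 0)
    (hsurj : ∀ w, ∃ s ∉ 𝔪, ∃ u, s • w = f u) (h : HasUniqueExtension 𝔪 M₂) :
    HasUniqueExtension 𝔪 M₁ := by
  have hunit : ∀ s ∉ 𝔪, ∃ c, ∃ b ∈ 𝔪, c * s + b = 1 := by
    intro s hs
    obtain ⟨c, hc⟩ := h𝔪.exists_inv hs
    obtain ⟨b, hb, hbc⟩ := hc
    exact ⟨c, b, hb, hbc⟩
  refine ⟨fun u hu => ?_, fun φ => ?_⟩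
  · obtain ⟨s, hs, hsu⟩ := hker u (h.1 _ fun a ha => by rw [← map_smul, hu a ha, map_zero])
    obtain ⟨c, b, hb, hcb⟩ := hunit s hs
    rw [← one_smul R u, ← hcb, add_smul, mul_smul, hsu, smul_zero, hu b hb, add_zero]
  · obtain ⟨w, hw⟩ := h.2 (f ∘ₗ φ)
    obtain ⟨s, hs, u, hsu⟩ := hsurj w
    set χ : 𝔪 →ₗ[R] M₁ := s • φ - (LinearMap.toSpanSingleton R M₁ u).domRestrict 𝔪 with hχ
    have hχ' : ∀ a, f (χ a) = 0 := by
      intro a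
      have := hw a
      rw [LinearMap.comp_apply] at this
      simp [hχ, this, ← hsu, smul_comm s (a : R) w]
    have hann : ∃ t ∉ 𝔪, ∀ a : 𝔪, t • χ a = 0 := by
      have hfin : Module.Finite R 𝔪 := Module.Finite.iff_fg.2 hfg
      obtain ⟨S, hS⟩ := hfin.fg_top
      choose t ht ht' using fun a : 𝔪 => hker _ (hχ' a)
      -- One denominator for each of finitely many generators of `𝔪`; their product kills the whole
      -- image of `χ`.
      refine ⟨∏ a ∈ S, t a, fun hmem => ?_, fun a => ?_⟩
      · obtain ⟨a, -, ha⟩ := (h𝔪.isPrime.prod_mem_iff).1 hmem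
        exact ht a ha
      · have hle : (⊤ : Submodule R 𝔪) ≤ LinearMap.ker ((∏ a ∈ S, t a) • χ) := by
          rw [← hS, Submodule.span_le]
          intro b hb
          have hb' : b ∈ S := hb
          obtain ⟨r, hr⟩ := Finset.dvd_prod_of_mem t hb'
          change (∏ a ∈ S, t a) • χ b = 0
          rw [hr, mul_comm, mul_smul, ht', smul_zero]
        exact hle (Submodule.mem_top (x := a))
    obtain ⟨t, ht, htχ⟩ := hann
    obtain ⟨c, b, hb, hcb⟩ := hunit (t * s) fun hmem =>
      (h𝔪.isPrime.mem_or_mem hmem).elim ht hs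
    -- Split `1 = c t s + b` with `b ∈ 𝔪`: on the first summand `t s φ(a) = a t u`, on the second `b
    -- φ(a) = a φ(b)`.
    refine ⟨c • t • u + φ ⟨b, hb⟩, fun a => ?_⟩
    have h1 : (t * s) • φ a = (a : R) • t • u := by
      have := htχ a
      simp only [hχ, LinearMap.sub_apply, LinearMap.smul_apply, smul_sub, sub_eq_zero] at this
      rw [mul_smul, this, smul_comm]
      simp
    have h2 : b • φ a = (a : R) • φ ⟨b, hb⟩ := by
      rw [← map_smul, ← map_smul]
      congr 1
      ext
      simp [mul_comm]
    rw [← one_smul R (φ a), ← hcb, add_smul, mul_smul c, h1, h2, smul_add, smul_comm c]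

/-- Once all local dimensions are two, being Cohen–Macaulay asks for a regular sequence of length
two in each maximal ideal. Depth two descends from the localization to `R/I`, and a regular sequence
found in `𝔪` localizes. -/
theorem isCMRing_quotient_iff [IsNoetherianRing R] {I : Ideal R}
    (hdim : ∀ (P : Ideal (R ⧸ I)) [P.IsMaximal], ringKrullDim (Localization.AtPrime P) = 2) :
    IsCMRing (R ⧸ I) ↔ ∀ 𝔪 : Ideal R, 𝔪.IsMaximal → HasUniqueExtension 𝔪 (R ⧸ I) := by
  constructor
  · intro h 𝔪 h𝔪
    by_cases hI : I ≤ 𝔪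
    swap
    · exact hasUniqueExtension_quotient_of_not_le h𝔪 hI
    have hcomap : (𝔪.map (Ideal.Quotient.mk I)).comap (Ideal.Quotient.mk I) = 𝔪 := by
      rw [Ideal.comap_map_of_surjective' _ Ideal.Quotient.mk_surjective, Ideal.mk_ker,
        sup_eq_left.2 hI]
    have hmem : ∀ x, Ideal.Quotient.mk I x ∈ 𝔪.map (Ideal.Quotient.mk I) ↔ x ∈ 𝔪 := by
      intro x
      rw [← Ideal.mem_comap, hcomap]
    have hP : (𝔪.map (Ideal.Quotient.mk I)).IsMaximal := by
      refine (Ideal.map_eq_top_or_isMaximal_of_surjective _ Ideal.Quotient.mk_surjective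
        h𝔪).resolve_left fun htop => h𝔪.ne_top ?_
      rw [← hcomap, htop, Ideal.comap_top]
    set P := 𝔪.map (Ideal.Quotient.mk I)
    obtain ⟨rs, hrs, hreg, hlen⟩ := h P
    rw [hdim P] at hlen
    have hlen' : rs.length = 2 := by exact_mod_cast hlen
    obtain ⟨x, y, rfl⟩ := List.length_eq_two.1 hlen'
    -- Clearing denominators changes the elements of the regular sequence only by units, so they may
    -- be taken from `𝔪`.
    have hlift : ∀ x ∈ IsLocalRing.maximalIdeal (Localization.AtPrime P),
        ∃ a ∈ 𝔪, ∃ s : Localization.AtPrime P, IsUnit s ∧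
          algebraMap R (Localization.AtPrime P) a = s * x := by
      intro x hx
      obtain ⟨a, s, hs⟩ := IsLocalization.exists_mk'_eq P.primeCompl x
      obtain ⟨a, rfl⟩ := Ideal.Quotient.mk_surjective a
      rw [← hs, IsLocalization.AtPrime.mk'_mem_maximal_iff _ P, hmem] at hx
      refine ⟨a, hx, algebraMap _ _ (s : R ⧸ I), IsLocalization.map_units _ s, ?_⟩
      rw [← hs, IsLocalization.mk'_spec']
      rfl
    obtain ⟨a, ha, s, hs, has⟩ := hlift x (hrs x (by simp))
    obtain ⟨b, hb, t, ht, hbt⟩ := hlift y (hrs y (by simp))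
    obtain ⟨hx, hy⟩ := isWeaklyRegular_pair_iff.1 hreg.toIsWeaklyRegular
    have hA : HasUniqueExtension 𝔪 (Localization.AtPrime P) := by
      refine HasUniqueExtension.of_isWeaklyRegular ha hb (isWeaklyRegular_pair_iff.2
        ⟨fun u hu => ?_, fun v w hvw => ?_⟩)
      · rw [Algebra.smul_def, has, mul_assoc, hs.mul_right_eq_zero] at hu
        exact hx u hu
      · rw [Algebra.smul_def, Algebra.smul_def, has, hbt] at hvw
        obtain ⟨t', ht'⟩ := ht.exists_left_inv
        obtain ⟨s', hs'⟩ := hs.exists_left_inv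
        obtain ⟨u, hu⟩ := hy v (t' * s * w) (by
          simp only [smul_eq_mul]
          linear_combination t' * hvw - y * v * ht')
        refine ⟨s' * u, ?_⟩
        rw [Algebra.smul_def, has, hu, smul_eq_mul]
        linear_combination - x * u * hs'
    refine hA.of_localization h𝔪 (IsNoetherian.noetherian 𝔪)
      (IsScalarTower.toAlgHom R (R ⧸ I) (Localization.AtPrime P)).toLinearMap ?_ ?_
    · intro u hu
      obtain ⟨c, hc⟩ := (IsLocalization.map_eq_zero_iff P.primeCompl _ u).1 hu
      obtain ⟨s, hs⟩ := Ideal.Quotient.mk_surjective (c : R ⧸ I)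
      refine ⟨s, fun hs' => c.2 ?_, ?_⟩
      · rw [← hs]
        exact (hmem s).2 hs'
      · rw [Algebra.smul_def, Ideal.Quotient.algebraMap_eq, hs, hc]
    · intro w
      obtain ⟨a, c, hac⟩ := IsLocalization.exists_mk'_eq P.primeCompl w
      obtain ⟨s, hs⟩ := Ideal.Quotient.mk_surjective (c : R ⧸ I)
      refine ⟨s, fun hs' => c.2 ?_, a, ?_⟩
      · rw [← hs]
        exact (hmem s).2 hs'
      · rw [Algebra.smul_def, IsScalarTower.algebraMap_apply R (R ⧸ I),
          Ideal.Quotient.algebraMap_eq, hs, ← hac, IsLocalization.mk'_spec']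
        rfl
  · intro h P hP
    have h𝔪 : (P.comap (Ideal.Quotient.mk I)).IsMaximal :=
      Ideal.comap_isMaximal_of_surjective _ Ideal.Quotient.mk_surjective
    obtain ⟨x, hx, y, hy, hreg⟩ := (h _ h𝔪).exists_isWeaklyRegular
    have hreg' := (RingTheory.Sequence.isWeaklyRegular_map_algebraMap_iff (R ⧸ I) (R ⧸ I) _).2 hreg
    refine ⟨_, ?_, RingTheory.Sequence.IsWeaklyRegular.isRegular_of_isLocalization_of_mem
      (Localization.AtPrime P) P hreg' ?_, ?_⟩
    · intro r hr
      simp only [List.map_cons, List.map_nil, List.mem_cons, List.not_mem_nil, or_false] at hr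
      rcases hr with rfl | rfl <;> rw [IsLocalization.AtPrime.to_map_mem_maximal_iff _ P] <;>
        assumption
    · intro r hr
      simp only [List.map_cons, List.map_nil, List.mem_cons, List.not_mem_nil, or_false] at hr
      rcases hr with rfl | rfl <;> assumption
    · rw [hdim P]
      rfl

end UniqueExtension
end ArrCurve

namespace ArrCurve
open MvPolynomial
-- Dimension two for quotients by ideals of unions of lines
section Dimension
variable {k : Type*} [Field k]

/-- In `k[s][t] ≅ R/(a, b)` a maximal ideal `n` meets `k[s]` in a nonzero maximal ideal `(p)`, and
`0 < (p) < n` is a chain of primes. It serves both to build regular sequences and to bound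
dimensions below. -/
theorem exists_chain_of_span_pair_le {a b : CoordRing k} (ha : a.IsHomogeneous 1)
    (hb : b.IsHomogeneous 1) (hab : LinearIndependent k ![a, b]) {𝔪 : Ideal (CoordRing k)}
    (h𝔪 : 𝔪.IsMaximal) (hle : Ideal.span {a, b} ≤ 𝔪) :
    ∃ x ∈ 𝔪, ∃ y ∈ 𝔪, x ∉ Ideal.span {a, b} ∧ (Ideal.span {x} ⊔ Ideal.span {a, b}).IsPrime ∧
      y ∉ Ideal.span {x} ⊔ Ideal.span {a, b} := by
  obtain ⟨ψ, hψ, hker⟩ := exists_surjective_ker_eq_span_pair ha hb hab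
  have hcomap : ∀ J : Ideal (CoordRing k), (J.map ψ).comap ψ = J ⊔ Ideal.span {a, b} := by
    intro J
    rw [Ideal.comap_map_of_surjective' _ hψ, hker]
  have h𝔪' : (𝔪.map ψ).comap ψ = 𝔪 := by rw [hcomap, sup_eq_left.2 hle]
  have hn : (𝔪.map ψ).IsMaximal := by
    refine (Ideal.map_eq_top_or_isMaximal_of_surjective _ hψ h𝔪).resolve_left fun htop =>
      h𝔪.ne_top ?_
    rw [← h𝔪', htop, Ideal.comap_top]
  set n := 𝔪.map ψ
  have h𝔭 : (n.comap (Polynomial.C : Polynomial k →+* _)).IsMaximal :=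
    Polynomial.isMaximal_comap_C_of_isJacobsonRing n
  set 𝔭 := n.comap (Polynomial.C : Polynomial k →+* _) with h𝔭def
  have h𝔭₀ : 𝔭 ≠ ⊥ := fun h => Ring.ne_bot_of_isMaximal_of_not_isField h𝔭
    (Polynomial.not_isField k) h
  obtain ⟨p, hp⟩ := (IsPrincipalIdealRing.principal 𝔭).principal
  have hp' : 𝔭 = Ideal.span {p} := hp
  have hp₀ : p ≠ 0 := by
    rintro rfl
    exact h𝔭₀ (by rw [hp']; simp)
  have hmap : 𝔭.map Polynomial.C = Ideal.span {Polynomial.C p} := by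
    rw [hp', Ideal.map_span, Set.image_singleton]
  -- The extended ideal is not maximal: the variable would be invertible modulo it, and comparing
  -- constant coefficients would put `1` in `𝔭`.
  have hlt : ∃ q ∈ n, q ∉ 𝔭.map Polynomial.C := by
    by_contra! hcon
    have hXn : (Polynomial.X : Polynomial (Polynomial k)) ∉ n := fun hX => by
      have := Ideal.mem_map_C_iff.1 (hcon _ hX) 1
      rw [Polynomial.coeff_X_one] at this
      exact h𝔭.ne_top ((Ideal.eq_top_iff_one _).2 this)
    obtain ⟨c, i, hi, hci⟩ := hn.exists_inv hXn
    have := Ideal.mem_map_C_iff.1 (hcon _ hi) 0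
    have e := congrArg (fun f => Polynomial.coeff f 0) hci
    simp only [Polynomial.coeff_add, Polynomial.mul_coeff_zero, Polynomial.coeff_X_zero, mul_zero,
      zero_add, Polynomial.coeff_one_zero] at e
    rw [e] at this
    exact h𝔭.ne_top ((Ideal.eq_top_iff_one _).2 this)
  obtain ⟨q, hq, hq'⟩ := hlt
  obtain ⟨x, hx⟩ := hψ (Polynomial.C p)
  obtain ⟨y, hy⟩ := hψ q
  have hspan : Ideal.span {x} ⊔ Ideal.span {a, b} = (𝔭.map Polynomial.C).comap ψ := by
    rw [← hcomap, Ideal.map_span, Set.image_singleton, hx, hmap]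
  refine ⟨x, ?_, y, ?_, ?_, ?_, ?_⟩
  · rw [← h𝔪', Ideal.mem_comap, hx, ← Ideal.mem_comap, ← h𝔭def, hp']
    exact Ideal.mem_span_singleton_self p
  · rw [← h𝔪', Ideal.mem_comap, hy]
    exact hq
  · rw [← hker, RingHom.mem_ker, hx]
    simpa using hp₀
  · rw [hspan]
    have := Ideal.isPrime_map_C_of_isPrime (P := 𝔭)
    exact Ideal.comap_isPrime ψ _
  · rw [hspan, Ideal.mem_comap, hy]
    exact hq'

theorem hasUniqueExtension_quotient_span_pair {a b : CoordRing k} (ha : a.IsHomogeneous 1)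
    (hb : b.IsHomogeneous 1) (hab : LinearIndependent k ![a, b]) {𝔪 : Ideal (CoordRing k)}
    (h𝔪 : 𝔪.IsMaximal) : HasUniqueExtension 𝔪 (CoordRing k ⧸ Ideal.span {a, b}) := by
  by_cases hle : Ideal.span {a, b} ≤ 𝔪
  swap
  · exact hasUniqueExtension_quotient_of_not_le h𝔪 hle
  obtain ⟨x, hx, y, hy, hxP, hprime, hyP⟩ := exists_chain_of_span_pair_le ha hb hab h𝔪 hle
  have hP := isPrime_span_pair ha hb hab
  refine HasUniqueExtension.of_isWeaklyRegular hx hy (isWeaklyRegular_pair_iff.2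
    ⟨fun u hu => ?_, fun v w hvw => ?_⟩)
  · obtain ⟨u, rfl⟩ := Ideal.Quotient.mk_surjective u
    change Ideal.Quotient.mk _ (x * u) = 0 at hu
    rw [Ideal.Quotient.eq_zero_iff_mem] at hu
    exact Ideal.Quotient.eq_zero_iff_mem.2 ((hP.mem_or_mem hu).resolve_left hxP)
  · obtain ⟨v, rfl⟩ := Ideal.Quotient.mk_surjective v
    obtain ⟨w, rfl⟩ := Ideal.Quotient.mk_surjective w
    change Ideal.Quotient.mk _ (y * v) = Ideal.Quotient.mk _ (x * w) at hvw
    rw [Ideal.Quotient.eq] at hvw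
    have hyv : y * v ∈ Ideal.span {x} ⊔ Ideal.span {a, b} := by
      rw [← sub_add_cancel (y * v) (x * w)]
      exact Ideal.add_mem _ (Ideal.mem_sup_right hvw) (Ideal.mem_sup_left
        (Ideal.mul_mem_right _ _ (Ideal.mem_span_singleton_self x)))
    obtain ⟨c, d, hd, hcd⟩ :=
      Ideal.mem_span_singleton_sup.1 ((hprime.mem_or_mem hyv).resolve_left hyP)
    refine ⟨Ideal.Quotient.mk _ c, ?_⟩
    change Ideal.Quotient.mk _ v = Ideal.Quotient.mk _ (x * c)
    rw [Ideal.Quotient.eq, ← hcd]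
    convert hd using 1
    ring

/-- The ideal `I` defines a union of lines: every prime containing `I` contains a prime ideal,
generated by two linear forms, which contains `I`. -/
def IsLineArrangementIdeal (I : Ideal (CoordRing k)) : Prop :=
  ∀ p : Ideal (CoordRing k), p.IsPrime → I ≤ p → ∃ a b : CoordRing k, a.IsHomogeneous 1 ∧
    b.IsHomogeneous 1 ∧ LinearIndependent k ![a, b] ∧ I ≤ Ideal.span {a, b} ∧ Ideal.span {a, b} ≤ p

/-- A chain of primes in `R/I` pulls back to `R`, where its bottom prime contains the prime of a
line and so already has height at least two. -/
theorem IsLineArrangementIdeal.height_add_two_le {I : Ideal (CoordRing k)}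
    (hI : IsLineArrangementIdeal I) (n : ℕ) (P : Ideal (CoordRing k ⧸ I)) [P.IsPrime]
    (hn : n ≤ P.height) : ((n + 2 : ℕ) : ℕ∞) ≤ (P.comap (Ideal.Quotient.mk I)).height := by
  induction n generalizing P with
  | zero =>
    have hIP : I ≤ P.comap (Ideal.Quotient.mk I) := by
      intro x hx
      rw [Ideal.mem_comap, Ideal.Quotient.eq_zero_iff_mem.2 hx]
      exact P.zero_mem
    obtain ⟨a, b, ha, hb, hab, -, hle⟩ := hI _ inferInstance hIP
    calc ((0 + 2 : ℕ) : ℕ∞) = (Ideal.span {a, b}).height := by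
          rw [height_span_pair ha hb hab]; rfl
      _ ≤ _ := Ideal.height_mono hle
  | succ n ih =>
    have hnot : ¬ P.height ≤ (n : ℕ∞) := fun h => by
      have := hn.trans h
      norm_cast at this
      omega
    rw [Ideal.height_le_iff] at hnot
    push Not at hnot
    obtain ⟨Q, hQ, hQP, hnQ⟩ := hnot
    have h1 := ih Q hnQ
    have hlt : Q.comap (Ideal.Quotient.mk I) < P.comap (Ideal.Quotient.mk I) := by
      refine lt_of_le_of_ne (Ideal.comap_mono hQP.le) fun h => hQP.ne ?_
      exact Ideal.comap_injective_of_surjective _ Ideal.Quotient.mk_surjective h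
    calc ((n + 1 + 2 : ℕ) : ℕ∞) = ((n + 2 : ℕ) : ℕ∞) + 1 := by push_cast; ring
      _ ≤ (Q.comap (Ideal.Quotient.mk I)).height + 1 := by gcongr
      _ ≤ _ := Ideal.height_add_one_le_of_lt_of_isPrime hlt

theorem IsLineArrangementIdeal.ringKrullDim_localization {I : Ideal (CoordRing k)}
    (hI : IsLineArrangementIdeal I) (P : Ideal (CoordRing k ⧸ I)) [hP : P.IsMaximal] :
    ringKrullDim (Localization.AtPrime P) = 2 := by
  refine (IsLocalization.AtPrime.ringKrullDim_eq_height P (Localization.AtPrime P)).trans ?_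
  suffices h : P.height = 2 by rw [h]; rfl
  have h𝔪 : (P.comap (Ideal.Quotient.mk I)).IsMaximal :=
    Ideal.comap_isMaximal_of_surjective _ Ideal.Quotient.mk_surjective
  have hIP : I ≤ P.comap (Ideal.Quotient.mk I) := by
    intro x hx
    rw [Ideal.mem_comap, Ideal.Quotient.eq_zero_iff_mem.2 hx]
    exact P.zero_mem
  apply le_antisymm
  · by_contra hcon
    -- Height three in the quotient would force height five in a ring of dimension four.
    have h3 : ((3 : ℕ) : ℕ∞) ≤ P.height := by
      have := Order.add_one_le_of_lt (not_le.1 hcon)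
      exact le_trans (by norm_num) this
    have h5 := hI.height_add_two_le 3 P h3
    have h4 := Ideal.height_le_ringKrullDim_of_isPrime (I := P.comap (Ideal.Quotient.mk I))
    rw [MvPolynomial.ringKrullDim_of_isNoetherianRing, ringKrullDim_eq_zero_of_field, zero_add,
      Nat.card_eq_fintype_card, Fintype.card_fin] at h4
    have h4' : (P.comap (Ideal.Quotient.mk I)).height ≤ ((4 : ℕ) : ℕ∞) := by
      exact WithBot.coe_le_coe.1 h4
    have := h5.trans h4'
    norm_cast at this
  · obtain ⟨a, b, ha, hb, hab, hI', hle⟩ := hI _ inferInstance hIP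
    obtain ⟨x, hx, y, hy, hxP, hprime, hyP⟩ := exists_chain_of_span_pair_le ha hb hab h𝔪 hle
    have hP₀ := isPrime_span_pair ha hb hab
    have hcm : ∀ J : Ideal (CoordRing k), I ≤ J →
        (J.map (Ideal.Quotient.mk I)).comap (Ideal.Quotient.mk I) = J := by
      intro J hJ
      rw [Ideal.comap_map_of_surjective' _ Ideal.Quotient.mk_surjective, Ideal.mk_ker,
        sup_eq_left.2 hJ]
    have hpr : ∀ J : Ideal (CoordRing k), I ≤ J → J.IsPrime →
        (J.map (Ideal.Quotient.mk I)).IsPrime := by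
      intro J hJ hJ'
      refine Ideal.map_isPrime_of_surjective Ideal.Quotient.mk_surjective ?_
      rwa [Ideal.mk_ker]
    have hI'' := hI'.trans (le_sup_right : _ ≤ Ideal.span {x} ⊔ Ideal.span {a, b})
    have i₀ := hpr _ hI' hP₀
    have i₁ := hpr _ hI'' hprime
    have h01 : (Ideal.span {a, b}).map (Ideal.Quotient.mk I) <
        (Ideal.span {x} ⊔ Ideal.span {a, b}).map (Ideal.Quotient.mk I) := by
      refine lt_of_le_of_ne (Ideal.map_mono le_sup_right) fun h => hxP ?_
      have := congrArg (Ideal.comap (Ideal.Quotient.mk I)) h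
      rw [hcm _ hI', hcm _ hI''] at this
      rw [this]
      exact Ideal.mem_sup_left (Ideal.mem_span_singleton_self x)
    have h12 : (Ideal.span {x} ⊔ Ideal.span {a, b}).map (Ideal.Quotient.mk I) < P := by
      refine lt_of_le_of_ne (Ideal.map_le_iff_le_comap.2 (sup_le ?_ hle)) fun h => hyP ?_
      · rwa [Ideal.span_singleton_le_iff_mem]
      · have := congrArg (Ideal.comap (Ideal.Quotient.mk I)) h
        rw [hcm _ hI''] at this
        rw [this]
        exact hy
    have e1 := Ideal.height_add_one_le_of_lt_of_isPrime h01
    have e2 := Ideal.height_add_one_le_of_lt_of_isPrime h12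
    calc (2 : ℕ∞) = 0 + 1 + 1 := by norm_num
      _ ≤ ((Ideal.span {a, b}).map (Ideal.Quotient.mk I)).height + 1 + 1 := by
        gcongr; exact zero_le
      _ ≤ _ := le_trans (by gcongr) e2

theorem IsLineArrangementIdeal.isACM_iff {I : Ideal (CoordRing k)}
    (hI : IsLineArrangementIdeal I) :
    IsACM I ↔ ∀ 𝔪 : Ideal (CoordRing k), 𝔪.IsMaximal → HasUniqueExtension 𝔪 (CoordRing k ⧸ I) :=
  isCMRing_quotient_iff fun P _ => hI.ringKrullDim_localization P

end Dimension
end ArrCurve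

namespace ArrCurve
open MvPolynomial
-- The top-dimensional part through localization
section TopDimPart
variable {k : Type*} [Field k]

/-- An isolated primary component is the contraction of the localization at its radical, hence
independent of the decomposition. -/
theorem mem_of_mem_isMinimalPrimaryDecomposition_iff {R : Type*} [CommRing R] {J : Ideal R}
    {t : Finset (Ideal R)} (ht : Submodule.IsMinimalPrimaryDecomposition J t) {q : Ideal R}
    (hq : q ∈ t) (hmin : q.radical ∈ J.minimalPrimes) (f : R) :
    f ∈ q ↔ ∃ s ∉ q.radical, s * f ∈ J := by
  have hprim : q.IsPrimary := ht.primary hq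
  have hprime : q.radical.IsPrime := hmin.1.1
  have hJ : J = t.inf id := ht.inf_eq.symm
  constructor
  · intro hf
    -- Otherwise another component would have its radical inside this minimal prime, hence equal to
    -- it, and a minimal decomposition has distinct radicals.
    have hnot : ¬ (t.erase q).inf id ≤ q.radical := by
      classical
      intro hle
      obtain ⟨q', hq', hle'⟩ := hprime.inf_le'.1 hle
      obtain ⟨hne, hq't⟩ := Finset.mem_erase.1 hq'
      have hprime' : q'.radical.IsPrime := Ideal.isPrime_radical (ht.primary hq't)
      have h1 : q'.radical ≤ q.radical := hprime.radical_le_iff.2 hle'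
      have h2 : J ≤ q'.radical := by
        rw [hJ]
        exact (Finset.inf_le (f := id) hq't).trans Ideal.le_radical
      have heq : q'.radical = q.radical := le_antisymm h1 (hmin.2 ⟨hprime', h2⟩ h1)
      refine ht.distinct hq't hq hne ?_
      simpa using heq
    obtain ⟨s, hs, hs'⟩ := SetLike.not_le_iff_exists.1 hnot
    refine ⟨s, hs', ?_⟩
    rw [hJ, Submodule.mem_finsetInf]
    intro q' hq'
    by_cases hqq : q' = q
    · rw [hqq]
      exact q.mul_mem_left s hf
    · exact Ideal.mul_mem_right f _ ((Submodule.mem_finsetInf.1 hs) q' (Finset.mem_erase.2 ⟨hqq, hq'⟩))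
  · rintro ⟨s, hs, hsf⟩
    have : s * f ∈ q := by
      rw [hJ] at hsf
      exact Finset.inf_le (f := id) hq hsf
    rw [mul_comm] at this
    exact ((Ideal.isPrimary_iff.1 hprim).2 this).resolve_right hs

theorem mem_topDimPart_iff {J : Ideal (CoordRing k)}
    (hJ : ∀ P : Ideal (CoordRing k), P.IsPrime → J ≤ P → P.height = 2 → P ∈ J.minimalPrimes)
    (f : CoordRing k) :
    f ∈ topDimPart J ↔ ∀ P : Ideal (CoordRing k), P.IsPrime → J ≤ P → P.height = 2 →
      ∃ s ∉ P, s * f ∈ J := by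
  rw [topDimPart, Submodule.mem_sInf]
  constructor
  · intro h P hP hJP hP2
    have hmin := hJ P hP hJP hP2
    obtain ⟨t, ht⟩ := Submodule.IsLasker.exists_isMinimalPrimaryDecomposition
      (Submodule.isLasker (CoordRing k) (CoordRing k)) J
    obtain ⟨q, hq, rfl⟩ :=
      Ideal.IsMinimalPrimaryDecomposition.minimalPrimes_subset_image_radical ht hmin
    exact (mem_of_mem_isMinimalPrimaryDecomposition_iff ht hq hmin f).1 (h q ⟨t, ht, hq, hP2⟩)
  · intro h (q : Ideal (CoordRing k)) hq'
    obtain ⟨t, ht, hq, hq2⟩ := hq'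
    have hprime : q.radical.IsPrime := Ideal.isPrime_radical (ht.primary hq)
    have hle : J ≤ q.radical := by
      rw [← ht.inf_eq]
      exact (Finset.inf_le (f := id) hq).trans Ideal.le_radical
    exact (mem_of_mem_isMinimalPrimaryDecomposition_iff ht hq (hJ _ hprime hle hq2) f).2
      (h _ hprime hle hq2)

end TopDimPart

/-! ### Jacobian ideals of products and directional derivatives -/

section Jacobian
variable {k : Type*} [Field k]

theorem pderiv_mem_jacobianIdeal (F : CoordRing k) (i : Fin 4) :
    pderiv i F ∈ jacobianIdeal F := Ideal.subset_span ⟨i, rfl⟩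

theorem jacobianIdeal_le_iff {F : CoordRing k} {I : Ideal (CoordRing k)} :
    jacobianIdeal F ≤ I ↔ ∀ i, pderiv i F ∈ I := by
  rw [jacobianIdeal, Ideal.span_le, Set.range_subset_iff]
  rfl

theorem self_mem_jacobianIdeal [CharZero k] {F : CoordRing k} {n : ℕ} (hF : F.IsHomogeneous n)
    (hn : n ≠ 0) : F ∈ jacobianIdeal F := by
  have h : (n : CoordRing k) * F ∈ jacobianIdeal F := by
    rw [← nsmul_eq_mul, ← hF.sum_X_mul_pderiv]
    exact Ideal.sum_mem _ fun i _ => Ideal.mul_mem_left _ _ (pderiv_mem_jacobianIdeal F i)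
  have h' := Ideal.mul_mem_left _ (C (n : k)⁻¹) h
  rwa [← mul_assoc, ← C_eq_coe_nat, ← C_mul, inv_mul_cancel₀ (Nat.cast_ne_zero.2 hn), C_1,
    one_mul] at h'

theorem jacobianIdeal_mul_le {F : CoordRing k} (hF : F ∈ jacobianIdeal F) (L : CoordRing k) :
    jacobianIdeal (L * F) ≤ jacobianIdeal F := by
  rw [jacobianIdeal_le_iff]
  intro i
  rw [Derivation.leibniz, smul_eq_mul, smul_eq_mul]
  exact Ideal.add_mem _ (Ideal.mul_mem_left _ _ (pderiv_mem_jacobianIdeal F i))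
    (Ideal.mul_mem_right _ _ hF)

/-- From `L² ∂F = L ∂(L F) - (∂L) L F`. Together with `jacobianIdeal_mul_le` this makes the two
Jacobian ideals agree wherever `L` is invertible. -/
theorem sq_mul_mem_jacobianIdeal {F L : CoordRing k} (hF : L * F ∈ jacobianIdeal (L * F))
    {f : CoordRing k} (hf : f ∈ jacobianIdeal F) : L ^ 2 * f ∈ jacobianIdeal (L * F) := by
  have hle : jacobianIdeal F ≤ (jacobianIdeal (L * F)).colon {L ^ 2} := by
    rw [jacobianIdeal_le_iff]
    intro i
    rw [Submodule.mem_colon_singleton, smul_eq_mul]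
    have e : pderiv i F * L ^ 2 = L * pderiv i (L * F) - pderiv i L * (L * F) := by
      rw [Derivation.leibniz, smul_eq_mul, smul_eq_mul]
      ring
    rw [e]
    exact Ideal.sub_mem _ (Ideal.mul_mem_left _ _ (pderiv_mem_jacobianIdeal _ i))
      (Ideal.mul_mem_left _ _ hF)
  have := hle hf
  rwa [Submodule.mem_colon_singleton, smul_eq_mul, mul_comm f] at this

/-- The derivation of `k[x₀, …, x₃]` along the vector `v`. -/
noncomputable def dirDeriv (v : Fin 4 → k) : Derivation k (CoordRing k) (CoordRing k) :=
  mkDerivation k fun i => C (v i)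

theorem dirDeriv_apply (v : Fin 4 → k) (F : CoordRing k) :
    dirDeriv v F = ∑ i, C (v i) * pderiv i F := by
  have : dirDeriv v = ∑ i, (C (v i) : CoordRing k) • pderiv i := by
    refine derivation_ext fun j => ?_
    rw [dirDeriv, mkDerivation_X, Fin.sum_univ_four]
    fin_cases j <;> simp [pderiv_X]
  rw [this, Fin.sum_univ_four, Fin.sum_univ_four]
  rfl

theorem dirDeriv_linearForm (v : Fin 4 → k) {a : CoordRing k} (ha : a.IsHomogeneous 1) :
    dirDeriv v a = C (eval v a) := by
  rw [linearForm_eq_sum ha, map_sum, map_sum, map_sum]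
  refine Finset.sum_congr rfl fun i _ => ?_
  rw [← smul_eq_C_mul, Derivation.map_smul, dirDeriv, mkDerivation_X]
  simp [smul_eq_C_mul]

theorem pderiv_eq_dirDeriv (i : Fin 4) (F : CoordRing k) :
    pderiv i F = dirDeriv (Pi.single i 1) F := by
  rw [dirDeriv_apply]
  simp [Pi.single_apply, Finset.sum_ite_eq', apply_ite C]

theorem dirDeriv_mem_jacobianIdeal (v : Fin 4 → k) (F : CoordRing k) :
    dirDeriv v F ∈ jacobianIdeal F := by
  rw [dirDeriv_apply]
  exact Ideal.sum_mem _ fun i _ => Ideal.mul_mem_left _ _ (pderiv_mem_jacobianIdeal F i)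

theorem pderiv_linearForm (i : Fin 4) {a : CoordRing k} (ha : a.IsHomogeneous 1) :
    pderiv i a = C (coeff (Finsupp.single i 1) a) := by
  rw [pderiv_eq_dirDeriv, dirDeriv_linearForm _ ha]
  conv_lhs => rw [linearForm_eq_sum ha]
  simp [Pi.single_apply]

theorem exists_coeff_ne_zero_of_linearForm {a : CoordRing k} (ha : a.IsHomogeneous 1)
    (ha₀ : a ≠ 0) : ∃ i, coeff (Finsupp.single i 1) a ≠ 0 := by
  by_contra! h
  apply ha₀
  rw [linearForm_eq_sum ha]
  simp [h]

theorem jacobianIdeal_mul_linearForms {a b : CoordRing k} (ha : a.IsHomogeneous 1)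
    (hb : b.IsHomogeneous 1) (hab : LinearIndependent k ![a, b]) :
    jacobianIdeal (a * b) = Ideal.span {a, b} := by
  have hpd : ∀ i, pderiv i (a * b) = C (coeff (Finsupp.single i 1) b) * a +
      C (coeff (Finsupp.single i 1) a) * b := by
    intro i
    rw [Derivation.leibniz, pderiv_linearForm i ha, pderiv_linearForm i hb, smul_eq_mul,
      smul_eq_mul]
    ring
  apply le_antisymm
  · rw [jacobianIdeal_le_iff]
    intro i
    rw [hpd]
    exact Ideal.mem_span_pair.2 ⟨_, _, rfl⟩
  -- The derivatives of `a b` are combinations of `a` and `b` with coefficient rows `(b i, a i)`. A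
  -- nonzero 2×2 minor, which exists by independence, lets one solve for `a` and `b`.
  · have hminor : ∃ i j, coeff (Finsupp.single i 1) a * coeff (Finsupp.single j 1) b -
        coeff (Finsupp.single j 1) a * coeff (Finsupp.single i 1) b ≠ 0 := by
      by_contra! h
      obtain ⟨i, hi⟩ := exists_coeff_ne_zero_of_linearForm ha (hab.ne_zero 0)
      refine (linearIndependent_iff_not_dvd ha hb (hab.ne_zero 0)).1 hab
        ⟨C (coeff (Finsupp.single i 1) b / coeff (Finsupp.single i 1) a), ?_⟩
      rw [mul_comm]
      set r := coeff (Finsupp.single i 1) b / coeff (Finsupp.single i 1) a with hr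
      refine (linearForm_eq_sum hb).trans (Eq.trans ?_
        (congrArg (C r * ·) (linearForm_eq_sum ha).symm))
      change _ = C r * ∑ i, C (coeff (Finsupp.single i 1) a) * X i
      rw [Finset.mul_sum]
      refine Finset.sum_congr rfl fun j _ => ?_
      rw [← mul_assoc, ← C_mul]
      congr 2
      have := h i j
      rw [hr]
      field_simp
      linear_combination this
    obtain ⟨i, j, hij⟩ := hminor
    set a' := fun i => coeff (Finsupp.single i 1) a
    set b' := fun i => coeff (Finsupp.single i 1) b
    have hcancel : ∀ {c : k} {f : CoordRing k}, c ≠ 0 → C c * f ∈ jacobianIdeal (a * b) →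
        f ∈ jacobianIdeal (a * b) := by
      intro c f hc hf
      have := Ideal.mul_mem_left _ (C c⁻¹) hf
      rwa [← mul_assoc, ← C_mul, inv_mul_cancel₀ hc, C_1, one_mul] at this
    rw [Ideal.span_le]
    rintro x (rfl | rfl)
    · refine hcancel hij ?_
      have e : C (a' i * b' j - a' j * b' i) * x =
          C (a' i) * pderiv j (x * b) - C (a' j) * pderiv i (x * b) := by
        rw [hpd, hpd]
        simp only [C_sub, C_mul, a', b']
        ring
      rw [e]
      exact Ideal.sub_mem _ (Ideal.mul_mem_left _ _ (pderiv_mem_jacobianIdeal _ _))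
        (Ideal.mul_mem_left _ _ (pderiv_mem_jacobianIdeal _ _))
    · refine hcancel hij ?_
      have e : C (a' i * b' j - a' j * b' i) * x =
          C (b' j) * pderiv i (a * x) - C (b' i) * pderiv j (a * x) := by
        rw [hpd, hpd]
        simp only [C_sub, C_mul, a', b']
        ring
      rw [e]
      exact Ideal.sub_mem _ (Ideal.mul_mem_left _ _ (pderiv_mem_jacobianIdeal _ _))
        (Ideal.mul_mem_left _ _ (pderiv_mem_jacobianIdeal _ _))

/-- A line is not contained in the vertex of the cone, so some variable is invertible along it;
hence saturation changes nothing at the prime of a line. -/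
theorem exists_X_notMem_span_pair {a b : CoordRing k} (ha : a.IsHomogeneous 1)
    (hb : b.IsHomogeneous 1) (hab : LinearIndependent k ![a, b]) :
    ∃ i, (X i : CoordRing k) ∉ Ideal.span {a, b} := by
  obtain ⟨ψ, hψ, hker⟩ := exists_surjective_ker_eq_span_pair ha hb hab
  by_contra! h
  have hψ0 : ψ = aeval (fun _ => 0) := by
    refine algHom_ext fun i => ?_
    rw [aeval_X, ← RingHom.mem_ker, hker]
    exact h i
  obtain ⟨p, hp⟩ := hψ Polynomial.X
  rw [hψ0] at hp
  have hp' : algebraMap k (Polynomial (Polynomial k)) (constantCoeff p) = Polynomial.X := by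
    rw [← hp]
    exact (aeval_zero' p).symm
  have := congrArg (fun f => Polynomial.coeff f 1) hp'
  simp [IsScalarTower.algebraMap_apply k (Polynomial k) (Polynomial (Polynomial k))] at this

theorem le_saturation (I : Ideal (CoordRing k)) : I ≤ saturation I := by
  intro f hf
  change ∃ n : ℕ, ∀ g ∈ irrelevantIdeal k ^ n, g * f ∈ I
  exact ⟨0, fun g _ => I.mul_mem_left g hf⟩

theorem exists_pow_X_mul_mem_of_mem_saturation {I : Ideal (CoordRing k)} {f : CoordRing k}
    (hf : f ∈ saturation I) : ∃ n, ∀ i, X i ^ n * f ∈ I := by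
  obtain ⟨n, hn⟩ := hf
  exact ⟨n, fun i => hn _ (Ideal.pow_mem_pow (Ideal.subset_span (Set.mem_range_self i)) n)⟩

end Jacobian

/-! ### The two curve ideals in terms of the lines of the arrangement -/

section Arrangement
variable {k : Type*} [Field k] {n : ℕ}

/-- The linear forms `ℓ i` define distinct planes. -/
structure IsArrangement (ℓ : Fin n → CoordRing k) : Prop where
  isHomogeneous : ∀ i, (ℓ i).IsHomogeneous 1
  ne_zero : ∀ i, ℓ i ≠ 0
  linearIndependent : ∀ i j, i ≠ j → LinearIndependent k ![ℓ i, ℓ j]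

namespace IsArrangement
variable {ℓ : Fin n → CoordRing k}

theorem prime (h : IsArrangement ℓ) (i : Fin n) : Prime (ℓ i) :=
  linearForm_prime (h.isHomogeneous i) (h.ne_zero i)

theorem isPrime_span (h : IsArrangement ℓ) {i j : Fin n} (hij : i ≠ j) :
    (Ideal.span {ℓ i, ℓ j}).IsPrime :=
  isPrime_span_pair (h.isHomogeneous i) (h.isHomogeneous j) (h.linearIndependent i j hij)

theorem height_span (h : IsArrangement ℓ) {i j : Fin n} (hij : i ≠ j) :
    (Ideal.span {ℓ i, ℓ j}).height = 2 :=
  height_span_pair (h.isHomogeneous i) (h.isHomogeneous j) (h.linearIndependent i j hij)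

theorem not_dvd (h : IsArrangement ℓ) {i j : Fin n} (hij : i ≠ j) : ¬ ℓ i ∣ ℓ j :=
  (linearIndependent_iff_not_dvd (h.isHomogeneous i) (h.isHomogeneous j) (h.ne_zero i)).1
    (h.linearIndependent i j hij)

theorem isHomogeneous_prod (h : IsArrangement ℓ) : (∏ i, ℓ i).IsHomogeneous n := by
  simpa using IsHomogeneous.prod Finset.univ ℓ (fun _ => 1) fun i _ => h.isHomogeneous i

theorem prod_mem_jacobianIdeal [CharZero k] (h : IsArrangement ℓ) (hn : n ≠ 0) :
    ∏ i, ℓ i ∈ jacobianIdeal (∏ i, ℓ i) :=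
  self_mem_jacobianIdeal h.isHomogeneous_prod hn

theorem jacobianIdeal_le_span {i j : Fin n} (hij : i ≠ j) :
    jacobianIdeal (∏ i, ℓ i) ≤ Ideal.span {ℓ i, ℓ j} := by
  rw [jacobianIdeal_le_iff]
  intro q
  rw [← Finset.mul_prod_erase Finset.univ ℓ (Finset.mem_univ i), ← Finset.mul_prod_erase _ ℓ
    (Finset.mem_erase.2 ⟨hij.symm, Finset.mem_univ j⟩), Derivation.leibniz, Derivation.leibniz]
  simp only [smul_eq_mul]
  exact Ideal.mem_span_pair.2 ⟨ℓ j * pderiv q (∏ l ∈ (Finset.univ.erase i).erase j, ℓ l) +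
    (∏ l ∈ (Finset.univ.erase i).erase j, ℓ l) * pderiv q (ℓ j),
    (∏ l ∈ (Finset.univ.erase i).erase j, ℓ l) * pderiv q (ℓ i), by ring⟩

/-- Euler's formula puts a factor `ℓ i` in the prime. Choose a derivative with `∂(ℓ i)` a nonzero
constant: modulo `ℓ i` it leaves the product of the other factors. -/
theorem exists_span_le [CharZero k] (h : IsArrangement ℓ) (hn : n ≠ 0) {p : Ideal (CoordRing k)}
    (hp : p.IsPrime) (hle : jacobianIdeal (∏ i, ℓ i) ≤ p) :
    ∃ i j, i ≠ j ∧ Ideal.span {ℓ i, ℓ j} ≤ p := by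
  obtain ⟨i, -, hi⟩ := hp.prod_mem_iff.1 (hle (h.prod_mem_jacobianIdeal hn))
  obtain ⟨q, hq⟩ := exists_coeff_ne_zero_of_linearForm (h.isHomogeneous i) (h.ne_zero i)
  have hd := hle (pderiv_mem_jacobianIdeal _ q)
  rw [← Finset.mul_prod_erase Finset.univ ℓ (Finset.mem_univ i), Derivation.leibniz,
    pderiv_linearForm q (h.isHomogeneous i), smul_eq_mul, smul_eq_mul,
    Ideal.add_mem_iff_right _ (Ideal.mul_mem_right _ _ hi)] at hd
  have hd' := (hp.mem_or_mem hd).resolve_right fun hC => hp.ne_top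
    (Ideal.eq_top_of_isUnit_mem _ hC ((isUnit_iff_ne_zero.2 hq).map C))
  obtain ⟨j, hj, hj'⟩ := hp.prod_mem_iff.1 hd'
  refine ⟨i, j, (Finset.ne_of_mem_erase hj).symm, ?_⟩
  rw [Ideal.span_le]
  rintro x (rfl | rfl) <;> assumption

theorem eq_span_of_height [CharZero k] (h : IsArrangement ℓ) (hn : n ≠ 0)
    {p : Ideal (CoordRing k)} (hp : p.IsPrime) (hle : jacobianIdeal (∏ i, ℓ i) ≤ p)
    (hp2 : p.height ≤ 2) : ∃ i j, i ≠ j ∧ p = Ideal.span {ℓ i, ℓ j} := by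
  obtain ⟨i, j, hij, hle'⟩ := h.exists_span_le hn hp hle
  have := h.isPrime_span hij
  exact ⟨i, j, hij, (Ideal.eq_of_le_of_height_le _ hle' (by rwa [h.height_span hij])).symm⟩

theorem span_mem_minimalPrimes [CharZero k] (h : IsArrangement ℓ) (hn : n ≠ 0) {i j : Fin n}
    (hij : i ≠ j) : Ideal.span {ℓ i, ℓ j} ∈ (jacobianIdeal (∏ i, ℓ i)).minimalPrimes := by
  refine ⟨⟨h.isPrime_span hij, jacobianIdeal_le_span hij⟩, ?_⟩
  rintro p ⟨hp, hle⟩ hle'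
  obtain ⟨a, b, hab, rfl⟩ := h.eq_span_of_height hn hp hle
    ((Ideal.height_mono hle').trans (h.height_span hij).le)
  exact (Ideal.eq_of_le_of_height_le _ hle' (by rw [h.height_span hij, h.height_span hab])).ge

theorem mem_topCurveIdeal_iff [CharZero k] (h : IsArrangement ℓ) (hn : n ≠ 0) (f : CoordRing k) :
    f ∈ topCurveIdeal (∏ i, ℓ i) ↔ ∀ i j, i ≠ j →
      ∃ s ∉ Ideal.span {ℓ i, ℓ j}, s * f ∈ jacobianIdeal (∏ i, ℓ i) := by
  have hmem : ∀ f, f ∈ topDimPart (jacobianIdeal (∏ i, ℓ i)) ↔ ∀ i j, i ≠ j →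
      ∃ s ∉ Ideal.span {ℓ i, ℓ j}, s * f ∈ jacobianIdeal (∏ i, ℓ i) := by
    intro f
    rw [mem_topDimPart_iff]
    · constructor
      · exact fun hf i j hij => hf _ (h.isPrime_span hij) (jacobianIdeal_le_span hij)
          (h.height_span hij)
      · intro hf P hP hle hP2
        obtain ⟨i, j, hij, rfl⟩ := h.eq_span_of_height hn hP hle hP2.le
        exact hf i j hij
    · intro P hP hle hP2
      obtain ⟨i, j, hij, rfl⟩ := h.eq_span_of_height hn hP hle hP2.le
      exact h.span_mem_minimalPrimes hn hij
  constructor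
  · intro hf i j hij
    obtain ⟨N, hN⟩ := exists_pow_X_mul_mem_of_mem_saturation hf
    obtain ⟨e, he⟩ := exists_X_notMem_span_pair (h.isHomogeneous i) (h.isHomogeneous j)
      (h.linearIndependent i j hij)
    obtain ⟨s, hs, hsf⟩ := (hmem _).1 (hN e) i j hij
    have hprime := h.isPrime_span hij
    -- The power of a variable coming from the saturation is absorbed into the denominator.
    refine ⟨s * X e ^ N, fun hmem => (hprime.mem_or_mem hmem).elim hs fun he' =>
      he (hprime.mem_of_pow_mem N he'), ?_⟩
    rwa [mul_assoc]
  · exact fun hf => le_saturation _ ((hmem f).2 hf)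

theorem mem_redCurveIdeal_iff [CharZero k] (h : IsArrangement ℓ) (hn : n ≠ 0) (f : CoordRing k) :
    f ∈ redCurveIdeal (∏ i, ℓ i) ↔ ∀ i j, i ≠ j → f ∈ Ideal.span {ℓ i, ℓ j} := by
  constructor
  · intro hf i j hij
    obtain ⟨N, hN⟩ := exists_pow_X_mul_mem_of_mem_saturation hf
    obtain ⟨e, he⟩ := exists_X_notMem_span_pair (h.isHomogeneous i) (h.isHomogeneous j)
      (h.linearIndependent i j hij)
    have hprime := h.isPrime_span hij
    have := (hprime.radical_le_iff.2 (jacobianIdeal_le_span hij)) (hN e)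
    exact (hprime.mem_or_mem this).resolve_left fun he' => he (hprime.mem_of_pow_mem N he')
  · intro hf
    refine le_saturation _ ?_
    rw [Ideal.radical_eq_sInf, Submodule.mem_sInf]
    rintro p ⟨hle, hp⟩
    obtain ⟨i, j, hij, hle'⟩ := h.exists_span_le hn hp hle
    exact hle' (hf i j hij)

/-- Along a line that lies on no third plane the other factors are invertible, so the Jacobian ideal
is locally that of `ℓ i ℓ j`, which is the whole prime. The square of their product is the
denominator supplied by `sq_mul_mem_jacobianIdeal`. -/
theorem exists_mul_mem_jacobianIdeal [CharZero k] (h : IsArrangement ℓ) {i j : Fin n} (hij : i ≠ j)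
    (hij' : ∀ l, l ≠ i → l ≠ j → ℓ l ∉ Ideal.span {ℓ i, ℓ j}) :
    ∃ s ∉ Ideal.span {ℓ i, ℓ j}, ∀ f ∈ Ideal.span {ℓ i, ℓ j},
      s * f ∈ jacobianIdeal (∏ i, ℓ i) := by
  have hprime := h.isPrime_span hij
  have hprod : ∏ l, ℓ l = (∏ l ∈ (Finset.univ.erase i).erase j, ℓ l) * (ℓ i * ℓ j) := by
    rw [← Finset.mul_prod_erase Finset.univ ℓ (Finset.mem_univ i), ← Finset.mul_prod_erase _ ℓ
      (Finset.mem_erase.2 ⟨hij.symm, Finset.mem_univ j⟩)]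
    ring
  have hn : n ≠ 0 := fun h0 => (h0 ▸ i : Fin 0).elim0
  refine ⟨(∏ l ∈ (Finset.univ.erase i).erase j, ℓ l) ^ 2, fun hs => ?_, fun f hf => ?_⟩
  · obtain ⟨l, hl, hl'⟩ := hprime.prod_mem_iff.1 (hprime.mem_of_pow_mem 2 hs)
    simp only [Finset.mem_erase, Finset.mem_univ, and_true] at hl
    exact hij' l hl.2 hl.1 hl'
  · rw [← jacobianIdeal_mul_linearForms (h.isHomogeneous i) (h.isHomogeneous j)
      (h.linearIndependent i j hij)] at hf
    have := h.prod_mem_jacobianIdeal hn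
    rw [hprod] at this ⊢
    exact sq_mul_mem_jacobianIdeal this hf

end IsArrangement
end Arrangement
end ArrCurve

namespace ArrCurve
open MvPolynomial
-- The ideals of the enlarged arrangement as basic double links
section DoubleLink

/-- If `F ∈ I` and `L` is a nonzerodivisor modulo `I`, then `I ∩ (L, F) = L I + (F)`. -/
theorem mem_span_mul_add_span_iff {R : Type*} [CommRing R] {I : Ideal R} {F L : R} (hF : F ∈ I)
    (hL : ∀ x, L * x ∈ I → x ∈ I) (f : R) :
    f ∈ Ideal.span {L} * I + Ideal.span {F} ↔ f ∈ I ∧ f ∈ Ideal.span {L, F} := by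
  rw [Submodule.add_eq_sup]
  constructor
  · intro hf
    have h1 : Ideal.span {L} * I ⊔ Ideal.span {F} ≤ I :=
      sup_le Ideal.mul_le_right ((Ideal.span_singleton_le_iff_mem _).2 hF)
    have h2 : Ideal.span {L} * I ⊔ Ideal.span {F} ≤ Ideal.span {L, F} := by
      rw [Ideal.span_insert]
      exact sup_le_sup_right Ideal.mul_le_left _
    exact ⟨h1 hf, h2 hf⟩
  · rintro ⟨hfI, hf⟩
    obtain ⟨a, b, rfl⟩ := Ideal.mem_span_pair.1 hf
    have ha : a ∈ I := hL a (by
      rw [mul_comm]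
      exact (Ideal.add_mem_iff_left _ (I.mul_mem_left b hF)).1 hfI)
    rw [mul_comm a]
    exact Ideal.add_mem _ (Ideal.mem_sup_left (Ideal.mul_mem_mul
      (Ideal.mem_span_singleton_self L) ha)) (Ideal.mem_sup_right
      (Ideal.mul_mem_left _ _ (Ideal.mem_span_singleton_self F)))

end DoubleLink

namespace IsArrangement
variable {k : Type*} [Field k] {n : ℕ} {ℓ : Fin n → CoordRing k} {L : CoordRing k}

theorem cons (h : IsArrangement ℓ) (hL : L.IsHomogeneous 1) (hL₀ : L ≠ 0)
    (hLℓ : ∀ i, LinearIndependent k ![ℓ i, L]) :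
    IsArrangement (Fin.cons L ℓ : Fin (n + 1) → CoordRing k) where
  isHomogeneous i := by
    refine Fin.cases ?_ (fun i => ?_) i
    · exact hL
    · exact h.isHomogeneous i
  ne_zero i := by
    refine Fin.cases ?_ (fun i => ?_) i
    · exact hL₀
    · exact h.ne_zero i
  linearIndependent i j := by
    refine Fin.cases ?_ (fun i => ?_) i <;> refine Fin.cases ?_ (fun j => ?_) j
    · exact fun hne => absurd rfl hne
    · exact fun _ => LinearIndependent.pair_symm_iff.1 (hLℓ j)
    · exact fun _ => hLℓ i
    · exact fun hne => h.linearIndependent i j fun e => hne (congrArg Fin.succ e)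

/-- If `L` vanishes on none of the lines `ℓ i = ℓ j = 0`, then the lines `L = ℓ i = 0` lie on no
further plane of the arrangement. -/
theorem notMem_span_of_notMem (h : IsArrangement ℓ) (hL : L.IsHomogeneous 1)
    (hLC : ∀ i j, i ≠ j → L ∉ Ideal.span {ℓ i, ℓ j}) {i j : Fin n} (hij : i ≠ j) :
    ℓ j ∉ Ideal.span {L, ℓ i} := by
  intro hmem
  obtain ⟨α, β, hαβ⟩ := linearForm_mem_span_pair hL (h.isHomogeneous i) (h.isHomogeneous j) hmem
  have hα : α ≠ 0 := by
    rintro rfl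
    refine h.not_dvd hij ⟨C β, ?_⟩
    rw [hαβ, C_0]
    ring
  refine hLC i j hij (Ideal.mem_span_pair.2 ⟨- C (α⁻¹ * β), C α⁻¹, ?_⟩)
  have e : (C α⁻¹ * C α : CoordRing k) = 1 := by rw [← C_mul, inv_mul_cancel₀ hα, C_1]
  rw [hαβ, C_mul]
  linear_combination L * e

/-- The lines `L = ℓ i = 0` are distinct lines in the plane `L = 0`, so their union is cut out in it
by the product. Induction adds one line at a time, cancelling the remaining product modulo the prime
`(L, ℓ i)`. -/
theorem mem_span_pair_prod_iff (h : IsArrangement ℓ) (hL : L.IsHomogeneous 1)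
    (hLℓ : ∀ i, LinearIndependent k ![ℓ i, L])
    (hLC : ∀ i j, i ≠ j → L ∉ Ideal.span {ℓ i, ℓ j}) (s : Finset (Fin n)) (f : CoordRing k)
    (hs : s.Nonempty) :
    f ∈ Ideal.span {L, ∏ i ∈ s, ℓ i} ↔ ∀ i ∈ s, f ∈ Ideal.span {L, ℓ i} := by
  classical
  constructor
  · intro hf i hi
    obtain ⟨a, b, rfl⟩ := Ideal.mem_span_pair.1 hf
    rw [← Finset.mul_prod_erase s ℓ hi]
    exact Ideal.mem_span_pair.2 ⟨a, b * ∏ l ∈ s.erase i, ℓ l, by ring⟩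
  · induction hs using Finset.Nonempty.cons_induction with
    | singleton i => exact fun hf => by simpa using hf
    | cons i s hi hs ih =>
      intro hf
      obtain ⟨a, b, rfl⟩ := Ideal.mem_span_pair.1 (ih fun j hj => hf j (Finset.mem_cons_of_mem hj))
      have hprime := isPrime_span_pair hL (h.isHomogeneous i)
        (LinearIndependent.pair_symm_iff.1 (hLℓ i))
      have h1 := (Ideal.add_mem_iff_right _ (Ideal.mul_mem_left _ a
        (Ideal.subset_span (Set.mem_insert L {ℓ i})))).1 (hf i (Finset.mem_cons_self i s))
      have hb : b ∈ Ideal.span {L, ℓ i} := (hprime.mem_or_mem h1).resolve_right fun hmem => by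
        obtain ⟨j, hj, hj'⟩ := hprime.prod_mem_iff.1 hmem
        have hij : i ≠ j := by
          rintro rfl
          exact hi hj
        exact h.notMem_span_of_notMem hL hLC hij hj'
      obtain ⟨c, d, rfl⟩ := Ideal.mem_span_pair.1 hb
      rw [Finset.prod_cons]
      exact Ideal.mem_span_pair.2 ⟨a + c * ∏ l ∈ s, ℓ l, d, by ring⟩

section
variable [CharZero k] (h : IsArrangement ℓ) (hn : n ≠ 0) (hL : L.IsHomogeneous 1) (hL₀ : L ≠ 0)
  (hLℓ : ∀ i, LinearIndependent k ![ℓ i, L])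
  (hLC : ∀ i j, i ≠ j → L ∉ Ideal.span {ℓ i, ℓ j})

include h hn

theorem prod_mem_topCurveIdeal : ∏ i, ℓ i ∈ topCurveIdeal (∏ i, ℓ i) := by
  rw [h.mem_topCurveIdeal_iff hn]
  intro i j hij
  exact ⟨1, (Ideal.ne_top_iff_one _).1 (h.isPrime_span hij).ne_top, by
    rw [one_mul]
    exact h.prod_mem_jacobianIdeal hn⟩

theorem prod_mem_redCurveIdeal : ∏ i, ℓ i ∈ redCurveIdeal (∏ i, ℓ i) := by
  rw [h.mem_redCurveIdeal_iff hn]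
  exact fun i j hij => jacobianIdeal_le_span hij (h.prod_mem_jacobianIdeal hn)

include hLC

theorem mem_topCurveIdeal_of_mul_mem (x : CoordRing k)
    (hx : L * x ∈ topCurveIdeal (∏ i, ℓ i)) : x ∈ topCurveIdeal (∏ i, ℓ i) := by
  rw [h.mem_topCurveIdeal_iff hn] at hx ⊢
  intro i j hij
  obtain ⟨s, hs, hsx⟩ := hx i j hij
  refine ⟨s * L, fun hmem => ((h.isPrime_span hij).mem_or_mem hmem).elim hs (hLC i j hij), ?_⟩
  rwa [mul_assoc]

theorem mem_redCurveIdeal_of_mul_mem (x : CoordRing k)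
    (hx : L * x ∈ redCurveIdeal (∏ i, ℓ i)) : x ∈ redCurveIdeal (∏ i, ℓ i) := by
  rw [h.mem_redCurveIdeal_iff hn] at hx ⊢
  exact fun i j hij => ((h.isPrime_span hij).mem_or_mem (hx i j hij)).resolve_left (hLC i j hij)

include hL hL₀ hLℓ

theorem topCurveIdeal_mul : topCurveIdeal (L * ∏ i, ℓ i) =
    Ideal.span {L} * topCurveIdeal (∏ i, ℓ i) + Ideal.span {∏ i, ℓ i} := by
  have h' := h.cons hL hL₀ hLℓ
  have hF' := h'.prod_mem_jacobianIdeal n.succ_ne_zero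
  have hne : (Finset.univ : Finset (Fin n)).Nonempty := Finset.univ_nonempty_iff.2 ⟨⟨0, by omega⟩⟩
  ext f
  rw [mem_span_mul_add_span_iff (h.prod_mem_topCurveIdeal hn)
    (h.mem_topCurveIdeal_of_mul_mem hn hLC), h.mem_span_pair_prod_iff hL hLℓ hLC _ _ hne,
    h.mem_topCurveIdeal_iff hn, ← Fin.prod_cons, h'.mem_topCurveIdeal_iff n.succ_ne_zero]
  -- Old lines: `L` is invertible there, so passing to `L F` leaves the local condition unchanged.
  have hpair : ∀ i j : Fin n, i ≠ j → ((∃ s ∉ Ideal.span {ℓ i, ℓ j},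
      s * f ∈ jacobianIdeal (∏ i, (Fin.cons L ℓ : Fin (n + 1) → CoordRing k) i)) ↔
      ∃ s ∉ Ideal.span {ℓ i, ℓ j}, s * f ∈ jacobianIdeal (∏ i, ℓ i)) := by
    intro i j hij
    rw [Fin.prod_cons] at hF' ⊢
    constructor
    · rintro ⟨s, hs, hsf⟩
      exact ⟨s, hs, jacobianIdeal_mul_le (h.prod_mem_jacobianIdeal hn) L hsf⟩
    · rintro ⟨s, hs, hsf⟩
      have hprime := h.isPrime_span hij
      refine ⟨L ^ 2 * s, fun hmem => (hprime.mem_or_mem hmem).elim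
        (fun hL' => hLC i j hij (hprime.mem_of_pow_mem 2 hL')) hs, ?_⟩
      rw [mul_assoc]
      exact sq_mul_mem_jacobianIdeal hF' hsf
  -- New lines: each lies on exactly two planes, so the local condition is membership in its prime.
  have hline : ∀ i : Fin n, (∃ s ∉ Ideal.span {L, ℓ i},
      s * f ∈ jacobianIdeal (∏ i, (Fin.cons L ℓ : Fin (n + 1) → CoordRing k) i)) ↔
      f ∈ Ideal.span {L, ℓ i} := by
    intro i
    have hi : (0 : Fin (n + 1)) ≠ i.succ := (Fin.succ_ne_zero i).symm
    constructor
    · rintro ⟨s, hs, hsf⟩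
      exact ((h'.isPrime_span hi).mem_or_mem (jacobianIdeal_le_span hi hsf)).resolve_left hs
    · intro hf
      obtain ⟨s, hs, hs'⟩ := h'.exists_mul_mem_jacobianIdeal hi (fun l => by
        refine Fin.cases (fun h0 => absurd rfl h0) (fun l _ hl => ?_) l
        exact h.notMem_span_of_notMem hL hLC fun e => hl (congrArg Fin.succ e.symm))
      exact ⟨s, hs, hs' f hf⟩
  constructor
  · intro hf
    refine ⟨fun i j hij => (hpair i j hij).1 (hf i.succ j.succ fun e => hij (Fin.succ_inj.1 e)),
      fun i _ => (hline i).1 (hf 0 i.succ (Fin.succ_ne_zero i).symm)⟩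
  · rintro ⟨hf₁, hf₂⟩ i j
    refine Fin.cases ?_ (fun i => ?_) i <;> refine Fin.cases ?_ (fun j => ?_) j
    · exact fun hne => absurd rfl hne
    · exact fun _ => (hline j).2 (hf₂ j (Finset.mem_univ j))
    · intro _
      have := (hline i).2 (hf₂ i (Finset.mem_univ i))
      rwa [Set.pair_comm] at this
    · exact fun hne => (hpair i j fun e => hne (congrArg Fin.succ e)).2
        (hf₁ i j fun e => hne (congrArg Fin.succ e))

theorem redCurveIdeal_mul : redCurveIdeal (L * ∏ i, ℓ i) =
    Ideal.span {L} * redCurveIdeal (∏ i, ℓ i) + Ideal.span {∏ i, ℓ i} := by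
  have h' := h.cons hL hL₀ hLℓ
  have hne : (Finset.univ : Finset (Fin n)).Nonempty := Finset.univ_nonempty_iff.2 ⟨⟨0, by omega⟩⟩
  ext f
  rw [mem_span_mul_add_span_iff (h.prod_mem_redCurveIdeal hn)
    (h.mem_redCurveIdeal_of_mul_mem hn hLC), h.mem_span_pair_prod_iff hL hLℓ hLC _ _ hne,
    h.mem_redCurveIdeal_iff hn, ← Fin.prod_cons, h'.mem_redCurveIdeal_iff n.succ_ne_zero]
  constructor
  · intro hf
    exact ⟨fun i j hij => hf i.succ j.succ fun e => hij (Fin.succ_inj.1 e),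
      fun i _ => hf 0 i.succ (Fin.succ_ne_zero i).symm⟩
  · rintro ⟨hf₁, hf₂⟩ i j
    refine Fin.cases ?_ (fun i => ?_) i <;> refine Fin.cases ?_ (fun j => ?_) j
    · exact fun hne => absurd rfl hne
    · exact fun _ => hf₂ j (Finset.mem_univ j)
    · intro _
      have := hf₂ i (Finset.mem_univ i)
      rwa [Set.pair_comm] at this
    · exact fun hne => hf₁ i j fun e => hne (congrArg Fin.succ e)

end

/-- The hypothesis on the components of `C_F^red` in terms of the lines of the arrangement. -/
theorem notMem_span_of_forall_minimalPrimes [CharZero k] (h : IsArrangement ℓ) (hn : n ≠ 0)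
    (hLC : ∀ p ∈ (redCurveIdeal (∏ i, ℓ i)).minimalPrimes, L ∉ p) (i j : Fin n) (hij : i ≠ j) :
    L ∉ Ideal.span {ℓ i, ℓ j} := by
  have := h.isPrime_span hij
  have hle : redCurveIdeal (∏ i, ℓ i) ≤ Ideal.span {ℓ i, ℓ j} := fun f hf =>
    (h.mem_redCurveIdeal_iff hn f).1 hf i j hij
  have hJ : jacobianIdeal (∏ i, ℓ i) ≤ redCurveIdeal (∏ i, ℓ i) := fun f hf =>
    (h.mem_redCurveIdeal_iff hn f).2 fun i j hij => jacobianIdeal_le_span hij hf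
  obtain ⟨p, hp, hple⟩ := Ideal.exists_minimalPrimes_le hle
  exact fun hmem => hLC p hp
    ((h.span_mem_minimalPrimes hn hij).2 ⟨hp.1.1, hJ.trans hp.1.2⟩ hple hmem)

end IsArrangement
end ArrCurve

/-! ### Transfer of the Cohen–Macaulay property -/

namespace ArrCurve
open MvPolynomial

/-- Uses the exact sequence `0 → R/(I : c) → R/I → R/(I + (c)) → 0`, whose first map is
multiplication by `c`. -/
theorem hasUniqueExtension_quotient_iff_of_colon {R : Type*} [CommRing R] {𝔞 I I₀ : Ideal R} {c : R}
    (hc : ∀ x, c * x ∈ I ↔ x ∈ I₀) (h : HasUniqueExtension 𝔞 (R ⧸ (I ⊔ Ideal.span {c}))) :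
    HasUniqueExtension 𝔞 (R ⧸ I₀) ↔ HasUniqueExtension 𝔞 (R ⧸ I) := by
  have hker : I₀ = LinearMap.ker ((Submodule.mkQ I) ∘ₗ LinearMap.mulLeft R c) := by
    ext x
    rw [LinearMap.mem_ker, LinearMap.comp_apply, Submodule.mkQ_apply,
      Submodule.Quotient.mk_eq_zero, LinearMap.mulLeft_apply, hc]
  refine hasUniqueExtension_iff_of_exact (f := I₀.liftQ ((Submodule.mkQ I) ∘ₗ
    LinearMap.mulLeft R c) hker.le) (g := Submodule.factor le_sup_left) ?_
    (Submodule.factor_surjective _) (fun y => ?_) h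
  · rw [← LinearMap.ker_eq_bot]
    exact Submodule.ker_liftQ_eq_bot' _ _ hker
  · obtain ⟨y, rfl⟩ := Submodule.Quotient.mk_surjective _ y
    change Submodule.Quotient.mk y = 0 ↔ _
    rw [Submodule.Quotient.mk_eq_zero, sup_comm, Ideal.mem_span_singleton_sup]
    constructor
    · rintro ⟨a, b, hb, rfl⟩
      refine ⟨Submodule.Quotient.mk a, ?_⟩
      change Submodule.Quotient.mk (c * a) = _
      rw [Submodule.Quotient.eq, ← neg_mem_iff]
      convert hb using 1
      ring
    · rintro ⟨a, ha⟩
      obtain ⟨a, rfl⟩ := Submodule.Quotient.mk_surjective _ a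
      change Submodule.Quotient.mk (c * a) = _ at ha
      rw [Submodule.Quotient.eq, ← neg_mem_iff] at ha
      exact ⟨a, _, ha, by ring⟩

/-- Passing from `I` to `L I + (F)` does not affect the unique extension property if `R/(L, F)`
has it. -/
theorem hasUniqueExtension_mul_add_iff {R : Type*} [CommRing R] {𝔞 I : Ideal R} {F L : R}
    (hF : F ∈ I) (hL : ∀ x, L * x ∈ I → x ∈ I)
    (h : HasUniqueExtension 𝔞 (R ⧸ Ideal.span {L, F})) :
    HasUniqueExtension 𝔞 (R ⧸ (Ideal.span {L} * I + Ideal.span {F})) ↔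
      HasUniqueExtension 𝔞 (R ⧸ I) := by
  refine (hasUniqueExtension_quotient_iff_of_colon (c := L) (fun x => ?_) ?_).symm
  · rw [mem_span_mul_add_span_iff hF hL]
    refine ⟨fun hx => hL x hx.1, fun hx => ⟨I.mul_mem_left L hx, ?_⟩⟩
    exact Ideal.mul_mem_right _ _ (Ideal.subset_span (Set.mem_insert _ _))
  · have e : (Ideal.span {L} * I + Ideal.span {F}) ⊔ Ideal.span {L} = Ideal.span {L, F} := by
      rw [Ideal.span_insert, Submodule.add_eq_sup, sup_right_comm,
        sup_eq_right.2 (Ideal.mul_le_left : Ideal.span {L} * I ≤ Ideal.span {L})]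
    rwa [e]

namespace IsArrangement
variable {k : Type*} [Field k] {n : ℕ} {ℓ : Fin n → CoordRing k} {L : CoordRing k}

/-- The quotient is filtered by copies of the rings `R/(L, ℓ i)`, each a polynomial ring in two
variables; peel off one factor at a time. -/
theorem hasUniqueExtension_quotient_span_prod (h : IsArrangement ℓ) (hL : L.IsHomogeneous 1)
    (hL₀ : L ≠ 0) (hLℓ : ∀ i, LinearIndependent k ![ℓ i, L]) {𝔪 : Ideal (CoordRing k)}
    (h𝔪 : 𝔪.IsMaximal) (s : Finset (Fin n)) (hs : s.Nonempty) :
    HasUniqueExtension 𝔪 (CoordRing k ⧸ Ideal.span {L, ∏ i ∈ s, ℓ i}) := by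
  have hline : ∀ i, HasUniqueExtension 𝔪 (CoordRing k ⧸ Ideal.span {L, ℓ i}) := fun i =>
    hasUniqueExtension_quotient_span_pair hL (h.isHomogeneous i)
      (LinearIndependent.pair_symm_iff.1 (hLℓ i)) h𝔪
  induction hs using Finset.Nonempty.cons_induction with
  | singleton i =>
    rw [Finset.prod_singleton]
    exact hline i
  | cons i s hi hs ih =>
    have hLp := linearForm_prime hL hL₀
    rw [Finset.prod_cons]
    refine (hasUniqueExtension_quotient_iff_of_colon (I₀ := Ideal.span {L, ℓ i})
      (c := ∏ j ∈ s, ℓ j) (fun x => ?_) ?_).1 (hline i)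
    · constructor
      · intro hx
        obtain ⟨a, b, hab⟩ := Ideal.mem_span_pair.1 hx
        have hdvd : L ∣ (∏ j ∈ s, ℓ j) * (x - b * ℓ i) := ⟨a, by linear_combination - hab⟩
        obtain ⟨c, hc⟩ := (hLp.dvd_or_dvd hdvd).resolve_left fun hd => by
          obtain ⟨j, -, hj⟩ := hLp.exists_mem_finset_dvd hd
          exact (linearIndependent_iff_not_dvd hL (h.isHomogeneous j) hL₀).1
            (LinearIndependent.pair_symm_iff.1 (hLℓ j)) hj
        exact Ideal.mem_span_pair.2 ⟨c, b, by linear_combination - hc⟩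
      · intro hx
        obtain ⟨a, b, rfl⟩ := Ideal.mem_span_pair.1 hx
        exact Ideal.mem_span_pair.2 ⟨a * ∏ j ∈ s, ℓ j, b, by ring⟩
    · have e : Ideal.span {L, ℓ i * ∏ j ∈ s, ℓ j} ⊔ Ideal.span {∏ j ∈ s, ℓ j} =
          Ideal.span {L, ∏ j ∈ s, ℓ j} := by
        rw [Ideal.span_insert, Ideal.span_insert, sup_assoc]
        congr 1
        exact sup_eq_right.2 (Ideal.span_singleton_le_span_singleton.2 (Dvd.intro_left _ rfl))
      rwa [e]

section
variable [CharZero k] (h : IsArrangement ℓ) (hn : n ≠ 0)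
include h hn

theorem isLineArrangementIdeal_topCurveIdeal :
    IsLineArrangementIdeal (topCurveIdeal (∏ i, ℓ i)) := by
  intro p hp hle
  have hJ : jacobianIdeal (∏ i, ℓ i) ≤ topCurveIdeal (∏ i, ℓ i) := fun f hf =>
    (h.mem_topCurveIdeal_iff hn f).2 fun i j hij =>
      ⟨1, (Ideal.ne_top_iff_one _).1 (h.isPrime_span hij).ne_top, by rwa [one_mul]⟩
  obtain ⟨i, j, hij, hle'⟩ := h.exists_span_le hn hp (hJ.trans hle)
  refine ⟨ℓ i, ℓ j, h.isHomogeneous i, h.isHomogeneous j, h.linearIndependent i j hij,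
    fun f hf => ?_, hle'⟩
  obtain ⟨s, hs, hsf⟩ := (h.mem_topCurveIdeal_iff hn f).1 hf i j hij
  exact ((h.isPrime_span hij).mem_or_mem (jacobianIdeal_le_span hij hsf)).resolve_left hs

theorem isLineArrangementIdeal_redCurveIdeal :
    IsLineArrangementIdeal (redCurveIdeal (∏ i, ℓ i)) := by
  intro p hp hle
  have hJ : jacobianIdeal (∏ i, ℓ i) ≤ redCurveIdeal (∏ i, ℓ i) := fun f hf =>
    (h.mem_redCurveIdeal_iff hn f).2 fun i j hij => jacobianIdeal_le_span hij hf
  obtain ⟨i, j, hij, hle'⟩ := h.exists_span_le hn hp (hJ.trans hle)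
  exact ⟨ℓ i, ℓ j, h.isHomogeneous i, h.isHomogeneous j, h.linearIndependent i j hij,
    fun f hf => (h.mem_redCurveIdeal_iff hn f).1 hf i j hij, hle'⟩

variable (hL : L.IsHomogeneous 1) (hL₀ : L ≠ 0) (hLℓ : ∀ i, LinearIndependent k ![ℓ i, L])
  (hLC : ∀ i j, i ≠ j → L ∉ Ideal.span {ℓ i, ℓ j})
include hL hL₀ hLℓ hLC

theorem isACM_topCurveIdeal_mul_iff :
    IsACM (topCurveIdeal (L * ∏ i, ℓ i)) ↔ IsACM (topCurveIdeal (∏ i, ℓ i)) := by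
  have hline := (h.cons hL hL₀ hLℓ).isLineArrangementIdeal_topCurveIdeal n.succ_ne_zero
  rw [Fin.prod_cons] at hline
  rw [hline.isACM_iff, (h.isLineArrangementIdeal_topCurveIdeal hn).isACM_iff]
  refine forall₂_congr fun 𝔪 h𝔪 => ?_
  rw [h.topCurveIdeal_mul hn hL hL₀ hLℓ hLC]
  exact hasUniqueExtension_mul_add_iff (h.prod_mem_topCurveIdeal hn)
    (h.mem_topCurveIdeal_of_mul_mem hn hLC)
    (h.hasUniqueExtension_quotient_span_prod hL hL₀ hLℓ h𝔪 _
      (Finset.univ_nonempty_iff.2 ⟨⟨0, by omega⟩⟩))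

theorem isACM_redCurveIdeal_mul_iff :
    IsACM (redCurveIdeal (L * ∏ i, ℓ i)) ↔ IsACM (redCurveIdeal (∏ i, ℓ i)) := by
  have hline := (h.cons hL hL₀ hLℓ).isLineArrangementIdeal_redCurveIdeal n.succ_ne_zero
  rw [Fin.prod_cons] at hline
  rw [hline.isACM_iff, (h.isLineArrangementIdeal_redCurveIdeal hn).isACM_iff]
  refine forall₂_congr fun 𝔪 h𝔪 => ?_
  rw [h.redCurveIdeal_mul hn hL hL₀ hLℓ hLC]
  exact hasUniqueExtension_mul_add_iff (h.prod_mem_redCurveIdeal hn)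
    (h.mem_redCurveIdeal_of_mul_mem hn hLC)
    (h.hasUniqueExtension_quotient_span_prod hL hL₀ hLℓ h𝔪 _
      (Finset.univ_nonempty_iff.2 ⟨⟨0, by omega⟩⟩))

end
end IsArrangement
end ArrCurve

namespace ArrCurve
open MvPolynomial
attribute [local instance] MvPolynomial.gradedAlgebra
-- Homogeneity of the curve ideals
section Homogeneity
variable {k : Type*} [Field k]

theorem decompose_eq_homogeneousComponent (f : CoordRing k) (n : ℕ) :
    (DirectSum.decompose (homogeneousSubmodule (Fin 4) k) f n : CoordRing k) =
      homogeneousComponent n f :=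
  decomposition.decompose'_apply f n

theorem homogeneousComponent_add_mul {e : ℕ} {g : CoordRing k} (hg : g.IsHomogeneous e) (d : ℕ)
    (f : CoordRing k) :
    homogeneousComponent (d + e) (f * g) = homogeneousComponent d f * g := by
  rw [← decompose_eq_homogeneousComponent, ← decompose_eq_homogeneousComponent]
  exact DirectSum.coe_decompose_mul_add_of_right_mem _ hg

theorem isHomogeneous_of_homogeneousComponent_mem {I : Ideal (CoordRing k)}
    (h : ∀ f ∈ I, ∀ n, homogeneousComponent n f ∈ I) :
    I.IsHomogeneous (homogeneousSubmodule (Fin 4) k) := by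
  intro n f hf
  rw [decompose_eq_homogeneousComponent]
  exact h f hf n

theorem isHomogeneous_colon {J I : Ideal (CoordRing k)}
    (hJ : J.IsHomogeneous (homogeneousSubmodule (Fin 4) k))
    (hI : I.IsHomogeneous (homogeneousSubmodule (Fin 4) k)) :
    (J.colon (I : Set (CoordRing k))).IsHomogeneous (homogeneousSubmodule (Fin 4) k) := by
  refine isHomogeneous_of_homogeneousComponent_mem fun f hf n => ?_
  rw [Submodule.mem_colon] at hf ⊢
  intro g hg
  rw [smul_eq_mul, ← sum_homogeneousComponent g, Finset.mul_sum]
  refine Ideal.sum_mem _ fun d _ => ?_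
  rw [← homogeneousComponent_add_mul (homogeneousComponent_isHomogeneous d g)]
  exact homogeneousComponent_mem_of_mem hJ (hf _ (homogeneousComponent_mem_of_mem hI hg d)) _

theorem isHomogeneous_span_singleton {f : CoordRing k} {n : ℕ} (hf : f.IsHomogeneous n) :
    (Ideal.span {f}).IsHomogeneous (homogeneousSubmodule (Fin 4) k) :=
  Ideal.homogeneous_span _ _ fun x hx => ⟨n, by rwa [Set.mem_singleton_iff.1 hx]⟩

theorem isHomogeneous_span_pair {f g : CoordRing k} {m n : ℕ} (hf : f.IsHomogeneous m)
    (hg : g.IsHomogeneous n) :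
    (Ideal.span {f, g}).IsHomogeneous (homogeneousSubmodule (Fin 4) k) := by
  refine Ideal.homogeneous_span _ _ fun x hx => ?_
  rcases hx with rfl | rfl
  · exact ⟨m, hf⟩
  · exact ⟨n, hg⟩

theorem isHomogeneous_jacobianIdeal {F : CoordRing k} {n : ℕ} (hF : F.IsHomogeneous n) :
    (jacobianIdeal F).IsHomogeneous (homogeneousSubmodule (Fin 4) k) := by
  refine Ideal.homogeneous_span _ _ fun x hx => ?_
  obtain ⟨i, rfl⟩ := hx
  exact ⟨n - 1, hF.pderiv⟩

/-- The substitution `x ↦ t x`. -/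
noncomputable def scale (t : k) : CoordRing k →ₐ[k] CoordRing k := aeval fun i => C t * X i

theorem scale_apply_of_isHomogeneous (t : k) {f : CoordRing k} {n : ℕ} (hf : f.IsHomogeneous n) :
    scale t f = C (t ^ n) * f := by
  conv_rhs => rw [f.as_sum]
  conv_lhs => rw [f.as_sum]
  rw [map_sum, Finset.mul_sum]
  refine Finset.sum_congr rfl fun d hd => ?_
  have hdeg : n = d.sum fun _ e => e := by
    rw [hf.degree_eq_sum_deg_support hd]
    rfl
  rw [scale, aeval_monomial, monomial_eq, hdeg, Finsupp.prod, Finsupp.sum,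
    ← Finset.prod_pow_eq_pow_sum, Finsupp.prod, map_prod]
  simp only [mul_pow, Finset.prod_mul_distrib, MvPolynomial.algebraMap_eq, C_pow]
  ring

theorem scale_eq_sum (t : k) (f : CoordRing k) :
    scale t f = ∑ n ∈ Finset.range (f.totalDegree + 1), C (t ^ n) * homogeneousComponent n f := by
  conv_lhs => rw [← sum_homogeneousComponent f, map_sum]
  exact Finset.sum_congr rfl fun n _ =>
    scale_apply_of_isHomogeneous t (homogeneousComponent_isHomogeneous n f)

theorem scale_mem {I : Ideal (CoordRing k)} (hI : I.IsHomogeneous (homogeneousSubmodule (Fin 4) k))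
    (t : k) {f : CoordRing k} (hf : f ∈ I) : scale t f ∈ I := by
  rw [scale_eq_sum]
  exact Ideal.sum_mem _ fun n _ => I.mul_mem_left _ (homogeneousComponent_mem_of_mem hI hf n)

theorem scale_scale_inv {t : k} (ht : t ≠ 0) (f : CoordRing k) : scale t⁻¹ (scale t f) = f := by
  have : (scale t⁻¹).comp (scale t) = AlgHom.id k (CoordRing k) := by
    refine algHom_ext fun i => ?_
    simp only [scale, AlgHom.comp_apply, aeval_X, map_mul, AlgHom.id_apply, algHom_C,
      MvPolynomial.algebraMap_eq]
    rw [← mul_assoc, ← C_mul, mul_inv_cancel₀ ht, C_1, one_mul]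
  exact congrArg (fun φ => φ f) this

/-- Over an infinite field, an ideal stable under scaling of the coordinates is homogeneous. -/
theorem isHomogeneous_of_scale_mem [Infinite k] {I : Ideal (CoordRing k)}
    (h : ∀ t : k, t ≠ 0 → ∀ f ∈ I, scale t f ∈ I) :
    I.IsHomogeneous (homogeneousSubmodule (Fin 4) k) := by
  refine isHomogeneous_of_homogeneousComponent_mem fun f hf n => ?_
  by_cases hn : n < f.totalDegree + 1
  swap
  · rw [homogeneousComponent_eq_zero _ _ (by omega)]
    exact I.zero_mem
  rw [← Ideal.Quotient.eq_zero_iff_mem, ← Module.forall_dual_apply_eq_zero_iff k]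
  intro φ
  set p : Polynomial k := ∑ d ∈ Finset.range (f.totalDegree + 1),
    Polynomial.monomial d (φ (Ideal.Quotient.mk I (homogeneousComponent d f))) with hp
  have hp0 : p = 0 := by
    -- For a linear form `φ` on `R/I`, the polynomial `p(t) = φ(scale t f)` vanishes for all `t ≠
    -- 0`, so each of its coefficients `φ(f_d)` is zero.
    refine Polynomial.eq_zero_of_infinite_isRoot p (Set.Infinite.mono ?_
      (Set.finite_singleton (0 : k)).infinite_compl)
    intro t ht
    have h0 : Ideal.Quotient.mk I (scale t f) = 0 := Ideal.Quotient.eq_zero_iff_mem.2 (h t ht f hf)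
    have h1 := congrArg φ h0
    rw [scale_eq_sum, map_sum, map_sum, map_zero] at h1
    change Polynomial.eval t p = 0
    rw [hp, Polynomial.eval_finsetSum, ← h1]
    refine Finset.sum_congr rfl fun d _ => ?_
    rw [Polynomial.eval_monomial, ← smul_eq_C_mul]
    change _ = φ ((t ^ d) • Ideal.Quotient.mk I (homogeneousComponent d f))
    rw [map_smul, smul_eq_mul, mul_comm]
  have := congrArg (fun q => Polynomial.coeff q n) hp0
  simp only [hp, Polynomial.finsetSum_coeff, Polynomial.coeff_monomial, Polynomial.coeff_zero] at this
  rwa [Finset.sum_ite_eq', if_pos (Finset.mem_range.2 hn)] at this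

namespace IsArrangement
variable {n : ℕ} {ℓ : Fin n → CoordRing k} [CharZero k]

/-- The denominators `s` need not be homogeneous, so components cannot be taken directly; scaling is
an automorphism preserving the Jacobian ideal and all the primes, and it simply moves `s`. -/
theorem isHomogeneous_topCurveIdeal (h : IsArrangement ℓ) (hn : n ≠ 0) :
    (topCurveIdeal (∏ i, ℓ i)).IsHomogeneous (homogeneousSubmodule (Fin 4) k) := by
  refine isHomogeneous_of_scale_mem fun t ht f hf => ?_
  rw [h.mem_topCurveIdeal_iff hn] at hf ⊢
  intro i j hij
  obtain ⟨s, hs, hsf⟩ := hf i j hij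
  refine ⟨scale t s, fun hmem => hs ?_, ?_⟩
  · rw [← scale_scale_inv ht s]
    exact scale_mem (isHomogeneous_span_pair (h.isHomogeneous i) (h.isHomogeneous j)) _ hmem
  · rw [← map_mul]
    exact scale_mem (isHomogeneous_jacobianIdeal h.isHomogeneous_prod) t hsf

theorem isHomogeneous_redCurveIdeal (h : IsArrangement ℓ) (hn : n ≠ 0) :
    (redCurveIdeal (∏ i, ℓ i)).IsHomogeneous (homogeneousSubmodule (Fin 4) k) := by
  refine isHomogeneous_of_homogeneousComponent_mem fun f hf d => ?_
  rw [h.mem_redCurveIdeal_iff hn] at hf ⊢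
  exact fun i j hij => homogeneousComponent_mem_of_mem
    (isHomogeneous_span_pair (h.isHomogeneous i) (h.isHomogeneous j)) (hf i j hij) d

end IsArrangement
end Homogeneity

/-! ### Basic double linkage -/

section Liaison

theorem isRegular_pair {R : Type*} [CommRing R] [IsDomain R] {F G : R} (hF : F ≠ 0)
    (hG : ∀ x, F ∣ G * x → F ∣ x) (htop : Ideal.span {F, G} ≠ ⊤) :
    RingTheory.Sequence.IsRegular R [F, G] := by
  refine ⟨isWeaklyRegular_pair_iff.2 ⟨fun u hu => ?_, fun v w hvw => ?_⟩, fun h => htop ?_⟩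
  · exact (mul_eq_zero.1 hu).resolve_left hF
  · exact hG v ⟨w, hvw⟩
  · rw [smul_eq_mul, Ideal.mul_top, Ideal.ofList_cons, Ideal.ofList_singleton] at h
    rw [Ideal.span_insert, h]

/-- Basic double linkage: if `(F, G)` links `I` to its residual `(F, G) : I`, then `(F, L G)` links
the latter to `L I + (F)`. -/
theorem isEvenlyLinked_mul_add {k : Type*} [Field k] {I : Ideal (CoordRing k)}
    (hI : I.IsHomogeneous (homogeneousSubmodule (Fin 4) k)) {F G L : CoordRing k} {a b c : ℕ}
    (hF : F.IsHomogeneous a) (hG : G.IsHomogeneous b) (hL : L.IsHomogeneous c) (hF₀ : F ≠ 0)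
    (hFG : ∀ x, F ∣ G * x → F ∣ x) (hFL : ∀ x, F ∣ L * x → F ∣ x) (htop : Ideal.span {F, G} ≠ ⊤)
    (hle : Ideal.span {F, G} ≤ I)
    (hdual : (Ideal.span {F, G}).colon ((Ideal.span {F, G}).colon (I : Set (CoordRing k)) :
      Set (CoordRing k)) = I) :
    IsEvenlyLinked I (Ideal.span {L} * I + Ideal.span {F}) := by
  set K : Ideal (CoordRing k) := (Ideal.span {F, G}).colon (I : Set (CoordRing k)) with hK
  have hKhom : K.IsHomogeneous (homogeneousSubmodule (Fin 4) k) :=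
    isHomogeneous_colon (isHomogeneous_span_pair hF hG) hI
  have hleK : Ideal.span {F, G} ≤ K := Ideal.le_colon
  have hmemK : ∀ x, x ∈ K ↔ ∀ i ∈ I, x * i ∈ Ideal.span {F, G} := fun x => Submodule.mem_colon
  have hmemI : ∀ x, x ∈ I ↔ ∀ i ∈ K, x * i ∈ Ideal.span {F, G} := fun x => by
    conv_lhs => rw [← hdual]
    exact Submodule.mem_colon
  have hFmem : F ∈ Ideal.span {F, G} := Ideal.subset_span (by simp)
  have hGmem : G ∈ Ideal.span {F, G} := Ideal.subset_span (by simp)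
  have hle' : Ideal.span {F, L * G} ≤ Ideal.span {F, G} := by
    rw [Ideal.span_le]
    rintro x (rfl | rfl)
    · exact hFmem
    · exact Ideal.mul_mem_left _ _ hGmem
  have hF' : F ∈ Ideal.span {F, L * G} := Ideal.subset_span (by simp)
  have hLmem : ∀ x ∈ Ideal.span {F, G}, L * x ∈ Ideal.span {F, L * G} := by
    intro x hx
    obtain ⟨p, q, rfl⟩ := Ideal.mem_span_pair.1 hx
    exact Ideal.mem_span_pair.2 ⟨L * p, q, by ring⟩
  have hLmem' : ∀ x, L * x ∈ Ideal.span {F, L * G} → x ∈ Ideal.span {F, G} := by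
    intro x hx
    obtain ⟨p, q, hpq⟩ := Ideal.mem_span_pair.1 hx
    obtain ⟨r, hr⟩ := hFL (x - q * G) ⟨p, by linear_combination - hpq⟩
    exact Ideal.mem_span_pair.2 ⟨r, q, by linear_combination - hr⟩
  have hLI : ∀ x ∈ I, L * x ∈ Ideal.span {L} * I + Ideal.span {F} := fun x hx =>
    Ideal.mem_sup_left (Ideal.mul_mem_mul (Ideal.mem_span_singleton_self L) hx)
  have hFI' : F ∈ Ideal.span {L} * I + Ideal.span {F} :=
    Ideal.mem_sup_right (Ideal.mem_span_singleton_self F)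
  refine Relation.ReflTransGen.single ⟨K, ⟨hI, hKhom, F, G, a, b, hF, hG,
    isRegular_pair hF₀ hFG htop, le_inf hle hleK, rfl, hdual⟩, ⟨hKhom, ?_, F, L * G, a, c + b, hF,
    hL.mul hG, isRegular_pair hF₀ (fun x hx => hFG x (hFL _ ?_)) (fun h => htop ?_), ?_, ?_, ?_⟩⟩
  · exact ((isHomogeneous_span_singleton hL).mul hI).sup (isHomogeneous_span_singleton hF)
  · rwa [← mul_assoc]
  · exact top_le_iff.1 (h ▸ hle')
  · refine le_inf (hle'.trans hleK) ?_
    rw [Ideal.span_le]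
    rintro x (rfl | rfl)
    · exact hFI'
    · exact hLI G (hle hGmem)
  · ext x
    rw [Submodule.mem_colon]
    constructor
    · intro hx
      -- Testing `x` on `G ∈ K` gives `x = L q + r F`. Testing on all of `K` and cancelling `L` then
      -- gives `q K ⊆ (F, G)`, that is, `q ∈ I`.
      obtain ⟨p, q, hpq⟩ := Ideal.mem_span_pair.1 (hx G (hleK hGmem))
      obtain ⟨r, hr⟩ := hFG (x - q * L) ⟨p, by
        simp only [smul_eq_mul] at hpq
        linear_combination - hpq⟩
      have hq : q ∈ I := (hmemI q).2 fun y hy => hLmem' _ (by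
        have h1 := hx y hy
        rw [smul_eq_mul] at h1
        have h2 := Ideal.sub_mem _ h1 (Ideal.mul_mem_right (r * y) _ hF')
        convert h2 using 1
        linear_combination - y * hr)
      have e : x = L * q + r * F := by linear_combination hr
      rw [e]
      exact Ideal.add_mem _ (hLI q hq) (Ideal.mul_mem_left _ _ hFI')
    · intro hx y hy
      have hle'' : Ideal.span {L} * I + Ideal.span {F} ≤
          (Ideal.span {F, L * G}).colon {y} := by
        refine sup_le (Ideal.mul_le.2 fun l hl i hi => ?_)
          ((Ideal.span_singleton_le_iff_mem _).2 ?_)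
        · obtain ⟨l, rfl⟩ := Ideal.mem_span_singleton.1 hl
          rw [Submodule.mem_colon_singleton, smul_eq_mul]
          have := Ideal.mul_mem_left _ l (hLmem _ ((hmemI i).1 hi y hy))
          convert this using 1
          ring
        · rw [Submodule.mem_colon_singleton]
          exact Ideal.mul_mem_right _ _ hF'
      exact Submodule.mem_colon_singleton.1 (hle'' hx)
  · ext x
    rw [Submodule.mem_colon, hmemK]
    constructor
    · intro hx i hi
      refine hLmem' _ ?_
      have := hx _ (hLI i hi)
      rwa [smul_eq_mul, mul_left_comm] at this
    · intro hx y hy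
      have hle'' : Ideal.span {L} * I + Ideal.span {F} ≤
          (Ideal.span {F, L * G}).colon {x} := by
        refine sup_le (Ideal.mul_le.2 fun l hl i hi => ?_)
          ((Ideal.span_singleton_le_iff_mem _).2 ?_)
        · obtain ⟨l, rfl⟩ := Ideal.mem_span_singleton.1 hl
          rw [Submodule.mem_colon_singleton, smul_eq_mul]
          have := Ideal.mul_mem_left _ l (hLmem _ (hx i hi))
          convert this using 1
          ring
        · rw [Submodule.mem_colon_singleton]
          exact Ideal.mul_mem_right _ _ hF'
      have := Submodule.mem_colon_singleton.1 (hle'' hy)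
      rwa [smul_eq_mul, mul_comm y] at this

end Liaison
end ArrCurve

/-! ### Residuals in the complete intersection of `F` and a general polar -/

namespace ArrCurve
open MvPolynomial

/-- A form of denominators which works for all elements of a finitely generated ideal. -/
theorem exists_notMem_forall_mul_mem {R : Type*} [CommRing R] {I J P : Ideal R} (hI : I.FG)
    (hP : P.IsPrime) (h : ∀ f ∈ I, ∃ s ∉ P, s * f ∈ J) : ∃ s ∉ P, ∀ f ∈ I, s * f ∈ J := by
  obtain ⟨S, hS⟩ := hI
  have hSI : ∀ f ∈ S, f ∈ I := fun f hf => hS ▸ Ideal.subset_span hf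
  choose! t ht ht' using h
  refine ⟨∏ f ∈ S, t f, fun hmem => ?_, fun f hf => ?_⟩
  · obtain ⟨f, hf, hf'⟩ := hP.prod_mem_iff.1 hmem
    exact ht f (hSI f hf) hf'
  · have hle : I ≤ J.colon {∏ f ∈ S, t f} := by
      rw [← hS, Ideal.span_le]
      intro f hf
      obtain ⟨r, hr⟩ := Finset.dvd_prod_of_mem t hf
      rw [SetLike.mem_coe, Submodule.mem_colon_singleton, smul_eq_mul, hr]
      convert J.mul_mem_left r (ht' f (hSI f hf)) using 1
      ring
    have := Submodule.mem_colon_singleton.1 (hle hf)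
    rwa [smul_eq_mul, mul_comm] at this

theorem derivation_prod_of_eigen {k A ι : Type*} [CommRing k] [CommRing A] [Algebra k A]
    (D : Derivation k A A) (c : A) (s : Finset ι) (f : ι → A) (h : ∀ i ∈ s, D (f i) = c * f i) :
    D (∏ i ∈ s, f i) = s.card * c * ∏ i ∈ s, f i := by
  classical
  induction s using Finset.induction_on with
  | empty => simp
  | insert i s hi ih =>
    rw [Finset.prod_insert hi, Derivation.leibniz, ih fun j hj => h j (Finset.mem_insert_of_mem hj),
      h i (Finset.mem_insert_self i s), Finset.card_insert_of_notMem hi]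
    simp only [smul_eq_mul]
    push_cast
    ring

attribute [local instance] MvPolynomial.gradedAlgebra

namespace IsArrangement
variable {k : Type*} [Field k] {n : ℕ} {ℓ : Fin n → CoordRing k}

theorem prod_ne_zero (h : IsArrangement ℓ) : ∏ i, ℓ i ≠ 0 :=
  Finset.prod_ne_zero_iff.2 fun i _ => h.ne_zero i

theorem isRelPrime_prod (h : IsArrangement ℓ) {G : CoordRing k} (s : Finset (Fin n))
    (hG : ∀ i ∈ s, ¬ ℓ i ∣ G) : IsRelPrime (∏ i ∈ s, ℓ i) G :=
  IsRelPrime.prod_left fun i hi => (h.prime i).irreducible.isRelPrime_iff_not_dvd.2 (hG i hi)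

theorem exists_eval_ne_zero [Infinite k] (h : IsArrangement ℓ) :
    ∃ v : Fin 4 → k, ∀ i, eval v (ℓ i) ≠ 0 := by
  have : ∃ v : Fin 4 → k, eval v (∏ i, ℓ i) ≠ 0 := by
    by_contra! hcon
    exact h.prod_ne_zero (MvPolynomial.funext fun v => by rw [hcon v, map_zero])
  obtain ⟨v, hv⟩ := this
  rw [map_prod] at hv
  exact ⟨v, fun i => Finset.prod_ne_zero_iff.1 hv i (Finset.mem_univ i)⟩

theorem not_dvd_prod_erase (h : IsArrangement ℓ) (i : Fin n) (s : Finset (Fin n)) (hs : i ∉ s) :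
    ¬ ℓ i ∣ ∏ j ∈ s, ℓ j := fun hdvd => by
  obtain ⟨j, hj, hd⟩ := (h.prime i).exists_mem_finset_dvd hdvd
  have hij : i ≠ j := by
    rintro rfl
    exact hs hj
  exact h.not_dvd hij hd

variable {v : Fin 4 → k}

theorem dirDeriv_prod (h : IsArrangement ℓ) (i : Fin n) : dirDeriv v (∏ j, ℓ j) =
    C (eval v (ℓ i)) * (∏ j ∈ Finset.univ.erase i, ℓ j) +
      ℓ i * dirDeriv v (∏ j ∈ Finset.univ.erase i, ℓ j) := by
  rw [← Finset.mul_prod_erase Finset.univ ℓ (Finset.mem_univ i), Derivation.leibniz,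
    dirDeriv_linearForm v (h.isHomogeneous i), smul_eq_mul, smul_eq_mul]
  ring

/-- Modulo `ℓ i` the polar is a nonzero constant times the product of the other forms. Hence `F` and
its polar have no common factor. -/
theorem not_dvd_dirDeriv_prod (h : IsArrangement ℓ) (hv : ∀ i, eval v (ℓ i) ≠ 0) (i : Fin n) :
    ¬ ℓ i ∣ dirDeriv v (∏ j, ℓ j) := by
  rw [h.dirDeriv_prod i, dvd_add_left (dvd_mul_right _ _)]
  intro hd
  rcases (h.prime i).dvd_or_dvd hd with hd | hd
  · exact (h.prime i).not_isUnit (isUnit_of_dvd_unit hd ((isUnit_iff_ne_zero.2 (hv i)).map C))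
  · exact h.not_dvd_prod_erase i _ (Finset.notMem_erase i _) hd

theorem isHomogeneous_dirDeriv_prod (h : IsArrangement ℓ) :
    (dirDeriv v (∏ j, ℓ j)).IsHomogeneous (n - 1) := by
  rw [dirDeriv_apply]
  refine IsHomogeneous.sum _ _ _ fun i _ => ?_
  simpa using (isHomogeneous_C (Fin 4) (v i)).mul (h.isHomogeneous_prod.pderiv (i := i))

/-- The residual of the reduced curve in the complete intersection of `F` and a general polar of
`F` determines it locally at each of its lines. -/
theorem exists_residual_red (h : IsArrangement ℓ) (hv : ∀ i, eval v (ℓ i) ≠ 0) {i j : Fin n}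
    (hij : i ≠ j) : ∃ Δ : CoordRing k,
      (∀ f ∈ Ideal.span {ℓ i, ℓ j}, Δ * f ∈ Ideal.span {∏ i, ℓ i, dirDeriv v (∏ i, ℓ i)}) ∧
      ∀ f, f * Δ ∈ Ideal.span {∏ i, ℓ i, dirDeriv v (∏ i, ℓ i)} → f ∈ Ideal.span {ℓ i, ℓ j} := by
  have hF := Finset.mul_prod_erase Finset.univ ℓ (Finset.mem_univ i)
  have hH := Finset.mul_prod_erase _ ℓ (Finset.mem_erase.2 ⟨hij.symm, Finset.mem_univ j⟩)
  have hG := h.dirDeriv_prod (v := v) i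
  have hrel : IsRelPrime (∏ l ∈ Finset.univ.erase i, ℓ l) (dirDeriv v (∏ l, ℓ l)) :=
    h.isRelPrime_prod _ fun l _ => h.not_dvd_dirDeriv_prod hv l
  have hnd : ¬ ℓ i ∣ ∏ l ∈ (Finset.univ.erase i).erase j, ℓ l :=
    h.not_dvd_prod_erase i _ (by simp)
  have hH₀ : ∏ l ∈ Finset.univ.erase i, ℓ l ≠ 0 :=
    Finset.prod_ne_zero_iff.2 fun l _ => h.ne_zero l
  set α := eval v (ℓ i)
  have hα : (C α⁻¹ * C α : CoordRing k) = 1 := by rw [← C_mul, inv_mul_cancel₀ (hv i), C_1]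
  set F := ∏ l, ℓ l
  set G := dirDeriv v F
  set H := ∏ l ∈ Finset.univ.erase i, ℓ l
  set H' := ∏ l ∈ (Finset.univ.erase i).erase j, ℓ l
  -- Here `H = F/ℓ i` and `H' = H/ℓ j`. Then `Δ ℓ i = H' F`, while `Δ ℓ j = H²` lies in `(F, G)`
  -- because `H G = α H² + F ∂H`, where `∂` is the derivative along `v`.
  refine ⟨H * H', fun f hf => ?_, fun f hf => ?_⟩
  · obtain ⟨p, q, rfl⟩ := Ideal.mem_span_pair.1 hf
    refine Ideal.mem_span_pair.2 ⟨p * H' - q * C α⁻¹ * dirDeriv v H, q * C α⁻¹ * H, ?_⟩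
    rw [hG, ← hF]
    linear_combination q * H * H * hα - q * H * hH
  · obtain ⟨p, q, hpq⟩ := Ideal.mem_span_pair.1 hf
    -- `H` divides `q G` and is coprime to `G`. After cancelling `H`, reduction modulo `ℓ i` leaves
    -- `H' (f - e α ℓ j)`, and `H'` is prime to `ℓ i`.
    obtain ⟨e, rfl⟩ : H ∣ q := hrel.dvd_of_dvd_mul_left (z := q) ⟨f * H' - p * ℓ i, by
      linear_combination hpq + p * hF⟩
    have h1 : f * H' - p * ℓ i = e * G := mul_left_cancel₀ hH₀ (by
      linear_combination - hpq - p * hF)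
    have h2 : ℓ i ∣ H' * (f - e * C α * ℓ j) := ⟨p + e * dirDeriv v H, by
      linear_combination h1 + e * hG - e * C α * hH⟩
    obtain ⟨c, hc⟩ := ((h.prime i).dvd_or_dvd h2).resolve_left hnd
    exact Ideal.mem_span_pair.2 ⟨c, e * C α, by linear_combination - hc⟩

/-- The residual of the top-dimensional Jacobian scheme in the complete intersection of `F` and a
general polar of `F` determines it locally at each of its lines. -/
theorem exists_residual_top [CharZero k] (h : IsArrangement ℓ) (hv : ∀ i, eval v (ℓ i) ≠ 0)
    {i j : Fin n} (hij : i ≠ j) : ∃ Δ : CoordRing k,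
      (∀ f ∈ topCurveIdeal (∏ i, ℓ i),
        Δ * f ∈ Ideal.span {∏ i, ℓ i, dirDeriv v (∏ i, ℓ i)}) ∧
      ∀ f, f * Δ ∈ Ideal.span {∏ i, ℓ i, dirDeriv v (∏ i, ℓ i)} →
        ∃ s ∉ Ideal.span {ℓ i, ℓ j}, s * f ∈ jacobianIdeal (∏ i, ℓ i) := by
  classical
  have hn : n ≠ 0 := fun h0 => (h0 ▸ i : Fin 0).elim0
  have hprime := h.isPrime_span hij
  obtain ⟨s, hs, hs'⟩ := exists_notMem_forall_mul_mem
    (IsNoetherian.noetherian (topCurveIdeal (∏ i, ℓ i))) hprime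
    fun f hf => (h.mem_topCurveIdeal_iff hn f).1 hf i j hij
  have hiP : ℓ i ∈ Ideal.span {ℓ i, ℓ j} := Ideal.subset_span (by simp)
  have hjP : ℓ j ∈ Ideal.span {ℓ i, ℓ j} := Ideal.subset_span (by simp)
  set P := Ideal.span {ℓ i, ℓ j} with hPdef
  set α := eval v (ℓ i) with hα
  set β := eval v (ℓ j) with hβ
  have hα₀ : α ≠ 0 := hv i
  have hα' : (C α⁻¹ * C α : CoordRing k) = 1 := by rw [← C_mul, inv_mul_cancel₀ hα₀, C_1]
  have hCα : (C α : CoordRing k) ≠ 0 := by rwa [Ne, C_eq_zero]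
  -- `b` is a linear form of `P` vanishing at `v`. Locally at `P` one has `(F, G) = (b ∂F, G)` and
  -- `J_F = (∂F, G)` for a suitable partial derivative `∂`, so `b` generates the residual modulo
  -- `(F, G)`.
  set b : CoordRing k := C β * ℓ i - C α * ℓ j with hb
  have hbhom : b.IsHomogeneous 1 :=
    ((h.isHomogeneous i).C_mul β).sub ((h.isHomogeneous j).C_mul α)
  have hbP : b ∈ P := Ideal.sub_mem _ (Ideal.mul_mem_left _ _ hiP) (Ideal.mul_mem_left _ _ hjP)
  have hvb : eval v b = 0 := by
    simp only [hb, map_sub, map_mul, eval_C, ← hα, ← hβ]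
    ring
  have hb₀ : b ≠ 0 := fun h0 => h.not_dvd hij ⟨C α⁻¹ * C β, by
    rw [hb] at h0
    linear_combination - (C α⁻¹) * h0 - ℓ j * hα'⟩
  have hbprime := linearForm_prime hbhom hb₀
  have hbℓ : ∀ l, ¬ b ∣ ℓ l := fun l hd => by
    obtain ⟨c, hc⟩ := hd
    have := congrArg (eval v) hc
    rw [map_mul, hvb, zero_mul] at this
    exact hv l this
  set S := Finset.univ.filter fun l => ℓ l ∈ P with hS
  set H := ∏ l ∈ Finset.univ.filter (fun l => ¬ ℓ l ∈ P), ℓ l with hH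
  set GP := ∏ l ∈ S, ℓ l with hGP
  have hFH : GP * H = ∏ l, ℓ l := Finset.prod_filter_mul_prod_filter_not _ _ _
  have hHP : H ∉ P := fun hmem => by
    obtain ⟨l, hl, hl'⟩ := hprime.prod_mem_iff.1 hmem
    exact (Finset.mem_filter.1 hl).2 hl'
  have hbF : ¬ b ∣ ∏ l, ℓ l := fun hd => by
    obtain ⟨l, -, hl⟩ := hbprime.exists_mem_finset_dvd hd
    exact hbℓ l hl
  set F := ∏ l, ℓ l with hF
  set G := dirDeriv v F with hG
  -- the coefficients of `ℓ i` and `b`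
  set ε : Fin 4 → k := fun e => coeff (Finsupp.single e 1) (ℓ i) with hε
  set η : Fin 4 → k := fun e => coeff (Finsupp.single e 1) b with hη
  set κ : Fin 4 → CoordRing k := fun e => C (ε e) * b - C (η e) * ℓ i with hκ
  -- The correction `κ e` makes every linear form in `P` an eigenvector of `D e` with the same
  -- eigenvalue `α η e`: a local Euler derivation for the planes through the line.
  set D : Fin 4 → Derivation k (CoordRing k) (CoordRing k) := fun e =>
    (C α * b) • pderiv e - κ e • dirDeriv v with hD
  have hDapp : ∀ e f, D e f = C α * b * pderiv e f - κ e * dirDeriv v f := fun e f => rfl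
  have hκP : ∀ e, κ e ∈ P := fun e =>
    Ideal.sub_mem _ (Ideal.mul_mem_left _ _ hbP) (Ideal.mul_mem_left _ _ hiP)
  have hDi : ∀ e, D e (ℓ i) = C (α * η e) * ℓ i := fun e => by
    rw [hDapp, pderiv_linearForm e (h.isHomogeneous i), dirDeriv_linearForm v (h.isHomogeneous i),
      ← hα, C_mul]
    simp only [hκ, hε]
    ring
  have hDb : ∀ e, D e b = C (α * η e) * b := fun e => by
    rw [hDapp, pderiv_linearForm e hbhom, dirDeriv_linearForm v hbhom, hvb, C_0, C_mul]
    simp only [hη]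
    ring
  have hDj : ∀ e, D e (ℓ j) = C (α * η e) * ℓ j := fun e => by
    have h1 := hDb e
    rw [hb, map_sub, ← smul_eq_C_mul, ← smul_eq_C_mul, Derivation.map_smul, Derivation.map_smul,
      hDi, smul_eq_C_mul, smul_eq_C_mul, smul_eq_C_mul, smul_eq_C_mul] at h1
    exact mul_left_cancel₀ hCα (by linear_combination - h1)
  have hDS : ∀ e, ∀ l ∈ S, D e (ℓ l) = C (α * η e) * ℓ l := fun e l hl => by
    obtain ⟨c, d, hcd⟩ := linearForm_mem_span_pair (h.isHomogeneous i) (h.isHomogeneous j)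
      (h.isHomogeneous l) (Finset.mem_filter.1 hl).2
    rw [hcd, map_add, ← smul_eq_C_mul, ← smul_eq_C_mul, Derivation.map_smul, Derivation.map_smul,
      hDi, hDj, smul_eq_C_mul, smul_eq_C_mul, smul_eq_C_mul, smul_eq_C_mul]
    ring
  -- Since `F = GP H`, one has `D e F = U e GP`. Modulo `P`, `U e` is `|S| α η e H`, invertible at
  -- `P` when `η e ≠ 0` in characteristic zero.
  set U : Fin 4 → CoordRing k := fun e =>
    (S.card : CoordRing k) * C (α * η e) * H + D e H with hU
  have hUF : ∀ e, U e * F = H * (C α * b * pderiv e F - κ e * G) := fun e => by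
    rw [hG, ← hDapp, ← hFH, Derivation.leibniz, hGP, derivation_prod_of_eigen (D e) _ S ℓ (hDS e),
      ← hGP, smul_eq_mul, smul_eq_mul]
    simp only [hU]
    ring
  have hFc : F ∈ Ideal.span {F, G} := Ideal.subset_span (by simp)
  have hGc : G ∈ Ideal.span {F, G} := Ideal.subset_span (by simp)
  refine ⟨H * b * s, fun f hf => ?_, fun f hf => ?_⟩
  -- The identity for `U e F` reads `α H b ∂F = U e F + H κ G`, so `H b` carries the Jacobian ideal
  -- into `(F, G)`; the factor `s` handles the passage from the curve ideal to `J_F`.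
  · have hle : jacobianIdeal F ≤ (Ideal.span {F, G}).colon {H * b} := by
      rw [jacobianIdeal_le_iff]
      intro e
      rw [Submodule.mem_colon_singleton, smul_eq_mul]
      exact Ideal.mem_span_pair.2 ⟨C α⁻¹ * U e, C α⁻¹ * H * κ e, by
        linear_combination C α⁻¹ * hUF e + H * b * pderiv e F * hα'⟩
    have := Submodule.mem_colon_singleton.1 (hle (hs' f hf))
    rw [smul_eq_mul] at this
    convert this using 1
    ring
  · obtain ⟨e, he⟩ := exists_coeff_ne_zero_of_linearForm hbhom hb₀
    have hUP : U e ∉ P := fun hmem => by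
      have hDP : D e H ∈ P := by
        rw [hDapp]
        exact Ideal.sub_mem _ (Ideal.mul_mem_right _ _ (Ideal.mul_mem_left _ _ hbP))
          (Ideal.mul_mem_right _ _ (hκP e))
      have h1 := (Ideal.add_mem_iff_left _ hDP).1 hmem
      have hcard : S.card ≠ 0 := Finset.card_ne_zero_of_mem
        (Finset.mem_filter.2 ⟨Finset.mem_univ i, hiP⟩)
      refine (hprime.mem_or_mem h1).elim (fun h2 => hprime.ne_top ?_) hHP
      refine Ideal.eq_top_of_isUnit_mem _ h2 ?_
      rw [← C_eq_coe_nat, ← C_mul]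
      exact (isUnit_iff_ne_zero.2 (mul_ne_zero (Nat.cast_ne_zero.2 hcard)
        (mul_ne_zero hα₀ he))).map C
    have hbU : ¬ b ∣ U e := fun hd => hUP (Ideal.mem_of_dvd _ hd hbP)
    have hbG : ¬ b ∣ G := fun hd => by
      have : b ∣ U e * F := by
        rw [hUF e]
        refine Dvd.dvd.mul_left (dvd_sub ?_ (Dvd.dvd.mul_left hd _)) _
        exact Dvd.dvd.mul_right (dvd_mul_left _ _) _
      exact (hbprime.dvd_or_dvd this).elim hbU hbF
    obtain ⟨p, q, hpq⟩ := Ideal.mem_span_pair.1 hf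
    -- Multiply the relation by `U e` and replace `U e F`: everything but a multiple of `G` is
    -- divisible by `b`. As `b` is prime to `G`, it can be cancelled.
    have hd : b ∣ G * (q * U e - p * H * κ e) :=
      ⟨U e * f * H * s - p * H * C α * pderiv e F, by
        linear_combination U e * hpq - p * hUF e⟩
    obtain ⟨τ, hτ⟩ := (hbprime.dvd_or_dvd hd).resolve_left hbG
    refine ⟨U e * s * H, fun hmem => (hprime.mem_or_mem hmem).elim
      (fun h1 => (hprime.mem_or_mem h1).elim hUP hs) hHP, ?_⟩
    have hfin : U e * s * H * f = p * H * C α * pderiv e F + τ * G := mul_left_cancel₀ hb₀ (by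
      linear_combination - U e * hpq + p * hUF e + G * hτ)
    rw [hfin]
    exact Ideal.add_mem _ (Ideal.mul_mem_left _ _ (pderiv_mem_jacobianIdeal _ _))
      (Ideal.mul_mem_left _ _ (dirDeriv_mem_jacobianIdeal v F))

section
variable [CharZero k] (h : IsArrangement ℓ) (hn : n ≠ 0) {L : CoordRing k}
  (hL : L.IsHomogeneous 1) (hLℓ : ∀ i, LinearIndependent k ![ℓ i, L])
include h hn hL hLℓ

/-- `hres` is the nontrivial inclusion of the duality `(F, G) : ((F, G) : I) = I`; the rest of the
linkage is formal. -/
theorem isEvenlyLinked_of_residual {I : Ideal (CoordRing k)}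
    (hI : I.IsHomogeneous (homogeneousSubmodule (Fin 4) k)) (hJ : jacobianIdeal (∏ i, ℓ i) ≤ I)
    (hone : n = 1 → I = ⊤)
    (hres : ∀ v : Fin 4 → k, (∀ i, eval v (ℓ i) ≠ 0) → ∀ f,
      (∀ Δ, (∀ g ∈ I, Δ * g ∈ Ideal.span {∏ i, ℓ i, dirDeriv v (∏ i, ℓ i)}) →
        f * Δ ∈ Ideal.span {∏ i, ℓ i, dirDeriv v (∏ i, ℓ i)}) → f ∈ I) :
    IsEvenlyLinked I (Ideal.span {L} * I + Ideal.span {∏ i, ℓ i}) := by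
  have hrel : ∀ G : CoordRing k, (∀ i, ¬ ℓ i ∣ G) → ∀ x, ∏ i, ℓ i ∣ G * x → ∏ i, ℓ i ∣ x :=
    fun G hG x hx => (h.isRelPrime_prod Finset.univ fun i _ => hG i).dvd_of_dvd_mul_left hx
  have hLnd : ∀ i, ¬ ℓ i ∣ L := fun i =>
    (linearIndependent_iff_not_dvd (h.isHomogeneous i) hL (h.ne_zero i)).1 (hLℓ i)
  rcases Nat.lt_or_ge 1 n with h1 | h1
  · obtain ⟨v, hv⟩ := h.exists_eval_ne_zero
    have h01 : (⟨0, by omega⟩ : Fin n) ≠ ⟨1, h1⟩ := by simp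
    have hcJ : Ideal.span {∏ i, ℓ i, dirDeriv v (∏ i, ℓ i)} ≤ jacobianIdeal (∏ i, ℓ i) := by
      rw [Ideal.span_le]
      rintro x (rfl | rfl)
      · exact h.prod_mem_jacobianIdeal hn
      · exact dirDeriv_mem_jacobianIdeal v _
    refine isEvenlyLinked_mul_add hI h.isHomogeneous_prod
      (h.isHomogeneous_dirDeriv_prod (v := v)) hL h.prod_ne_zero
      (hrel _ (h.not_dvd_dirDeriv_prod hv)) (hrel _ hLnd) (fun htop => ?_) (hcJ.trans hJ)
      (le_antisymm (fun f hf => hres v hv f fun Δ hΔ => ?_) fun f hf => ?_)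
    · exact (h.isPrime_span h01).ne_top
        (top_le_iff.1 (htop ▸ hcJ.trans (jacobianIdeal_le_span h01)))
    · exact Submodule.mem_colon.1 hf Δ (Submodule.mem_colon.2 hΔ)
    · refine Submodule.mem_colon.2 fun Δ hΔ => ?_
      have := Submodule.mem_colon.1 hΔ f hf
      rwa [smul_eq_mul, mul_comm] at this
  -- For one plane the curve is empty and the polar is a constant, so `L` takes the place of `G`.
  · have hI' := hone (by omega)
    have hprime := isPrime_span_pair (h.isHomogeneous ⟨0, by omega⟩) hL (hLℓ ⟨0, by omega⟩)
    refine isEvenlyLinked_mul_add hI h.isHomogeneous_prod hL hL h.prod_ne_zero (hrel _ hLnd)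
      (hrel _ hLnd) (fun htop => hprime.ne_top (top_le_iff.1 (htop ▸ ?_))) (hI' ▸ le_top) ?_
    · rw [Ideal.span_le]
      rintro x (rfl | rfl)
      · exact Ideal.mem_of_dvd _ (Finset.dvd_prod_of_mem ℓ (Finset.mem_univ ⟨0, by omega⟩))
          (Ideal.subset_span (by simp))
      · exact Ideal.subset_span (by simp)
    · rw [hI', Submodule.top_coe, Submodule.colon_univ, Submodule.colon_eq_top_iff_subset]

theorem isEvenlyLinked_topCurveIdeal : IsEvenlyLinked (topCurveIdeal (∏ i, ℓ i))
    (Ideal.span {L} * topCurveIdeal (∏ i, ℓ i) + Ideal.span {∏ i, ℓ i}) := by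
  refine h.isEvenlyLinked_of_residual hn hL hLℓ (h.isHomogeneous_topCurveIdeal hn)
    (fun f hf => (h.mem_topCurveIdeal_iff hn f).2 fun i j hij =>
      ⟨1, (Ideal.ne_top_iff_one _).1 (h.isPrime_span hij).ne_top, by rwa [one_mul]⟩)
    (fun h1 => ?_) fun v hv f hf => ?_
  · subst h1
    rw [eq_top_iff]
    exact fun f _ => (h.mem_topCurveIdeal_iff hn f).2 fun i j hij =>
      absurd (Subsingleton.elim i j) hij
  · rw [h.mem_topCurveIdeal_iff hn]
    intro i j hij
    obtain ⟨Δ, hΔ, hΔ'⟩ := h.exists_residual_top hv hij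
    exact hΔ' f (hf Δ hΔ)

theorem isEvenlyLinked_redCurveIdeal : IsEvenlyLinked (redCurveIdeal (∏ i, ℓ i))
    (Ideal.span {L} * redCurveIdeal (∏ i, ℓ i) + Ideal.span {∏ i, ℓ i}) := by
  refine h.isEvenlyLinked_of_residual hn hL hLℓ (h.isHomogeneous_redCurveIdeal hn)
    (fun f hf => (h.mem_redCurveIdeal_iff hn f).2 fun i j hij => jacobianIdeal_le_span hij hf)
    (fun h1 => ?_) fun v hv f hf => ?_
  · subst h1
    rw [eq_top_iff]
    exact fun f _ => (h.mem_redCurveIdeal_iff hn f).2 fun i j hij =>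
      absurd (Subsingleton.elim i j) hij
  · rw [h.mem_redCurveIdeal_iff hn]
    intro i j hij
    obtain ⟨Δ, hΔ, hΔ'⟩ := h.exists_residual_red hv hij
    exact hΔ' f (hf Δ fun g hg => hΔ g ((h.mem_redCurveIdeal_iff hn g).1 hg i j hij))

end
end IsArrangement
end ArrCurve

namespace ArrCurve
open MvPolynomial
-- Localizations and vanishing of `H¹` and `H²` of the twists of `𝓞`
section IdealAway
variable {k : Type*} [Field k]

theorem mem_idealAway_iff {I : Ideal (CoordRing k)} {w : CoordRing k} {f : Frac k} :
    f ∈ idealAway I w ↔ ∃ n : ℕ, ∃ g ∈ I, algebraMap _ (Frac k) w ^ n * f = algebraMap _ _ g := by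
  simp only [← map_pow, ← Algebra.smul_def]
  rfl

theorem algebraMap_frac_ne_zero {w : CoordRing k} (hw : w ≠ 0) : algebraMap _ (Frac k) w ≠ 0 :=
  (map_ne_zero_iff _ (IsFractionRing.injective (CoordRing k) (Frac k))).2 hw

theorem algebraMap_frac_injective : Function.Injective (algebraMap (CoordRing k) (Frac k)) :=
  IsFractionRing.injective (CoordRing k) (Frac k)

theorem idealAway_mono {I J : Ideal (CoordRing k)} (h : I ≤ J) (w : CoordRing k) :
    idealAway I w ≤ idealAway J w := by
  rintro f ⟨n, g, hg, hf⟩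
  exact ⟨n, g, h hg, hf⟩

theorem idealAway_le_of_dvd_pow {I : Ideal (CoordRing k)} {w w' : CoordRing k} {m : ℕ}
    (h : w ∣ w' ^ m) : idealAway I w ≤ idealAway I w' := by
  intro f hf
  rw [mem_idealAway_iff] at hf ⊢
  obtain ⟨n, g, hg, hf⟩ := hf
  obtain ⟨c, hc⟩ := h
  refine ⟨m * n, c ^ n * g, I.mul_mem_left _ hg, ?_⟩
  rw [pow_mul, ← map_pow, hc, map_mul, mul_pow, map_mul, ← hf, map_pow]
  ring

theorem smul_mem_idealAway {I J : Ideal (CoordRing k)} {a w : CoordRing k}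
    (h : ∀ x ∈ I, a * x ∈ J) {f : Frac k} (hf : f ∈ idealAway I w) :
    algebraMap _ (Frac k) a * f ∈ idealAway J w := by
  rw [mem_idealAway_iff] at hf ⊢
  obtain ⟨n, g, hg, hf⟩ := hf
  refine ⟨n, a * g, h g hg, ?_⟩
  rw [map_mul, ← hf]
  ring

theorem div_mem_idealAway {I : Ideal (CoordRing k)} {w g : CoordRing k} (hw : w ≠ 0) (hg : g ∈ I)
    (n : ℕ) : algebraMap _ (Frac k) g / algebraMap _ (Frac k) w ^ n ∈ idealAway I w := by
  rw [mem_idealAway_iff]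
  exact ⟨n, g, hg, mul_div_cancel₀ _ (pow_ne_zero _ (algebraMap_frac_ne_zero hw))⟩

theorem exists_of_mem_idealAway_mul_add {I : Ideal (CoordRing k)} {F L w : CoordRing k}
    (hw : w ≠ 0) {x : Frac k} (hx : x ∈ idealAway (Ideal.span {L} * I + Ideal.span {F}) w) :
    ∃ a ∈ idealAway I w, ∃ r ∈ idealAway ⊤ w,
      x = algebraMap _ (Frac k) L * a + algebraMap _ (Frac k) F * r := by
  obtain ⟨n, g, hg, hx⟩ := mem_idealAway_iff.1 hx
  obtain ⟨y, hy, z, hz, rfl⟩ := Submodule.mem_sup.1 hg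
  obtain ⟨a, ha, rfl⟩ := Ideal.mem_span_singleton_mul.1 hy
  obtain ⟨r, rfl⟩ := Ideal.mem_span_singleton.1 hz
  refine ⟨_, div_mem_idealAway hw ha n, _, div_mem_idealAway hw (Submodule.mem_top (x := r)) n, ?_⟩
  have hw' := pow_ne_zero n (algebraMap_frac_ne_zero hw)
  field_simp
  rw [mul_comm x, hx, map_add, map_mul, map_mul]

/-- The relations between `L` and `F` over a localization are generated by the obvious one. -/
theorem exists_of_mul_eq_mul {F L w : CoordRing k} (hw : w ≠ 0) (hL₀ : L ≠ 0)
    (hFL : ∀ x, L ∣ F * x → L ∣ x) {y z : Frac k} (hy : y ∈ idealAway ⊤ w) (hz : z ∈ idealAway ⊤ w)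
    (h : algebraMap _ (Frac k) L * z = algebraMap _ (Frac k) F * y) :
    ∃ s ∈ idealAway ⊤ w, y = algebraMap _ (Frac k) L * s ∧ z = algebraMap _ (Frac k) F * s := by
  obtain ⟨n, Y, -, hY⟩ := mem_idealAway_iff.1 hy
  obtain ⟨m, Z, -, hZ⟩ := mem_idealAway_iff.1 hz
  have hw' := algebraMap_frac_ne_zero hw
  have h1 : L * (w ^ n * Z) = F * (w ^ m * Y) := by
    apply algebraMap_frac_injective
    simp only [map_mul, map_pow]
    rw [← hY, ← hZ]
    linear_combination algebraMap _ (Frac k) w ^ n * algebraMap _ (Frac k) w ^ m * h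
  obtain ⟨s, hs⟩ := hFL _ ⟨_, h1.symm⟩
  have hy' : y = algebraMap _ (Frac k) L * (algebraMap _ (Frac k) s /
      algebraMap _ (Frac k) w ^ (m + n)) := by
    have := congrArg (algebraMap _ (Frac k)) hs
    rw [map_mul, map_mul, ← hY, map_pow] at this
    field_simp
    rw [← this]
    ring
  refine ⟨_, div_mem_idealAway hw (Submodule.mem_top (x := s)) (m + n), hy', ?_⟩
  apply mul_left_cancel₀ (algebraMap_frac_ne_zero hL₀)
  rw [h]
  conv_lhs => rw [hy']
  ring

/-- The product of the variables. -/
noncomputable def varProd (k : Type*) [Field k] : CoordRing k := ∏ p, X p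

theorem varProd_ne_zero : varProd k ≠ 0 := Finset.prod_ne_zero_iff.2 fun p _ => X_ne_zero p

theorem isHomogeneous_varProd_pow (n : ℕ) : (varProd k ^ n).IsHomogeneous (4 * n) := by
  have : (varProd k).IsHomogeneous 4 := by
    have h := IsHomogeneous.prod Finset.univ (X : Fin 4 → CoordRing k) (fun _ => 1)
      fun i _ => isHomogeneous_X k i
    rw [Finset.sum_const, Finset.card_univ, Fintype.card_fin, smul_eq_mul, mul_one] at h
    exact h
  exact this.pow n

/-- The form with `∀ᶠ` lets finitely many cochain entries share one denominator. -/
theorem eventually_exists_of_mem_idealAway {I : Ideal (CoordRing k)} {w : CoordRing k} {m : ℕ}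
    (hw : w ∣ varProd k ^ m) {f : Frac k} (hf : f ∈ idealAway I w) :
    ∀ᶠ n in Filter.atTop, ∃ g ∈ I, algebraMap _ (Frac k) (varProd k) ^ n * f = algebraMap _ _ g := by
  obtain ⟨N, g, hg, hf⟩ := mem_idealAway_iff.1 (idealAway_le_of_dvd_pow hw hf)
  filter_upwards [Filter.eventually_ge_atTop N] with n hn
  refine ⟨varProd k ^ (n - N) * g, I.mul_mem_left _ hg, ?_⟩
  rw [map_mul, map_pow, ← hf, ← mul_assoc, ← pow_add, Nat.sub_add_cancel hn]

/-- The product of the variables with index in `S`. -/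
noncomputable def varProdOn (k : Type*) [Field k] (S : Finset (Fin 4)) : CoordRing k := ∏ p ∈ S, X p

theorem varProdOn_ne_zero (S : Finset (Fin 4)) : varProdOn k S ≠ 0 :=
  Finset.prod_ne_zero_iff.2 fun p _ => X_ne_zero p

theorem X_dvd_varProdOn {S : Finset (Fin 4)} {i : Fin 4} (hi : i ∈ S) : X i ∣ varProdOn k S :=
  Finset.dvd_prod_of_mem _ hi

theorem varProdOn_insert_dvd (S : Finset (Fin 4)) (i : Fin 4) :
    varProdOn k (insert i S) ∣ X i * varProdOn k S := by
  by_cases hi : i ∈ S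
  · rw [Finset.insert_eq_of_mem hi]
    exact dvd_mul_left _ _
  · rw [varProdOn, Finset.prod_insert hi, varProdOn]

theorem varProdOn_dvd_varProd (S : Finset (Fin 4)) : varProdOn k S ∣ varProd k :=
  Finset.prod_dvd_prod_of_subset _ _ _ (Finset.subset_univ S)

theorem idealAway_X (I : Ideal (CoordRing k)) (i : Fin 4) :
    idealAway I (X i) = idealAway I (varProdOn k {i}) := by
  rw [varProdOn, Finset.prod_singleton]

theorem idealAway_X_mul_X (I : Ideal (CoordRing k)) (i j : Fin 4) :
    idealAway I (X i * X j) = idealAway I (varProdOn k {i, j}) := by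
  apply le_antisymm
  · refine idealAway_le_of_dvd_pow (m := 2) ?_
    rw [sq]
    exact mul_dvd_mul (X_dvd_varProdOn (by simp)) (X_dvd_varProdOn (by simp))
  · refine idealAway_le_of_dvd_pow (m := 1) ?_
    rw [pow_one]
    refine (varProdOn_insert_dvd {j} i).trans ?_
    rw [varProdOn, Finset.prod_singleton]

/-- With common denominator `(x₀ x₁ x₂ x₃)ⁿ`, having no pole along `x_p = 0` means that `x_pⁿ`
divides the numerator, a condition on each monomial separately. -/
theorem mem_idealAway_top_varProdOn_iff (S : Finset (Fin 4)) {n : ℕ} {f : Frac k} {g : CoordRing k}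
    (h : algebraMap _ (Frac k) (varProd k) ^ n * f = algebraMap _ _ g) :
    f ∈ idealAway ⊤ (varProdOn k S) ↔ ∀ e, coeff e g ≠ 0 → ∀ p ∉ S, n ≤ e p := by
  have hvar : varProd k = varProdOn k S * varProdOn k Sᶜ :=
    (Finset.prod_mul_prod_compl S _).symm
  constructor
  · intro hf e he p hp
    obtain ⟨m, g', -, hg'⟩ := mem_idealAway_iff.1 hf
    have h1 : varProdOn k S ^ m * g = varProd k ^ n * g' := by
      apply algebraMap_frac_injective
      simp only [map_mul, map_pow]
      rw [← h, ← hg']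
      ring
    have hdvd : X p ^ n ∣ varProdOn k S ^ m * g := by
      rw [h1]
      exact Dvd.dvd.mul_right (pow_dvd_pow_of_dvd (Finset.dvd_prod_of_mem _ (Finset.mem_univ p)) n) _
    have hXp : Prime (X p : CoordRing k) := X_prime
    have hnd : ¬ X p ∣ varProdOn k S ^ m := fun hd => by
      obtain ⟨q, hq, hqd⟩ := hXp.exists_mem_finset_dvd (hXp.dvd_of_dvd_pow hd)
      exact hp (X_dvd_X.1 hqd ▸ hq)
    obtain ⟨c, rfl⟩ := hXp.pow_dvd_of_dvd_mul_left n hnd hdvd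
    rw [X_pow_eq_monomial, coeff_monomial_mul'] at he
    by_contra hlt
    refine he (if_neg fun hle => hlt ?_)
    simpa using hle p
  · intro hg
    have hmon : varProdOn k Sᶜ ^ n = monomial (∑ p ∈ Sᶜ, Finsupp.single p n) (1 : k) := by
      rw [varProdOn, ← Finset.prod_pow, monomial_sum_one]
      exact Finset.prod_congr rfl fun p _ => X_pow_eq_monomial
    have hdvd : varProdOn k Sᶜ ^ n ∣ g := by
      rw [hmon, monomial_one_dvd_iff_modMonomial_eq_zero]
      ext e
      rw [coeff_zero]
      by_cases hle : ∑ p ∈ Sᶜ, Finsupp.single p n ≤ e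
      · exact coeff_modMonomial_of_le _ hle
      · rw [coeff_modMonomial_of_not_le _ hle]
        by_contra hne
        refine hle fun p => ?_
        rw [Finsupp.finsetSum_apply]
        simp only [Finsupp.single_apply, Finset.sum_ite_eq', Finset.mem_compl]
        split_ifs with hp
        · exact Nat.zero_le _
        · exact hg e hne p hp
    obtain ⟨c, rfl⟩ := hdvd
    refine mem_idealAway_iff.2 ⟨n, c, Submodule.mem_top, ?_⟩
    apply mul_left_cancel₀ (pow_ne_zero n (algebraMap_frac_ne_zero (varProdOn_ne_zero (k := k) Sᶜ)))
    rw [hvar, map_mul, map_mul, map_pow] at h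
    rw [← h]
    ring

/-- Assemble a polynomial from the family `a`, taking the coefficient at `e` from `a (π e)`. -/
noncomputable def mixCoeff (π : (Fin 4 →₀ ℕ) → Fin 4) (a : Fin 4 → CoordRing k) : CoordRing k :=
  ∑ e ∈ Finset.univ.biUnion fun p => (a p).support, monomial e (coeff e (a (π e)))

theorem coeff_mixCoeff (π : (Fin 4 →₀ ℕ) → Fin 4) (a : Fin 4 → CoordRing k) (e : Fin 4 →₀ ℕ) :
    coeff e (mixCoeff π a) = coeff e (a (π e)) := by
  classical
  rw [mixCoeff, coeff_sum]
  simp only [coeff_monomial, Finset.sum_ite_eq', Finset.mem_biUnion, Finset.mem_univ, true_and]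
  split_ifs with h
  · rfl
  · by_contra hne
    exact h ⟨π e, mem_support_iff.2 (Ne.symm hne)⟩

theorem exists_index_le (n : ℕ) :
    ∃ π : (Fin 4 →₀ ℕ) → Fin 4, ∀ e : Fin 4 →₀ ℕ, (∃ p, n ≤ e p) → n ≤ e (π e) := by
  classical
  refine ⟨fun e => if h : ∃ p, n ≤ e p then h.choose else 0, fun e h => ?_⟩
  simp only [dif_pos h]
  exact h.choose_spec

/-- The cone homotopy with vertex `π e`, chosen monomial by monomial, creates no pole along `x_{π e}
= 0`, because `π e` is picked with exponent at least `n`. Such an index exists since `insert (π e)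
S` has at most three of the four elements; this is where `H³` would fail. -/
theorem coeff_mixCoeff_support {n : ℕ} {π : (Fin 4 →₀ ℕ) → Fin 4}
    (hπ : ∀ e : Fin 4 →₀ ℕ, (∃ p, n ≤ e p) → n ≤ e (π e)) {S : Finset (Fin 4)} (hS : S.card ≤ 2)
    {a : Fin 4 → CoordRing k} (ha : ∀ q e, coeff e (a q) ≠ 0 → ∀ p ∉ insert q S, n ≤ e p)
    (e : Fin 4 →₀ ℕ) (he : coeff e (mixCoeff π a) ≠ 0) (p : Fin 4) (hp : p ∉ S) : n ≤ e p := by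
  rw [coeff_mixCoeff] at he
  have h1 := ha (π e) e he
  by_cases hpe : p = π e
  · rw [hpe]
    refine hπ e ?_
    have hcard : (insert (π e) S).card < (Finset.univ : Finset (Fin 4)).card := by
      have := Finset.card_insert_le (π e) S
      simp only [Finset.card_univ, Fintype.card_fin]
      omega
    obtain ⟨q, -, hq⟩ := Finset.exists_mem_notMem_of_card_lt_card hcard
    exact ⟨q, h1 q hq⟩
  · exact h1 p (by simp [hpe, hp])

/-- `H¹(ℙ³, 𝓞(t)) = 0` for all `t`. -/
theorem exists_cochain_of_cocycle_one {r : Fin 4 → Fin 4 → Frac k}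
    (hr : ∀ i j, r i j ∈ idealAway ⊤ (X i * X j : CoordRing k))
    (hr' : ∀ i j l, r j l - r i l + r i j = 0) :
    ∃ ρ : Fin 4 → Frac k, (∀ i, ρ i ∈ idealAway ⊤ (X i : CoordRing k)) ∧
      ∀ i j, r i j = ρ j - ρ i := by
  simp only [idealAway_X_mul_X, idealAway_X] at hr ⊢
  have hev := Filter.eventually_all.2 fun i => Filter.eventually_all.2 fun j =>
    eventually_exists_of_mem_idealAway (m := 1) (by
      rw [pow_one]; exact varProdOn_dvd_varProd _) (hr i j)
  obtain ⟨n, hn⟩ := hev.exists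
  choose g _ hg using hn
  obtain ⟨π, hπ⟩ := exists_index_le n
  have hu := pow_ne_zero n (algebraMap_frac_ne_zero (varProd_ne_zero (k := k)))
  -- The coefficient of `ρ i` at `e` is that of `r (π e) i`, and the cocycle condition at `(π e, i,
  -- j)` makes this a primitive.
  refine ⟨fun i => algebraMap _ _ (mixCoeff π fun p => g p i) /
    algebraMap _ (Frac k) (varProd k) ^ n, fun i => ?_, fun i j => ?_⟩
  · refine (mem_idealAway_top_varProdOn_iff {i} (mul_div_cancel₀ _ hu)).2
      (coeff_mixCoeff_support hπ (by simp) fun q => ?_)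
    exact (mem_idealAway_top_varProdOn_iff {q, i} (hg q i)).1 (hr q i)
  · apply mul_left_cancel₀ hu
    rw [hg i j, mul_sub, mul_div_cancel₀ _ hu, mul_div_cancel₀ _ hu, ← map_sub]
    congr 1
    ext e
    rw [coeff_sub, coeff_mixCoeff, coeff_mixCoeff, ← coeff_sub]
    congr 1
    apply algebraMap_frac_injective
    rw [map_sub, ← hg, ← hg, ← hg]
    linear_combination algebraMap _ (Frac k) (varProd k) ^ n * hr' (π e) i j

/-- `H²(ℙ³, 𝓞(t)) = 0` for all `t`. -/
theorem exists_cochain_of_cocycle_two {s : Fin 4 → Fin 4 → Fin 4 → Frac k}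
    (hs : ∀ i j l, s i j l ∈ idealAway ⊤ (varProdOn k {i, j, l}))
    (hs' : ∀ i j l p, s j l p - s i l p + s i j p - s i j l = 0) :
    ∃ t : Fin 4 → Fin 4 → Frac k, (∀ i j, t i j ∈ idealAway ⊤ (X i * X j : CoordRing k)) ∧
      ∀ i j l, s i j l = t j l - t i l + t i j := by
  simp only [idealAway_X_mul_X]
  have hev := Filter.eventually_all.2 fun i => Filter.eventually_all.2 fun j =>
    Filter.eventually_all.2 fun l =>
    eventually_exists_of_mem_idealAway (m := 1) (by
      rw [pow_one]; exact varProdOn_dvd_varProd _) (hs i j l)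
  obtain ⟨n, hn⟩ := hev.exists
  choose g _ hg using hn
  obtain ⟨π, hπ⟩ := exists_index_le n
  have hu := pow_ne_zero n (algebraMap_frac_ne_zero (varProd_ne_zero (k := k)))
  refine ⟨fun i j => algebraMap _ _ (mixCoeff π fun p => g p i j) /
    algebraMap _ (Frac k) (varProd k) ^ n, fun i j => ?_, fun i j l => ?_⟩
  · refine (mem_idealAway_top_varProdOn_iff {i, j} (mul_div_cancel₀ _ hu)).2
      (coeff_mixCoeff_support hπ Finset.card_le_two fun q => ?_)
    exact (mem_idealAway_top_varProdOn_iff {q, i, j} (hg q i j)).1 (hs q i j)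
  · apply mul_left_cancel₀ hu
    rw [hg i j l, mul_add, mul_sub, mul_div_cancel₀ _ hu, mul_div_cancel₀ _ hu,
      mul_div_cancel₀ _ hu, ← map_sub, ← map_add]
    congr 1
    ext e
    rw [coeff_add, coeff_sub, coeff_mixCoeff, coeff_mixCoeff, coeff_mixCoeff, ← coeff_sub,
      ← coeff_add]
    congr 1
    apply algebraMap_frac_injective
    rw [map_add, map_sub, ← hg, ← hg, ← hg, ← hg]
    linear_combination algebraMap _ (Frac k) (varProd k) ^ n * hs' (π e) i j l

end IdealAway
end ArrCurve

namespace ArrCurve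
open MvPolynomial
attribute [local instance] MvPolynomial.gradedAlgebra
-- The shift isomorphism of Hartshorne–Rao modules
section HRShift
variable {k : Type*} [Field k]

theorem idealAway_X_le_right (I : Ideal (CoordRing k)) (i j : Fin 4) :
    idealAway I (X j) ≤ idealAway I (X i * X j) :=
  idealAway_le_of_dvd_pow (m := 1) (by rw [pow_one]; exact dvd_mul_left _ _)

theorem idealAway_X_mul_X_le (I : Ideal (CoordRing k)) {i j : Fin 4} {S : Finset (Fin 4)}
    (hi : i ∈ S) (hj : j ∈ S) : idealAway I (X i * X j) ≤ idealAway I (varProdOn k S) := by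
  rw [idealAway_X_mul_X]
  refine idealAway_le_of_dvd_pow (m := 1) ?_
  rw [pow_one]
  exact Finset.prod_dvd_prod_of_subset _ _ _ (by simp [Finset.insert_subset_iff, hi, hj])

theorem mul_mem_span_mul_add {I : Ideal (CoordRing k)} {F L x : CoordRing k} (hx : x ∈ I) :
    L * x ∈ Ideal.span {L} * I + Ideal.span {F} :=
  Submodule.mem_sup_left (Ideal.mul_mem_mul (Ideal.mem_span_singleton_self L) hx)

theorem mul_right_mem_span_mul_add {I : Ideal (CoordRing k)} {F L x : CoordRing k} :
    F * x ∈ Ideal.span {L} * I + Ideal.span {F} :=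
  Submodule.mem_sup_right (Ideal.mul_mem_right _ _ (Ideal.mem_span_singleton_self F))

/-- Injectivity. Writing `L c = δ(L a + F r)` gives `L (c - δa) = F δr`, so `c - δa = F s` and `δr =
L s` with `s` a cocycle of `𝓞`. By vanishing of `H¹`, `s = δt`, and `c = δ(a + F t)`. -/
theorem mem_coboundaries_of_smul_mem {I : Ideal (CoordRing k)} {F L : CoordRing k} (hF : F ∈ I)
    (hL₀ : L ≠ 0) (hFL : ∀ x, L ∣ F * x → L ∣ x) {c : Fin 4 → Fin 4 → Frac k} (hc : c ∈ cocycles I)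
    (h : L • c ∈ coboundaries (Ideal.span {L} * I + Ideal.span {F})) : c ∈ coboundaries I := by
  obtain ⟨b, hb, hcb⟩ := h
  have hcb' : ∀ i j, algebraMap _ (Frac k) L * c i j = b j - b i := fun i j => by
    rw [← Algebra.smul_def]
    exact hcb i j
  choose a ha r hr hbr using fun i => exists_of_mem_idealAway_mul_add (X_ne_zero i) (hb i)
  have hsub : ∀ i j, r j - r i ∈ idealAway ⊤ (X i * X j : CoordRing k) := fun i j =>
    Submodule.sub_mem _ (idealAway_X_le_right _ i j (hr j)) (idealAway_le_mul _ _ _ (hr i))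
  have hz : ∀ i j, c i j - a j + a i ∈ idealAway ⊤ (X i * X j : CoordRing k) := fun i j =>
    idealAway_mono (le_top (a := I)) _ (Submodule.add_mem _ (Submodule.sub_mem _ (hc.1 i j)
      (idealAway_X_le_right _ i j (ha j))) (idealAway_le_mul _ _ _ (ha i)))
  have key := fun i j => exists_of_mul_eq_mul (mul_ne_zero (X_ne_zero i) (X_ne_zero j)) hL₀ hFL
    (hsub i j) (hz i j)
    (by linear_combination hcb' i j + hbr j - hbr i)
  choose s hs hs1 hs2 using key
  obtain ⟨t, ht, hst⟩ := exists_cochain_of_cocycle_one hs fun i j l => by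
    apply mul_left_cancel₀ (algebraMap_frac_ne_zero hL₀)
    linear_combination hs1 i l - hs1 j l - hs1 i j
  refine ⟨fun i => a i + algebraMap _ _ F * t i, fun i => Submodule.add_mem _ (ha i)
    (smul_mem_idealAway (fun x _ => I.mul_mem_right _ hF) (ht i)), fun i j => ?_⟩
  linear_combination hs2 i j + algebraMap _ (Frac k) F * hst i j

/-- Surjectivity. Writing `c = L a + F r`, one gets `δa = F s`, `δr = -L s` with `s` a 2-cocycle of
`𝓞`, so `s = δt`. Then `a - F t` is a cocycle of `I`, `r + L t = δρ`, and `c = L (a - F t) + δ(F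
ρ)`. -/
theorem exists_sub_smul_mem_coboundaries {I : Ideal (CoordRing k)} {F L : CoordRing k} (hF : F ∈ I)
    (hL₀ : L ≠ 0) (hFL : ∀ x, L ∣ F * x → L ∣ x) {c : Fin 4 → Fin 4 → Frac k}
    (hc : c ∈ cocycles (Ideal.span {L} * I + Ideal.span {F})) :
    ∃ c' ∈ cocycles I, L • c' - c ∈ coboundaries (Ideal.span {L} * I + Ideal.span {F}) := by
  choose a ha r hr hcr using fun i j =>
    exists_of_mem_idealAway_mul_add (mul_ne_zero (X_ne_zero i) (X_ne_zero j)) (hc.1 i j)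
  have hδ : ∀ (J : Ideal (CoordRing k)) (x : Fin 4 → Fin 4 → Frac k),
      (∀ i j, x i j ∈ idealAway J (X i * X j)) → ∀ i j l,
      x j l - x i l + x i j ∈ idealAway ⊤ (varProdOn k {i, j, l}) := fun J x hx i j l =>
    idealAway_mono (le_top (a := J)) _ (Submodule.add_mem _ (Submodule.sub_mem _
      (idealAway_X_mul_X_le _ (by simp) (by simp) (hx j l))
      (idealAway_X_mul_X_le _ (by simp) (by simp) (hx i l)))
      (idealAway_X_mul_X_le _ (by simp) (by simp) (hx i j)))
  have key := fun i j l => exists_of_mul_eq_mul (varProdOn_ne_zero {i, j, l}) hL₀ hFL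
    (Submodule.neg_mem _ (hδ _ r hr i j l)) (hδ _ a ha i j l)
    (by linear_combination hc.2 i j l - hcr j l + hcr i l - hcr i j)
  choose s hs hs1 hs2 using key
  obtain ⟨t, ht, hst⟩ := exists_cochain_of_cocycle_two hs fun i j l p => by
    apply mul_left_cancel₀ (algebraMap_frac_ne_zero hL₀)
    linear_combination -hs1 j l p + hs1 i l p - hs1 i j p + hs1 i j l
  obtain ⟨ρ, hρ, hrρ⟩ := exists_cochain_of_cocycle_one
    (r := fun i j => r i j + algebraMap _ _ L * t i j)
    (fun i j => Submodule.add_mem _ (hr i j)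
      (smul_mem_idealAway (fun _ _ => Submodule.mem_top) (ht i j)))
    fun i j l => by linear_combination -hs1 i j l - algebraMap _ (Frac k) L * hst i j l
  refine ⟨fun i j => a i j - algebraMap _ _ F * t i j, ⟨fun i j => Submodule.sub_mem _ (ha i j)
    (smul_mem_idealAway (fun x _ => I.mul_mem_right _ hF) (ht i j)), fun i j l => ?_⟩,
    fun i => - (algebraMap _ _ F * ρ i), fun i => Submodule.neg_mem _
    (smul_mem_idealAway (fun _ _ => mul_right_mem_span_mul_add) (hρ i)), fun i j => ?_⟩
  · linear_combination hs2 i j l + algebraMap _ (Frac k) F * hst i j l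
  · change L • (a i j - algebraMap _ _ F * t i j) - c i j = _
    rw [Algebra.smul_def]
    linear_combination -hcr i j - algebraMap _ (Frac k) F * hrρ i j

theorem homogeneousComponent_div_mem_idealAway {I : Ideal (CoordRing k)}
    (hI : I.IsHomogeneous (homogeneousSubmodule (Fin 4) k)) {w : CoordRing k} {e : ℕ}
    (hw : w.IsHomogeneous e) {f : Frac k} (hf : f ∈ idealAway I w) {n : ℕ} {g : CoordRing k}
    (hg : algebraMap _ (Frac k) (varProd k) ^ n * f = algebraMap _ _ g) (d : ℕ) :
    algebraMap _ (Frac k) (homogeneousComponent d g) / algebraMap _ (Frac k) (varProd k) ^ n ∈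
      idealAway I w := by
  obtain ⟨N, g', hg', hf⟩ := mem_idealAway_iff.1 hf
  have hu := pow_ne_zero n (algebraMap_frac_ne_zero (varProd_ne_zero (k := k)))
  have h1 : g * w ^ N = g' * varProd k ^ n := by
    apply algebraMap_frac_injective
    simp only [map_mul, map_pow]
    rw [← hg, ← hf]
    ring
  have h2 := homogeneousComponent_add_mul (hw.pow N) d g
  rw [h1] at h2
  obtain ⟨g'', hg'', h3⟩ : ∃ g'' ∈ I, homogeneousComponent d g * w ^ N = g'' * varProd k ^ n := by
    by_cases hle : 4 * n ≤ d + e * N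
    · refine ⟨homogeneousComponent (d + e * N - 4 * n) g', homogeneousComponent_mem_of_mem hI hg' _,
        ?_⟩
      rw [← homogeneousComponent_add_mul (isHomogeneous_varProd_pow n), ← h2,
        Nat.sub_add_cancel hle]
    · refine ⟨0, I.zero_mem, ?_⟩
      rw [← h2, zero_mul, ← decompose_eq_homogeneousComponent]
      exact DirectSum.coe_decompose_mul_of_right_mem_of_not_le _ (isHomogeneous_varProd_pow n) hle
  refine mem_idealAway_iff.2 ⟨N, g'', hg'', ?_⟩
  have := congrArg (algebraMap _ (Frac k)) h3
  simp only [map_mul, map_pow] at this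
  rw [← mul_div_assoc, mul_comm, this, mul_div_cancel_right₀ _ hu]

theorem homogeneousComponent_eq_self_of_mem_fracDegree {t : ℤ} {f : Frac k}
    (hf : f ∈ fracDegree k t) {n D : ℕ} (hD : (D : ℤ) = t + 4 * n) {g : CoordRing k}
    (hg : algebraMap _ (Frac k) (varProd k) ^ n * f = algebraMap _ _ g) :
    homogeneousComponent D g = g := by
  obtain ⟨p, q, a, b, hp, hq, hq₀, rfl, hab⟩ := hf
  have hq' := algebraMap_frac_ne_zero hq₀
  have h1 : g * q = varProd k ^ n * p := by
    apply algebraMap_frac_injective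
    simp only [map_mul, map_pow]
    rw [← hg]
    field_simp
  have h2 := homogeneousComponent_add_mul hq D g
  have h3 : (varProd k ^ n * p).IsHomogeneous (D + b) := by
    have : D + b = 4 * n + a := by omega
    rw [this]
    exact (isHomogeneous_varProd_pow n).mul hp
  rw [h1, homogeneousComponent_of_mem h3, if_pos rfl, ← h1] at h2
  exact (mul_right_cancel₀ hq₀ h2).symm

theorem algebraMap_mul_mem_fracDegree {L : CoordRing k} (hL : L.IsHomogeneous 1) {t : ℤ}
    {f : Frac k} (hf : f ∈ fracDegree k t) : algebraMap _ (Frac k) L * f ∈ fracDegree k (t + 1) := by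
  obtain ⟨p, q, a, b, hp, hq, hq₀, rfl, hab⟩ := hf
  refine ⟨L * p, q, 1 + a, b, hL.mul hp, hq, hq₀, ?_, by push_cast; omega⟩
  rw [map_mul, mul_div_assoc]

/-- Needed because a class whose product with `L` is homogeneous must itself have a homogeneous
representative: take the degree `t` part of the cocycle and the degree `t + 1` part of the bounding
cochain. -/
theorem exists_homogeneous_cocycle {I J : Ideal (CoordRing k)}
    (hI : I.IsHomogeneous (homogeneousSubmodule (Fin 4) k))
    (hJ : J.IsHomogeneous (homogeneousSubmodule (Fin 4) k)) {L : CoordRing k}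
    (hL : L.IsHomogeneous 1) {t : ℤ} {c c' : Fin 4 → Fin 4 → Frac k} (hc : c ∈ cocycles I)
    (hc' : c' ∈ cocycles J) (hct : ∀ i j, c' i j ∈ fracDegree k (t + 1))
    (h : L • c - c' ∈ coboundaries J) :
    ∃ x ∈ cocycles I, (∀ i j, x i j ∈ fracDegree k t) ∧ L • x - c' ∈ coboundaries J := by
  obtain ⟨b, hb, hcb⟩ := h
  have hcb' : ∀ i j, algebraMap _ (Frac k) L * c i j - c' i j = b j - b i := fun i j => by
    rw [← Algebra.smul_def]
    exact hcb i j
  have hX : ∀ i : Fin 4, (X i : CoordRing k) ∣ varProd k ^ 1 := fun i => by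
    rw [pow_one]
    exact Finset.dvd_prod_of_mem _ (Finset.mem_univ i)
  have hXX : ∀ i j : Fin 4, (X i * X j : CoordRing k) ∣ varProd k ^ 2 := fun i j => by
    rw [sq]
    exact mul_dvd_mul (by simpa using hX i) (by simpa using hX j)
  have e1 := Filter.eventually_all.2 fun i => Filter.eventually_all.2 fun j =>
    eventually_exists_of_mem_idealAway (hXX i j) (hc.1 i j)
  have e2 := Filter.eventually_all.2 fun i => Filter.eventually_all.2 fun j =>
    eventually_exists_of_mem_idealAway (hXX i j) (hc'.1 i j)
  have e3 := Filter.eventually_all.2 fun i => eventually_exists_of_mem_idealAway (hX i) (hb i)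
  obtain ⟨n, ⟨⟨h1, h2⟩, h3⟩, h4⟩ :=
    (((e1.and e2).and e3).and (Filter.eventually_ge_atTop (-t).toNat)).exists
  choose g _ hg using h1
  choose g' _ hg' using h2
  choose y _ hy using h3
  -- The denominator has degree `4 n`, so degree `t` fractions have numerators of degree `t + 4 n`;
  -- `n` was taken large enough for this to be nonnegative.
  obtain ⟨d, hd⟩ : ∃ d : ℕ, (d : ℤ) = t + 4 * n := ⟨(t + 4 * n).toNat, by omega⟩
  have hu := pow_ne_zero n (algebraMap_frac_ne_zero (varProd_ne_zero (k := k)))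
  have hg'd : ∀ i j, homogeneousComponent (d + 1) (g' i j) = g' i j := fun i j =>
    homogeneousComponent_eq_self_of_mem_fracDegree (hct i j) (by push_cast; omega) (hg' i j)
  refine ⟨fun i j => algebraMap _ _ (homogeneousComponent d (g i j)) /
    algebraMap _ (Frac k) (varProd k) ^ n, ⟨fun i j => ?_, fun i j l => ?_⟩, fun i j => ?_,
    fun i => algebraMap _ _ (homogeneousComponent (d + 1) (y i)) /
    algebraMap _ (Frac k) (varProd k) ^ n, fun i => ?_, fun i j => ?_⟩
  · exact homogeneousComponent_div_mem_idealAway hI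
      ((isHomogeneous_X k i).mul (isHomogeneous_X k j)) (hc.1 i j) (hg i j) d
  · rw [← sub_div, ← add_div, ← map_sub, ← map_add, ← map_sub, ← map_add]
    have : g j l - g i l + g i j = 0 := by
      apply algebraMap_frac_injective
      rw [map_add, map_sub, ← hg, ← hg, ← hg, map_zero]
      linear_combination algebraMap _ (Frac k) (varProd k) ^ n * hc.2 i j l
    rw [this, map_zero, map_zero, zero_div]
  · refine ⟨_, _, d, 4 * n, homogeneousComponent_isHomogeneous d (g i j),
      isHomogeneous_varProd_pow n, pow_ne_zero n varProd_ne_zero, ?_, by push_cast; omega⟩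
    rw [map_pow]
  · exact homogeneousComponent_div_mem_idealAway hJ (isHomogeneous_X k i) (hb i) (hy i) (d + 1)
  · have h5 : g i j * L - g' i j = y j - y i := by
      apply algebraMap_frac_injective
      rw [map_sub, map_sub, map_mul, ← hg, ← hg', ← hy, ← hy]
      linear_combination algebraMap _ (Frac k) (varProd k) ^ n * hcb' i j
    have h6 := congrArg (algebraMap _ (Frac k)) (congrArg (homogeneousComponent (d + 1)) h5)
    rw [map_sub, map_sub, homogeneousComponent_add_mul hL, hg'd, map_sub, map_sub, map_mul,
      ← hg'] at h6
    change L • (algebraMap _ (Frac k) (homogeneousComponent d (g i j)) / _) - c' i j = _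
    rw [Algebra.smul_def, ← sub_div, ← h6]
    field_simp

/-- Multiplication by `L` on Hartshorne–Rao modules, for `L I ⊆ J`. -/
noncomputable def mulHR {I J : Ideal (CoordRing k)} (L : CoordRing k) (h : ∀ x ∈ I, L * x ∈ J) :
    HRModule I →ₗ[CoordRing k] HRModule J :=
  Submodule.mapQ _ _
    ((LinearMap.lsmul (CoordRing k) (Fin 4 → Fin 4 → Frac k) L).restrict
      (p := cocycles I) (q := cocycles J) fun c hc =>
        ⟨fun i j => by
          change L • c i j ∈ _
          rw [Algebra.smul_def]
          exact smul_mem_idealAway h (hc.1 i j), ((cocycles I).smul_mem L hc).2⟩)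
    (by
      rintro c ⟨b, hb, hcb⟩
      refine ⟨L • b, fun i => ?_, fun i j => ?_⟩
      · change L • b i ∈ _
        rw [Algebra.smul_def]
        exact smul_mem_idealAway h (hb i)
      · change L • c.1 i j = L • b j - L • b i
        rw [← smul_sub]
        exact congrArg _ (hcb i j))

theorem mkQ_eq_iff {I : Ideal (CoordRing k)} {c d : cocycles I} :
    ((coboundaries I).submoduleOf (cocycles I)).mkQ c =
      ((coboundaries I).submoduleOf (cocycles I)).mkQ d ↔ c.1 - d.1 ∈ coboundaries I :=
  Submodule.Quotient.eq _

theorem mem_HRDegree_iff {I : Ideal (CoordRing k)} {t : ℤ} {m : HRModule I} :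
    m ∈ HRDegree I t ↔ ∃ c : cocycles I, (∀ i j, c.1 i j ∈ fracDegree k t) ∧
      ((coboundaries I).submoduleOf (cocycles I)).mkQ c = m :=
  Iff.rfl

theorem hrShiftIso_mul_add {I : Ideal (CoordRing k)}
    (hI : I.IsHomogeneous (homogeneousSubmodule (Fin 4) k)) {F L : CoordRing k} {n : ℕ}
    (hFn : F.IsHomogeneous n) (hF : F ∈ I) (hL : L.IsHomogeneous 1) (hL₀ : L ≠ 0)
    (hFL : ∀ x, L ∣ F * x → L ∣ x) :
    HRShiftIso (Ideal.span {L} * I + Ideal.span {F}) I (-1) := by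
  set J := Ideal.span {L} * I + Ideal.span {F} with hJ
  have hJh : J.IsHomogeneous (homogeneousSubmodule (Fin 4) k) :=
    ((isHomogeneous_span_singleton hL).mul hI).sup (isHomogeneous_span_singleton hFn)
  have hLI : ∀ x ∈ I, L * x ∈ J := fun x hx => mul_mem_span_mul_add hx
  have hmk : ∀ c : cocycles I, ∃ c' : cocycles J, c'.1 = L • c.1 ∧
      mulHR L hLI (((coboundaries I).submoduleOf (cocycles I)).mkQ c) =
        ((coboundaries J).submoduleOf (cocycles J)).mkQ c' := fun c => ⟨_, rfl, rfl⟩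
  have hbij : Function.Bijective (mulHR L hLI) := by
    constructor
    · rw [injective_iff_map_eq_zero]
      intro m hm
      obtain ⟨c, rfl⟩ := Submodule.mkQ_surjective _ m
      obtain ⟨c', hc', h⟩ := hmk c
      rw [h, ← map_zero (Submodule.mkQ _), mkQ_eq_iff, hc', Submodule.coe_zero, sub_zero] at hm
      rw [← map_zero (Submodule.mkQ _), mkQ_eq_iff, Submodule.coe_zero, sub_zero]
      exact mem_coboundaries_of_smul_mem hF hL₀ hFL c.2 hm
    · intro m
      obtain ⟨c, rfl⟩ := Submodule.mkQ_surjective _ m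
      obtain ⟨a, ha, hac⟩ := exists_sub_smul_mem_coboundaries hF hL₀ hFL c.2
      obtain ⟨c', hc', h⟩ := hmk ⟨a, ha⟩
      refine ⟨_, h.trans ?_⟩
      rw [mkQ_eq_iff, hc']
      exact hac
  refine ⟨(LinearEquiv.ofBijective _ hbij).symm, fun t m => ?_⟩
  obtain ⟨m, rfl⟩ := (LinearEquiv.ofBijective _ hbij).surjective m
  rw [LinearEquiv.symm_apply_apply, LinearEquiv.ofBijective_apply]
  obtain ⟨c, rfl⟩ := Submodule.mkQ_surjective _ m
  obtain ⟨c', hc', h⟩ := hmk c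
  rw [h, mem_HRDegree_iff, mem_HRDegree_iff]
  constructor
  · rintro ⟨x, hx, hxc⟩
    rw [eq_comm, mkQ_eq_iff, hc'] at hxc
    obtain ⟨y, hy, hyt, hyx⟩ := exists_homogeneous_cocycle hI hJh hL (t := t + -1) c.2 x.2
      (fun i j => by rw [neg_add_cancel_right]; exact hx i j) hxc
    refine ⟨⟨y, hy⟩, hyt, mkQ_eq_iff.2 ?_⟩
    -- The homogeneous `y` has the same image under `L` as `c`, so injectivity identifies their
    -- classes.
    refine mem_coboundaries_of_smul_mem hF hL₀ hFL (Submodule.sub_mem _ hy c.2) ?_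
    have := Submodule.sub_mem _ hyx hxc
    rwa [sub_sub_sub_cancel_right, ← smul_sub] at this
  · rintro ⟨x, hx, hxc⟩
    obtain ⟨x', hx', h'⟩ := hmk x
    refine ⟨x', fun i j => ?_, by rw [← h', hxc, h]⟩
    rw [hx']
    change L • x.1 i j ∈ _
    rw [Algebra.smul_def, ← neg_add_cancel_right t 1]
    exact algebraMap_mul_mem_fracDegree hL (hx i j)

end HRShift
end ArrCurve

namespace ArrCurve
open MvPolynomial
-- Coprimality of `L` and `F`, and conclusion
section LinearFormFactor
variable {k : Type*} [Field k] {n : ℕ} {ℓ : Fin n → CoordRing k} {L : CoordRing k}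

namespace IsArrangement

/-- With a second plane present, `ℓ i ∣ L` would put `L` in the prime of a line; only the case of
one plane needs the extra assumption. -/
theorem linearIndependent_of_notMem_span (h : IsArrangement ℓ) (hn : n ≠ 0)
    (hL : L.IsHomogeneous 1) (hLC : ∀ i j, i ≠ j → L ∉ Ideal.span {ℓ i, ℓ j})
    (hL₁ : n = 1 → ∀ i, LinearIndependent k ![ℓ i, L]) (i : Fin n) :
    LinearIndependent k ![ℓ i, L] := by
  by_cases h1 : n = 1
  · exact hL₁ h1 i
  have : Nontrivial (Fin n) := Fin.nontrivial_iff_two_le.2 (by omega)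
  obtain ⟨j, hj⟩ := exists_ne i
  rw [linearIndependent_iff_not_dvd (h.isHomogeneous i) hL (h.ne_zero i)]
  exact fun hd => hLC i j hj.symm
    (Ideal.mem_of_dvd _ hd (Ideal.subset_span (Set.mem_insert _ _)))

theorem dvd_of_dvd_prod_mul (h : IsArrangement ℓ) (hL : L.IsHomogeneous 1) (hL₀ : L ≠ 0)
    (hLℓ : ∀ i, LinearIndependent k ![ℓ i, L]) {x : CoordRing k} (hx : L ∣ (∏ i, ℓ i) * x) :
    L ∣ x := by
  have hp := linearForm_prime hL hL₀
  refine (hp.dvd_or_dvd hx).resolve_left fun hd => ?_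
  obtain ⟨i, -, hi⟩ := hp.exists_mem_finset_dvd hd
  exact (linearIndependent_iff_not_dvd hL (h.isHomogeneous i) hL₀).1
    (LinearIndependent.pair_symm_iff.1 (hLℓ i)) hi

end IsArrangement
end LinearFormFactor
end ArrCurve

theorem proposition2p8 {k : Type*} [Field k] [CharZero k]
    -- an arrangement of `m ≥ 1` distinct planes `ℓ i = 0`
    (m : ℕ) (hm : 1 ≤ m) (ℓ : Fin m → ArrCurve.CoordRing k)
    (hℓ : ∀ i, (ℓ i).IsHomogeneous 1) (hℓ₀ : ∀ i, ℓ i ≠ 0)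
    (hind : Pairwise fun i j => LinearIndependent k ![ℓ i, ℓ j])
    (F : ArrCurve.CoordRing k) (hF : F = ∏ i, ℓ i)
    -- a linear form vanishing on no component of `C_F^red`
    (L : ArrCurve.CoordRing k) (hL : L.IsHomogeneous 1)
    (hLC : ∀ p ∈ (ArrCurve.redCurveIdeal F).minimalPrimes, L ∉ p)
    -- for a single plane `C_F^red` is empty, and `L F` has to define an arrangement
    (hL₁ : m = 1 → ∀ i, LinearIndependent k ![ℓ i, L]) :
    -- (i)
    ArrCurve.HRShiftIso (ArrCurve.topCurveIdeal (L * F)) (ArrCurve.topCurveIdeal F) (-1) ∧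
    ArrCurve.HRShiftIso (ArrCurve.redCurveIdeal (L * F)) (ArrCurve.redCurveIdeal F) (-1) ∧
    -- (ii)
    ArrCurve.topCurveIdeal (L * F) =
      Ideal.span {L} * ArrCurve.topCurveIdeal F + Ideal.span {F} ∧
    ArrCurve.redCurveIdeal (L * F) =
      Ideal.span {L} * ArrCurve.redCurveIdeal F + Ideal.span {F} ∧
    -- (iii)
    (ArrCurve.IsACM (ArrCurve.topCurveIdeal (L * F)) ↔
      ArrCurve.IsACM (ArrCurve.topCurveIdeal F)) ∧
    (ArrCurve.IsACM (ArrCurve.redCurveIdeal (L * F)) ↔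
      ArrCurve.IsACM (ArrCurve.redCurveIdeal F)) ∧
    ArrCurve.IsEvenlyLinked (ArrCurve.topCurveIdeal F) (ArrCurve.topCurveIdeal (L * F)) ∧
    ArrCurve.IsEvenlyLinked (ArrCurve.redCurveIdeal F) (ArrCurve.redCurveIdeal (L * F)) := by
  subst hF
  have h : ArrCurve.IsArrangement ℓ := ⟨hℓ, hℓ₀, fun i j hij => hind hij⟩
  have hn : m ≠ 0 := by omega
  have hLs := h.notMem_span_of_forall_minimalPrimes hn hLC
  have hLℓ := h.linearIndependent_of_notMem_span hn hL hLs hL₁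
  have hL₀ : L ≠ 0 := (hLℓ ⟨0, by omega⟩).ne_zero 1
  have hdvd := fun x => h.dvd_of_dvd_prod_mul hL hL₀ hLℓ (x := x)
  have htop := h.topCurveIdeal_mul hn hL hL₀ hLℓ hLs
  have hred := h.redCurveIdeal_mul hn hL hL₀ hLℓ hLs
  refine ⟨?_, ?_, htop, hred, h.isACM_topCurveIdeal_mul_iff hn hL hL₀ hLℓ hLs,
    h.isACM_redCurveIdeal_mul_iff hn hL hL₀ hLℓ hLs, ?_, ?_⟩
  · rw [htop]
    exact ArrCurve.hrShiftIso_mul_add (h.isHomogeneous_topCurveIdeal hn) h.isHomogeneous_prod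
      (h.prod_mem_topCurveIdeal hn) hL hL₀ hdvd
  · rw [hred]
    exact ArrCurve.hrShiftIso_mul_add (h.isHomogeneous_redCurveIdeal hn) h.isHomogeneous_prod
      (h.prod_mem_redCurveIdeal hn) hL hL₀ hdvd
  · rw [htop]
    exact h.isEvenlyLinked_topCurveIdeal hn hL hLℓ
  · rw [hred]
    exact h.isEvenlyLinked_redCurveIdeal hn hL hLℓ
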